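/- Let $\mathcal H$ be a complex separable Hilbert space, $\mathcal B(\mathcal H)$, $\mathcal B_\infty(\mathcal H)$, $\mathcal B_1(\mathcal H)$ its bounded, compact and trace class operators. For a bounded dissipative operator $T$ (i.e. $\operatorname{Im} T=(T-T^*)/(2i)\ge 0$) let $L$ be its minimal self-adjoint dilation in a Hilbert space $\mathcal K\supseteq\mathcal H$, so that $P_{\mathcal H}(L-z)^{-1}|_{\mathcal H}=(T-z)^{-1}$ for $\operatorname{Im} z<0$, and put $\Xi(T)=P_{\mathcal H}E_L((-\infty,0))|_{\mathcal H}$, where $E_L(\cdot)$ is the spectral measure of $L$ and $P_{\mathcal H}$ the orthogonal projection of $\mathcal K$ onto $\mathcal H$. A pair $(P,Q)$ of orthogonal projections in $\mathcal H$ is a Fredholm pair if $QP|_{\operatorname{ran}P}:\operatorname{ran}P\to\operatorname{ran}Q$ is a Fredholm operator; its Fredholm index is denoted $\operatorname{index}(P,Q)$. For $C\in\mathcal B(\mathcal H)$ and an orthogonal projection $Q$ in $\mathcal H$, the pair $(C,Q)$ has a trindex if there is an orthogonal projection $P$ with $C-P\in\mathcal B_1(\mathcal H)$ and $(P,Q)$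 a Fredholm pair; then $\operatorname{trindex}(C,Q)=\operatorname{tr}(C-P)+\operatorname{index}(P,Q)$, which does not depend on the choice of $P$. **Theorem.** Let $S=S^*\in\mathcal B(\mathcal H)$, $A=A^*\in\mathcal B_\infty(\mathcal H)$, $0\le B\in\mathcal B_1(\mathcal H)$, and suppose that $(S+A+\tau_0B)^{-1}\in\mathcal B(\mathcal H)$ for some $\tau_0\in\mathbb R$. Let $A_j=A_j^*\in\mathcal B_\infty(\mathcal H)$ and $0\le B_j\in\mathcal B_1(\mathcal H)$, $j\in\mathbb N$, be such that $\lim_{j\to\infty}\|A_j-A\|=0$ and $\lim_{j\to\infty}\|B_j-B\|_{\mathcal B_1(\mathcal H)}=0$. Then the pairs $(\Xi(S+A+iB),\Xi(S))$ and $(\Xi(S+A_j+iB_j),\Xi(S))$, $j\in\mathbb N$, have a trindex, and $$\lim_{j\to\infty}\operatorname{trindex}\big(\Xi(S+A_j+iB_j),\Xi(S)\big)=\operatorname{trindex}\big(\Xi(S+A+iB),\Xi(S)\big).$$ -/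

import Mathlib

open Filter Topology MeasureTheory
open scoped InnerProductSpace

noncomputable section

namespace Trindex

universe u

/-! ### Trace class operators on a Hilbert space -/

section TraceClass

variable (H : Type u) [NormedAddCommGroup H] [InnerProductSpace ℂ H] [CompleteSpace H]

/-- The index set of a fixed orthonormal basis of `H`. -/
def basisIndex : Set H := (exists_hilbertBasis ℂ H).choose

/-- A fixed orthonormal basis of `H`. -/
def stdBasis : HilbertBasis (basisIndex H) ℂ H := (exists_hilbertBasis ℂ H).choose_spec.choose

variable {H}

/-- The trace norm `tr |T| = ∑ ⟨eᵢ, |T| eᵢ⟩` with `|T| = (T* T)^{1/2}`, as an element of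
`[0, ∞]`. -/
def traceNorm (T : H →L[ℂ] H) : ENNReal :=
  ∑' i, ENNReal.ofReal (⟪stdBasis H i, CFC.abs T (stdBasis H i)⟫_ℂ).re

/-- `T` is of trace class: `tr |T| < ∞`. -/
def IsTraceClass (T : H →L[ℂ] H) : Prop := traceNorm T < ⊤

/-- The trace `∑ ⟨eᵢ, T eᵢ⟩` of a trace class operator. -/
def trace (T : H →L[ℂ] H) : ℂ := ∑' i, ⟪stdBasis H i, T (stdBasis H i)⟫_ℂ

end TraceClass

/-! ### Fredholm pairs of projections and the trindex -/

section Pairs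

variable {H : Type u} [NormedAddCommGroup H] [InnerProductSpace ℂ H] [CompleteSpace H]

/-- The map `QP|ran P : ran P → ran Q`. -/
def pairMap (P Q : H →L[ℂ] H) : P.range →L[ℂ] Q.range :=
  ((Q ∘L P) ∘L P.range.subtypeL).codRestrict Q.range
    (fun x => ⟨P (x : H), rfl⟩)

/-- `(P, Q)` is a Fredholm pair of orthogonal projections. -/
structure IsFredholmPair (P Q : H →L[ℂ] H) : Prop where
  left_proj : IsStarProjection P
  right_proj : IsStarProjection Q
  fredholm : (pairMap P Q).IsFredholm

/-- The Fredholm index `dim ker - dim coker` of `QP|ran P`. -/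
def pairIndex (P Q : H →L[ℂ] H) : ℤ :=
  (Module.finrank ℂ (pairMap P Q).ker : ℤ)
    - (Module.finrank ℂ (Q.range ⧸ (pairMap P Q).range) : ℤ)

/-- The pair `(A, Q)` has a trindex. -/
def HasTrindex (A Q : H →L[ℂ] H) : Prop :=
  ∃ P : H →L[ℂ] H, IsTraceClass (A - P) ∧ IsFredholmPair P Q

open Classical in
/-- `trindex (A, Q) = tr (A - P) + index (P, Q)` for an orthogonal projection `P` such that `A - P`
is of trace class and `(P, Q)` is a Fredholm pair (the value does not depend on `P`); it is set
to `0` if there is no such `P`. -/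
def trindex (A Q : H →L[ℂ] H) : ℂ :=
  if h : HasTrindex A Q then trace (A - h.choose) + (pairIndex h.choose Q : ℂ) else 0

end Pairs

/-! ### Spectral measures, self-adjoint dilations and the operator `Ξ` -/

/-- A projection-valued measure on the Borel sets of `ℝ`. By the spectral theorem these are the
spectral measures `E_L(·)` of the (possibly unbounded) self-adjoint operators
`L = ∫ λ dE_L(λ)` in `K`. -/
structure SpectralMeasure (K : Type u) [NormedAddCommGroup K] [InnerProductSpace ℂ K]
    [CompleteSpace K] where
  proj : Set ℝ → K →L[ℂ] K
  isStarProjection : ∀ s, MeasurableSet s → IsStarProjection (proj s)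
  proj_univ : proj Set.univ = 1
  hasSum_iUnion : ∀ f : ℕ → Set ℝ, (∀ n, MeasurableSet (f n)) →
    Pairwise (Function.onFun Disjoint f) →
    ∀ x : K, HasSum (fun n => proj (f n) x) (proj (⋃ n, f n) x)

namespace SpectralMeasure

variable {K : Type u} [NormedAddCommGroup K] [InnerProductSpace ℂ K] [CompleteSpace K]

theorem proj_empty (E : SpectralMeasure K) : E.proj ∅ = 0 := by
  ext x
  have h := E.hasSum_iUnion (fun _ => ∅) (fun _ => MeasurableSet.empty)
    (fun _ _ _ => by simp [Function.onFun]) x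
  have h1 := h.summable.tendsto_atTop_zero
  simpa using tendsto_nhds_unique tendsto_const_nhds h1

theorem inner_proj_nonneg (E : SpectralMeasure K) {s : Set ℝ} (hs : MeasurableSet s) (x : K) :
    0 ≤ (⟪x, E.proj s x⟫_ℂ).re := by
  have h := (E.isStarProjection s hs).nonneg
  exact (ContinuousLinearMap.nonneg_iff_isPositive _).mp h |>.re_inner_nonneg_right x

/-- The positive measure `s ↦ ⟨x, E(s) x⟩`. -/
def measure (E : SpectralMeasure K) (x : K) : Measure ℝ :=
  Measure.ofMeasurable (fun s _ => ENNReal.ofReal (⟪x, E.proj s x⟫_ℂ).re)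
    (by simp [E.proj_empty])
    (by
      intro f hf hd
      have h := E.hasSum_iUnion f hf hd x
      have h2 : HasSum (fun n => (⟪x, E.proj (f n) x⟫_ℂ).re)
          (⟪x, E.proj (⋃ n, f n) x⟫_ℂ).re :=
        Complex.hasSum_re (h.mapL (innerSL ℂ x))
      rw [← h2.tsum_eq]
      exact ENNReal.ofReal_tsum_of_nonneg (fun n => E.inner_proj_nonneg (hf n) x) h2.summable)

theorem measure_apply (E : SpectralMeasure K) (x : K) {s : Set ℝ} (hs : MeasurableSet s) :
    E.measure x s = ENNReal.ofReal (⟪x, E.proj s x⟫_ℂ).re :=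
  Measure.ofMeasurable_apply s hs

end SpectralMeasure

variable {H : Type u} [NormedAddCommGroup H] [InnerProductSpace ℂ H] [CompleteSpace H]

/-- A minimal self-adjoint dilation `L` of the bounded dissipative operator `T` in `H`: a Hilbert
space `K` with an isometric embedding `V : H → K` and a self-adjoint operator `L` in `K`, given by
its spectral measure `E`, such that `V* (L - z)⁻¹ V = (T - z)⁻¹` for `Im z < 0` (as quadratic
forms, with `(L - z)⁻¹ = ∫ (λ - z)⁻¹ dE(λ)`), and such that no proper closed subspace of `K` that
contains `V H` reduces `L`. -/
structure SelfAdjointDilation (T : H →L[ℂ] H) where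
  K : Type u
  [normedAddCommGroup : NormedAddCommGroup K]
  [innerProductSpace : InnerProductSpace ℂ K]
  [completeSpace : CompleteSpace K]
  V : H →ₗᵢ[ℂ] K
  E : SpectralMeasure K
  resolvent_eq : ∀ z : ℂ, z.im < 0 → ∀ x : H,
    ⟪x, Ring.inverse (T - z • (1 : H →L[ℂ] H)) x⟫_ℂ
      = ∫ t : ℝ, ((t : ℂ) - z)⁻¹ ∂(E.measure (V x))
  minimal : Dense (Submodule.span ℂ
    {y : K | ∃ s : Set ℝ, MeasurableSet s ∧ ∃ x : H, y = E.proj s (V x)} : Set K)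

attribute [instance] SelfAdjointDilation.normedAddCommGroup
  SelfAdjointDilation.innerProductSpace SelfAdjointDilation.completeSpace

/-- The compression `P_H E_L((-∞, 0))|_H` to `H` of the spectral projection of a dilation. -/
def SelfAdjointDilation.compression {T : H →L[ℂ] H} (D : SelfAdjointDilation T) : H →L[ℂ] H :=
  D.V.toContinuousLinearMap.adjoint ∘L D.E.proj (Set.Iio 0) ∘L D.V.toContinuousLinearMap

open Classical in
/-- The operator `Ξ(T) = P_H E_L((-∞, 0))|_H` of a bounded dissipative operator `T`, where `L` is
the minimal self-adjoint dilation of `T` (which exists for every dissipative `T` and is unique up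
to unitary equivalence; `Ξ(T)` is set to `0` for the other `T`). -/
def Xi (T : H →L[ℂ] H) : H →L[ℂ] H :=
  if h : Nonempty (SelfAdjointDilation T) then h.some.compression else 0

end Trindex

end

/-!
For an invertible dissipative operator `T` put
`negSpec T = ½ - π⁻¹ ∫₀^∞ Re (T + iy)⁻¹ dy`. If `T` is self-adjoint, this is the spectral projection
of `T` for the negative half-line (`isStarProjection_negSpec`); in general it is `Ξ(T)`, because
`½ - π⁻¹ ∫₀^∞ Re (t + iy)⁻¹ dy` is the indicator function of `t < 0` up to its value at `0`, and
the integral may be moved through the dilation (`SelfAdjointDilation.compression_eq`). If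
`T = S + A + iB` is a compact perturbation of an invertible operator but not invertible itself, its
kernel is finite-dimensional and reduces `T`, and `Ξ(T) = negSpec (T + P)` with `P` the projection
onto the kernel. All of this presupposes that `T` has a minimal self-adjoint dilation
(`nonempty_selfAdjointDilation`): the Poisson kernel of the Cayley transform gives the measures
`⟨x, F(·) x⟩` of a positive operator measure `F`, and the dilation lives in the Hilbert space with
reproducing kernel `F(s ∩ t)`.

By the second resolvent identity the difference of two operators `negSpec` is the integral of
`(T + iy)⁻¹ (T' - T) (T' + iy)⁻¹` and its adjoint. Hence `negSpec T - negSpec T'` is compact or of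
trace class together with `T' - T`, with bounds (`traceBound_negSpec_sub`,
`norm_negSpec_sub_le`). So `(Ξ(S + A + iB), Ξ(S))` has a trindex, and for self-adjoint `R` that
differs from `S` by a compact operator and from `T = S + A + iB` by one of trace class it equals
`tr (negSpec T - negSpec R) + index (negSpec R, Ξ(S))`. That the choice of the projection does not
matter (`trindex_eq`) rests on the additivity of the index (`pairIndex_add`) and on the formula
`tr (P - Q) = index (P, Q)` for projections with a trace class difference
(`trace_sub_eq_pairIndex`).

For the limit one takes `R = S + A + τ₀B` and `R_j = S + A_j + τ₀B_j`. A vector in the kernel of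
`S + A + iB` lies in the kernels of `B` and of `S + A`, so `S + A + iB` is invertible along with `R`,
and all the operators are invertible with uniform bounds for large `j`. Then `negSpec R_j` converges
in norm to `negSpec R`, so the index is eventually constant, and the trace term converges because
`R_j - T_j = (τ₀ - i) B_j` converges in trace norm and the resolvents converge in norm
(`traceBound_negSpec_sub_sub`).
-/

noncomputable section

namespace Trindex

universe u

/-! ### Trace class operators -/

section TraceClassTheory

variable {H : Type u} [NormedAddCommGroup H] [InnerProductSpace ℂ H] [CompleteSpace H]

theorem hasSum_norm_sq_inner {ι : Type*} (b : HilbertBasis ι ℂ H) (y : H) :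
    HasSum (fun k => ‖⟪b k, y⟫_ℂ‖ ^ 2) (‖y‖ ^ 2) := by
  have h := b.hasSum_inner_mul_inner y y
  have h2 := Complex.hasSum_re h
  have h3 : (⟪y, y⟫_ℂ).re = ‖y‖ ^ 2 := by
    rw [inner_self_eq_norm_sq_to_K]; norm_cast
  rw [h3] at h2
  convert h2 using 2 with k
  rw [← inner_conj_symm y, Complex.conj_mul']
  norm_cast

theorem tsum_enorm_sq_inner {ι : Type*} (b : HilbertBasis ι ℂ H) (y : H) :
    ∑' k, ENNReal.ofReal (‖⟪b k, y⟫_ℂ‖ ^ 2) = ENNReal.ofReal (‖y‖ ^ 2) := by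
  rw [← (hasSum_norm_sq_inner b y).tsum_eq,
    ENNReal.ofReal_tsum_of_nonneg (fun _ => by positivity) (hasSum_norm_sq_inner b y).summable]

/-- The square of the Hilbert–Schmidt norm of `X`, as an element of `[0, ∞]`. -/
def hsSq (X : H →L[ℂ] H) : ENNReal := ∑' i, ENNReal.ofReal (‖X (stdBasis H i)‖ ^ 2)

theorem hsSq_adjoint (X : H →L[ℂ] H) : hsSq (star X) = hsSq X := by
  unfold hsSq
  simp_rw [← tsum_enorm_sq_inner (stdBasis H)]
  rw [ENNReal.tsum_comm]
  congr! 5 with i k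
  rw [ContinuousLinearMap.star_eq_adjoint, ContinuousLinearMap.adjoint_inner_right,
    ← inner_conj_symm, RCLike.norm_conj]

theorem hsSq_mul_left_le (Y X : H →L[ℂ] H) :
    hsSq (Y * X) ≤ ENNReal.ofReal (‖Y‖ ^ 2) * hsSq X := by
  unfold hsSq
  rw [← ENNReal.tsum_mul_left]
  refine ENNReal.tsum_le_tsum fun i => ?_
  rw [← ENNReal.ofReal_mul (by positivity), ← mul_pow]
  gcongr
  exact Y.le_opNorm _

theorem hsSq_mul_right_le (X Y : H →L[ℂ] H) :
    hsSq (X * Y) ≤ ENNReal.ofReal (‖Y‖ ^ 2) * hsSq X := by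
  rw [← hsSq_adjoint (X * Y), star_mul, ← hsSq_adjoint X, ← norm_star Y]
  exact hsSq_mul_left_le _ _

theorem ofReal_norm_sq_le_hsSq (X : H →L[ℂ] H) : ENNReal.ofReal (‖X‖ ^ 2) ≤ hsSq X := by
  by_cases htop : hsSq X = ⊤
  · rw [htop]; exact le_top
  have key : ∀ x, ‖X x‖ ≤ √(hsSq X).toReal * ‖x‖ := by
    intro x
    have h1 : ENNReal.ofReal (‖X x‖ ^ 2) ≤ hsSq X * ENNReal.ofReal (‖x‖ ^ 2) := by
      rw [← tsum_enorm_sq_inner (stdBasis H), ← hsSq_adjoint X, hsSq, ← ENNReal.tsum_mul_right]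
      refine ENNReal.tsum_le_tsum fun k => ?_
      rw [← ENNReal.ofReal_mul (by positivity), ← mul_pow, ← ContinuousLinearMap.adjoint_inner_left,
        ← ContinuousLinearMap.star_eq_adjoint]
      gcongr
      exact norm_inner_le_norm _ _
    have h2 := ENNReal.toReal_mono (ENNReal.mul_ne_top htop ENNReal.ofReal_ne_top) h1
    rw [ENNReal.toReal_mul, ENNReal.toReal_ofReal (by positivity),
      ENNReal.toReal_ofReal (by positivity)] at h2
    rw [← abs_of_nonneg (norm_nonneg (X x)), ← abs_of_nonneg (norm_nonneg x),
      ← Real.sqrt_sq_eq_abs, ← Real.sqrt_sq_eq_abs, ← Real.sqrt_mul ENNReal.toReal_nonneg]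
    exact Real.sqrt_le_sqrt h2
  have h3 := X.opNorm_le_bound (Real.sqrt_nonneg _) key
  rw [← ENNReal.ofReal_toReal htop]
  refine ENNReal.ofReal_le_ofReal ?_
  calc ‖X‖ ^ 2 ≤ √(hsSq X).toReal ^ 2 := by gcongr
    _ = _ := Real.sq_sqrt ENNReal.toReal_nonneg

theorem sum_norm_sq_le_of_hsSq_le {X : H →L[ℂ] H} {C : ℝ} (hC : 0 ≤ C)
    (h : hsSq X ≤ ENNReal.ofReal C) (F : Finset (basisIndex H)) :
    ∑ i ∈ F, ‖X (stdBasis H i)‖ ^ 2 ≤ C := by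
  have h1 : ENNReal.ofReal (∑ i ∈ F, ‖X (stdBasis H i)‖ ^ 2) ≤ ENNReal.ofReal C := by
    rw [ENNReal.ofReal_sum_of_nonneg (fun _ _ => by positivity)]
    exact (ENNReal.sum_le_tsum F).trans h
  exact (ENNReal.ofReal_le_ofReal_iff hC).1 h1

theorem summable_norm_sq_of_hsSq {X : H →L[ℂ] H} (h : hsSq X ≠ ⊤) :
    Summable fun i => ‖X (stdBasis H i)‖ ^ 2 := by
  have := ENNReal.summable_toReal h
  simpa [ENNReal.toReal_ofReal, sq_nonneg] using this

/-- A quantitative form of "the trace norm of `T` is at most `C`", tested against pairs of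
contractions. It is manifestly stable under sums, two-sided multiplication and integration, and on
self-adjoint operators finiteness of such a bound agrees with `IsTraceClass`. -/
def TraceBound (T : H →L[ℂ] H) (C : ℝ) : Prop :=
  ∀ U V : H →L[ℂ] H, ‖U‖ ≤ 1 → ‖V‖ ≤ 1 → ∀ F : Finset (basisIndex H),
    ∑ i ∈ F, ‖⟪U (stdBasis H i), T (V (stdBasis H i))⟫_ℂ‖ ≤ C

namespace TraceBound

variable {T T' : H →L[ℂ] H} {C C' : ℝ}

theorem nonneg (h : TraceBound T C) : 0 ≤ C := by
  simpa using h 0 0 (by simp) (by simp) ∅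

theorem mono (h : TraceBound T C) (hC : C ≤ C') : TraceBound T C' :=
  fun U V hU hV F => (h U V hU hV F).trans hC

theorem add (h : TraceBound T C) (h' : TraceBound T' C') : TraceBound (T + T') (C + C') := by
  intro U V hU hV F
  refine le_trans ?_ (add_le_add (h U V hU hV F) (h' U V hU hV F))
  rw [← Finset.sum_add_distrib]
  refine Finset.sum_le_sum fun i _ => ?_
  rw [_root_.add_apply, inner_add_right]
  exact norm_add_le _ _

theorem smul (h : TraceBound T C) (c : ℂ) : TraceBound (c • T) (‖c‖ * C) := by
  intro U V hU hV F
  refine le_trans (le_of_eq ?_) (mul_le_mul_of_nonneg_left (h U V hU hV F) (norm_nonneg c))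
  rw [Finset.mul_sum]
  refine Finset.sum_congr rfl fun i _ => ?_
  rw [_root_.smul_apply, inner_smul_right, norm_mul]

theorem neg (h : TraceBound T C) : TraceBound (-T) C := by
  simpa using h.smul (-1)

theorem sub (h : TraceBound T C) (h' : TraceBound T' C') : TraceBound (T - T') (C + C') := by
  rw [sub_eq_add_neg]; exact h.add h'.neg

theorem star (h : TraceBound T C) : TraceBound (star T) C := by
  intro U V hU hV F
  refine le_trans (le_of_eq ?_) (h V U hV hU F)
  refine Finset.sum_congr rfl fun i _ => ?_
  rw [ContinuousLinearMap.star_eq_adjoint, ContinuousLinearMap.adjoint_inner_right,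
    ← inner_conj_symm, RCLike.norm_conj]

theorem mul_mul (h : TraceBound T C) (X Y : H →L[ℂ] H) :
    TraceBound (X * T * Y) (‖X‖ * C * ‖Y‖) := by
  intro U V hU hV F
  rcases eq_or_ne X 0 with rfl | hX
  · simp
  rcases eq_or_ne Y 0 with rfl | hY
  · simp
  -- `‖X‖⁻¹ X* U` and `‖Y‖⁻¹ Y V` are again contractions.
  have hX0 : (0 : ℝ) < ‖X‖ := norm_pos_iff.2 hX
  have hY0 : (0 : ℝ) < ‖Y‖ := norm_pos_iff.2 hY
  have hU' : ‖((‖X‖⁻¹ : ℝ) : ℂ) • (Star.star X * U)‖ ≤ 1 := by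
    rw [norm_smul, Complex.norm_real, norm_inv, norm_norm]
    have : ‖Star.star X * U‖ ≤ ‖X‖ * 1 := by
      refine (norm_mul_le _ _).trans ?_
      rw [norm_star]; gcongr
    rw [inv_mul_le_iff₀ hX0]; exact this
  have hV' : ‖((‖Y‖⁻¹ : ℝ) : ℂ) • (Y * V)‖ ≤ 1 := by
    rw [norm_smul, Complex.norm_real, norm_inv, norm_norm]
    have : ‖Y * V‖ ≤ ‖Y‖ * 1 := by
      refine (norm_mul_le _ _).trans ?_
      gcongr
    rw [inv_mul_le_iff₀ hY0]; exact this
  have := h _ _ hU' hV' F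
  calc ∑ i ∈ F, ‖⟪U (stdBasis H i), (X * T * Y) (V (stdBasis H i))⟫_ℂ‖
      = ‖X‖ * (∑ i ∈ F, ‖⟪(((‖X‖⁻¹ : ℝ) : ℂ) • (Star.star X * U)) (stdBasis H i),
          T ((((‖Y‖⁻¹ : ℝ) : ℂ) • (Y * V)) (stdBasis H i))⟫_ℂ‖) * ‖Y‖ := by
        rw [Finset.mul_sum, Finset.sum_mul]
        refine Finset.sum_congr rfl fun i _ => ?_
        simp only [_root_.smul_apply, mul_apply_eq_comp, map_smul, inner_smul_left,
          inner_smul_right, norm_mul, Complex.conj_ofReal, Complex.norm_real, norm_inv, norm_norm,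
          ContinuousLinearMap.star_eq_adjoint, ContinuousLinearMap.adjoint_inner_left]
        field_simp
    _ ≤ ‖X‖ * C * ‖Y‖ := by gcongr

theorem mul_left (h : TraceBound T C) (X : H →L[ℂ] H) : TraceBound (X * T) (‖X‖ * C) := by
  have := h.mul_mul X 1
  rw [mul_one] at this
  refine this.mono (mul_le_of_le_one_right (mul_nonneg (norm_nonneg _) h.nonneg) ?_)
  exact ContinuousLinearMap.norm_id_le

theorem mul_right (h : TraceBound T C) (Y : H →L[ℂ] H) : TraceBound (T * Y) (C * ‖Y‖) := by
  have := h.mul_mul 1 Y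
  rw [one_mul] at this
  refine this.mono (mul_le_mul_of_nonneg_right (mul_le_of_le_one_left h.nonneg ?_) (norm_nonneg _))
  exact ContinuousLinearMap.norm_id_le

/-- Trace bounds pass to integrals, since each finite sum in the definition does. -/
theorem integral {α : Type*} [MeasurableSpace α] {μ : Measure α} {f : α → H →L[ℂ] H} {g : α → ℝ}
    (hf : Integrable f μ) (hg : Integrable g μ) (h : ∀ᵐ a ∂μ, TraceBound (f a) (g a)) :
    TraceBound (∫ a, f a ∂μ) (∫ a, g a ∂μ) := by
  intro U V hU hV F
  have key : ∀ i, ⟪U (stdBasis H i), (∫ a, f a ∂μ) (V (stdBasis H i))⟫_ℂ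
      = ∫ a, ⟪U (stdBasis H i), f a (V (stdBasis H i))⟫_ℂ ∂μ := by
    intro i
    rw [ContinuousLinearMap.integral_apply hf]
    exact (integral_inner (hf.apply_continuousLinearMap _) _).symm
  have hint : ∀ i, Integrable (fun a => ⟪U (stdBasis H i), f a (V (stdBasis H i))⟫_ℂ) μ :=
    fun i => (hf.apply_continuousLinearMap _).const_inner _
  calc ∑ i ∈ F, ‖⟪U (stdBasis H i), (∫ a, f a ∂μ) (V (stdBasis H i))⟫_ℂ‖
      ≤ ∑ i ∈ F, ∫ a, ‖⟪U (stdBasis H i), f a (V (stdBasis H i))⟫_ℂ‖ ∂μ := by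
        refine Finset.sum_le_sum fun i _ => ?_
        rw [key]; exact norm_integral_le_integral_norm _
    _ = ∫ a, ∑ i ∈ F, ‖⟪U (stdBasis H i), f a (V (stdBasis H i))⟫_ℂ‖ ∂μ := by
        rw [integral_finsetSum _ fun i _ => (hint i).norm]
    _ ≤ ∫ a, g a ∂μ := by
        refine integral_mono_ae (integrable_finsetSum _ fun i _ => (hint i).norm) hg ?_
        filter_upwards [h] with a ha using ha U V hU hV F

theorem sum_diag_le (h : TraceBound T C) (F : Finset (basisIndex H)) :
    ∑ i ∈ F, ‖⟪stdBasis H i, T (stdBasis H i)⟫_ℂ‖ ≤ C := by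
  simpa using h 1 1 ContinuousLinearMap.norm_id_le ContinuousLinearMap.norm_id_le F

theorem summable_diag (h : TraceBound T C) :
    Summable fun i => ⟪stdBasis H i, T (stdBasis H i)⟫_ℂ :=
  (summable_of_sum_le (fun _ => norm_nonneg _) h.sum_diag_le).of_norm

theorem norm_trace_le (h : TraceBound T C) : ‖trace T‖ ≤ C := by
  have hs : Summable fun i => ‖⟪stdBasis H i, T (stdBasis H i)⟫_ℂ‖ :=
    summable_of_sum_le (fun _ => norm_nonneg _) h.sum_diag_le
  exact (norm_tsum_le_tsum_norm hs).trans (hs.tsum_le_of_sum_le h.sum_diag_le)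

theorem trace_add (h : TraceBound T C) (h' : TraceBound T' C') :
    trace (T + T') = trace T + trace T' := by
  unfold trace
  rw [← h.summable_diag.tsum_add h'.summable_diag]
  simp

theorem trace_sub (h : TraceBound T C) (h' : TraceBound T' C') :
    trace (T - T') = trace T - trace T' := by
  unfold trace
  rw [← h.summable_diag.tsum_sub h'.summable_diag]
  simp

end TraceBound

theorem trace_neg (T : H →L[ℂ] H) : trace (-T) = -trace T := by
  unfold trace
  rw [← tsum_neg]
  simp

theorem sqrt_facts {X : H →L[ℂ] H} (hX : 0 ≤ X) :
    star (CFC.sqrt X) = CFC.sqrt X ∧ CFC.sqrt X * CFC.sqrt X = X :=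
  ⟨(IsSelfAdjoint.of_nonneg (CFC.sqrt_nonneg X)).star_eq, CFC.sqrt_mul_sqrt_self X hX⟩

theorem inner_sqrt_mul_sqrt {X : H →L[ℂ] H} (hX : 0 ≤ X) (u v : H) :
    ⟪u, X v⟫_ℂ = ⟪CFC.sqrt X u, CFC.sqrt X v⟫_ℂ := by
  obtain ⟨h1, h2⟩ := sqrt_facts hX
  conv_lhs => rw [← h2]
  rw [mul_apply_eq_comp, ← ContinuousLinearMap.adjoint_inner_left,
    ← ContinuousLinearMap.star_eq_adjoint, h1]

theorem hsSq_sqrt {X : H →L[ℂ] H} (hX : 0 ≤ X) :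
    hsSq (CFC.sqrt X) = ∑' i, ENNReal.ofReal (⟪stdBasis H i, X (stdBasis H i)⟫_ℂ).re := by
  unfold hsSq
  congr! 3 with i
  rw [inner_sqrt_mul_sqrt hX, inner_self_eq_norm_sq_to_K]
  norm_cast

/-- A positive operator is bounded by the sum of its diagonal, by the Cauchy–Schwarz inequality
for the Hilbert–Schmidt operators `X^{1/2} U` and `X^{1/2} V`. -/
theorem traceBound_of_nonneg {X : H →L[ℂ] H} (hX : 0 ≤ X) {C : ℝ} (hC : 0 ≤ C)
    (h : ∑' i, ENNReal.ofReal (⟪stdBasis H i, X (stdBasis H i)⟫_ℂ).re ≤ ENNReal.ofReal C) :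
    TraceBound X C := by
  intro U V hU hV F
  rw [← hsSq_sqrt hX] at h
  have aux : ∀ U : H →L[ℂ] H, ‖U‖ ≤ 1 →
      ∑ i ∈ F, ‖CFC.sqrt X (U (stdBasis H i))‖ ^ 2 ≤ C := by
    intro U hU
    refine sum_norm_sq_le_of_hsSq_le (X := CFC.sqrt X * U) hC ?_ F
    refine (hsSq_mul_right_le _ _).trans (le_trans ?_ h)
    refine mul_le_of_le_one_left (zero_le) ?_
    rw [ENNReal.ofReal_le_one]
    exact pow_le_one₀ (norm_nonneg _) hU
  calc ∑ i ∈ F, ‖⟪U (stdBasis H i), X (V (stdBasis H i))⟫_ℂ‖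
      ≤ ∑ i ∈ F, (‖CFC.sqrt X (U (stdBasis H i))‖ ^ 2 / 2
          + ‖CFC.sqrt X (V (stdBasis H i))‖ ^ 2 / 2) := by
        refine Finset.sum_le_sum fun i _ => ?_
        rw [inner_sqrt_mul_sqrt hX]
        refine (norm_inner_le_norm _ _).trans ?_
        nlinarith [sq_nonneg (‖CFC.sqrt X (U (stdBasis H i))‖
          - ‖CFC.sqrt X (V (stdBasis H i))‖)]
    _ ≤ C := by
        rw [Finset.sum_add_distrib, ← Finset.sum_div, ← Finset.sum_div]
        linarith [aux U hU, aux V hV]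

theorem re_inner_le_of_le {X Y : H →L[ℂ] H} (h : X ≤ Y) (x : H) :
    (⟪x, X x⟫_ℂ).re ≤ (⟪x, Y x⟫_ℂ).re := by
  have := ((ContinuousLinearMap.le_def _ _).1 h).re_inner_nonneg_right x
  simp only [FunLike.coe_sub, Pi.sub_apply, inner_sub_right, map_sub] at this
  simpa using this

/-- A self-adjoint `X` is `2 X⁺ - |X|` with `0 ≤ X⁺ ≤ |X|`, so its trace norm controls it. -/
theorem traceBound_of_traceNorm_le {X : H →L[ℂ] H} (hX : IsSelfAdjoint X) {C : ℝ} (hC : 0 ≤ C)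
    (h : traceNorm X ≤ ENNReal.ofReal C) : TraceBound X (3 * C) := by
  have h1 : TraceBound (CFC.abs X) C := traceBound_of_nonneg (CFC.abs_nonneg X) hC h
  have h2 : TraceBound X⁺ C := by
    refine traceBound_of_nonneg (CFC.posPart_nonneg X) hC (le_trans ?_ h)
    refine ENNReal.tsum_le_tsum fun i => ENNReal.ofReal_le_ofReal (re_inner_le_of_le ?_ _)
    rw [← CFC.posPart_add_negPart X hX]
    exact le_add_of_nonneg_right (CFC.negPart_nonneg X)
  have h3 : X = (2 : ℂ) • X⁺ - CFC.abs X := by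
    rw [eq_sub_iff_add_eq, add_comm, CFC.abs_add_self X hX, two_smul, two_smul]
  rw [h3]
  refine ((h2.smul 2).sub h1).mono (le_of_eq ?_)
  simp; ring

theorem traceBound_of_isTraceClass {X : H →L[ℂ] H} (hX : IsSelfAdjoint X) (h : IsTraceClass X) :
    TraceBound X (3 * (traceNorm X).toReal) :=
  traceBound_of_traceNorm_le hX ENNReal.toReal_nonneg (ENNReal.ofReal_toReal h.ne).ge

/-- For self-adjoint `X` and `f_ε(t) = t / (|t| + ε)` one has `|X| ≤ f_ε(X) X + ε`, and `f_ε(X)`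
is a contraction. -/
theorem TraceBound.traceNorm_le {X : H →L[ℂ] H} (hX : IsSelfAdjoint X) {C : ℝ}
    (h : TraceBound X C) : traceNorm X ≤ ENNReal.ofReal C := by
  unfold traceNorm
  rw [ENNReal.tsum_eq_iSup_sum]
  refine iSup_le fun F => ?_
  have hpos : ∀ i, 0 ≤ (⟪stdBasis H i, CFC.abs X (stdBasis H i)⟫_ℂ).re := fun i =>
    ((ContinuousLinearMap.nonneg_iff_isPositive _).mp (CFC.abs_nonneg X)).re_inner_nonneg_right _
  rw [← ENNReal.ofReal_sum_of_nonneg fun i _ => hpos i]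
  refine ENNReal.ofReal_le_ofReal ?_
  have key : ∀ ε : ℝ, 0 < ε →
      ∑ i ∈ F, (⟪stdBasis H i, CFC.abs X (stdBasis H i)⟫_ℂ).re ≤ C + ε * F.card := by
    intro ε hε
    have hden : ∀ t : ℝ, 0 < ‖t‖ + ε := fun t => by positivity
    set f : ℝ → ℝ := fun t => t / (‖t‖ + ε) with hf
    have hfc : Continuous f := continuous_id.div (by fun_prop) fun t => (hden t).ne'
    set J : H →L[ℂ] H := cfc f X with hJ
    have hJn : ‖J‖ ≤ 1 := norm_cfc_le zero_le_one fun t _ => by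
      rw [hf, norm_div, Real.norm_of_nonneg (hden t).le, div_le_one (hden t)]
      linarith
    have hJs : Star.star J = J := (cfc_predicate f X : IsSelfAdjoint J).star_eq
    have hle : CFC.abs X ≤ J * X + (ε : ℝ) • (1 : H →L[ℂ] H) := by
      have e1 : J * X = cfc (fun t => f t * t) X := by
        rw [cfc_mul f (fun t => t) X (by fun_prop) (by fun_prop), cfc_id' ℝ X]
      have e2 : J * X + (ε : ℝ) • (1 : H →L[ℂ] H) = cfc (fun t => f t * t + ε) X := by
        rw [cfc_add_const ε (fun t => f t * t) X (by fun_prop), e1, Algebra.algebraMap_eq_smul_one]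
      rw [e2, CFC.abs_eq_cfc_norm X hX]
      refine cfc_mono (fun t _ => ?_) (by fun_prop) (by fun_prop)
      have : f t * t + ε - ‖t‖ = ε ^ 2 / (‖t‖ + ε) := by
        have h0 := (hden t).ne'
        have hh : ‖t‖ ^ 2 = t ^ 2 := by rw [Real.norm_eq_abs, sq_abs]
        rw [hf]; field_simp; linear_combination -hh
      have h2 : 0 ≤ ε ^ 2 / (‖t‖ + ε) := by positivity
      linarith
    have hb := h J 1 hJn ContinuousLinearMap.norm_id_le F
    calc ∑ i ∈ F, (⟪stdBasis H i, CFC.abs X (stdBasis H i)⟫_ℂ).re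
        ≤ ∑ i ∈ F, (‖⟪J (stdBasis H i), X ((1 : H →L[ℂ] H) (stdBasis H i))⟫_ℂ‖ + ε) := by
          refine Finset.sum_le_sum fun i _ => (re_inner_le_of_le hle _).trans ?_
          have hn : ‖stdBasis H i‖ = 1 := (stdBasis H).orthonormal.1 i
          have h1 : ⟪stdBasis H i, (J * X + (ε : ℝ) • (1 : H →L[ℂ] H)) (stdBasis H i)⟫_ℂ
              = ⟪J (stdBasis H i), X (stdBasis H i)⟫_ℂ + ε := by
            rw [_root_.add_apply, inner_add_right, mul_apply_eq_comp,
              ← ContinuousLinearMap.adjoint_inner_left, ← ContinuousLinearMap.star_eq_adjoint, hJs]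
            congr 1
            rw [_root_.smul_apply, one_apply_eq_self, RCLike.real_smul_eq_coe_smul (K := ℂ),
              inner_smul_right, inner_self_eq_norm_sq_to_K, hn]
            simp
          rw [h1, Complex.add_re, Complex.ofReal_re, one_apply_eq_self]
          gcongr
          exact Complex.re_le_norm _
      _ ≤ C + ε * F.card := by
          rw [Finset.sum_add_distrib, Finset.sum_const, nsmul_eq_mul, mul_comm ε]
          gcongr
  have hlim : Tendsto (fun ε : ℝ => C + ε * F.card) (𝓝[>] 0) (𝓝 (C + 0 * F.card)) := by
    refine Tendsto.mono_left ?_ nhdsWithin_le_nhds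
    exact (Continuous.tendsto (by fun_prop) 0)
  rw [zero_mul, add_zero] at hlim
  exact ge_of_tendsto hlim (by filter_upwards [self_mem_nhdsWithin] with ε hε using key ε hε)

theorem TraceBound.isTraceClass {X : H →L[ℂ] H} (hX : IsSelfAdjoint X) {C : ℝ}
    (h : TraceBound X C) : IsTraceClass X :=
  (h.traceNorm_le hX).trans_lt ENNReal.ofReal_lt_top

theorem inner_mul_basis_eq_tsum {ι : Type*} (e : HilbertBasis ι ℂ H) (A B : H →L[ℂ] H) (i : ι) :
    ⟪e i, (A * B) (e i)⟫_ℂ = ∑' k, ⟪e i, A (e k)⟫_ℂ * ⟪e k, B (e i)⟫_ℂ := by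
  rw [mul_apply_eq_comp, ← ContinuousLinearMap.adjoint_inner_left, ← e.tsum_inner_mul_inner]
  simp_rw [ContinuousLinearMap.adjoint_inner_left]

theorem summable_matrix_norm_sq {X : H →L[ℂ] H} (hX : hsSq X ≠ ⊤) :
    Summable fun p : basisIndex H × basisIndex H =>
      ‖⟪stdBasis H p.2, X (stdBasis H p.1)⟫_ℂ‖ ^ 2 := by
  rw [summable_prod_of_nonneg fun _ => by positivity]
  refine ⟨fun i => (hasSum_norm_sq_inner (stdBasis H) (X (stdBasis H i))).summable, ?_⟩
  refine (summable_norm_sq_of_hsSq hX).congr fun i => ?_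
  exact (hasSum_norm_sq_inner (stdBasis H) (X (stdBasis H i))).tsum_eq.symm

theorem summable_matrix_mul {A B : H →L[ℂ] H} (hA : hsSq A ≠ ⊤) (hB : hsSq B ≠ ⊤) :
    Summable fun p : basisIndex H × basisIndex H =>
      ⟪stdBasis H p.1, A (stdBasis H p.2)⟫_ℂ * ⟪stdBasis H p.2, B (stdBasis H p.1)⟫_ℂ := by
  have h1 : Summable fun p : basisIndex H × basisIndex H =>
      ‖⟪stdBasis H p.1, A (stdBasis H p.2)⟫_ℂ‖ ^ 2 :=
    (summable_matrix_norm_sq hA).comp_injective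
      (i := fun p : basisIndex H × basisIndex H => (p.2, p.1)) Prod.swap_injective
  refine Summable.of_norm_bounded (h1.add (summable_matrix_norm_sq hB)) fun p => ?_
  rw [norm_mul]
  generalize ‖⟪stdBasis H p.1, A (stdBasis H p.2)⟫_ℂ‖ = a
  generalize ‖⟪stdBasis H p.2, B (stdBasis H p.1)⟫_ℂ‖ = b
  nlinarith [sq_nonneg (a - b), sq_nonneg (a + b)]

/-- The trace is cyclic on products of two Hilbert–Schmidt operators. -/
theorem trace_mul_comm_of_hsSq {A B : H →L[ℂ] H} (hA : hsSq A ≠ ⊤) (hB : hsSq B ≠ ⊤) :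
    trace (A * B) = trace (B * A) := by
  have hcomm := Summable.tsum_comm (f := fun i k : basisIndex H =>
    ⟪stdBasis H i, A (stdBasis H k)⟫_ℂ * ⟪stdBasis H k, B (stdBasis H i)⟫_ℂ)
    (summable_matrix_mul hA hB)
  calc trace (A * B)
      = ∑' i, ∑' k, ⟪stdBasis H i, A (stdBasis H k)⟫_ℂ * ⟪stdBasis H k, B (stdBasis H i)⟫_ℂ :=
        tsum_congr fun i => inner_mul_basis_eq_tsum (stdBasis H) A B i
    _ = ∑' k, ∑' i, ⟪stdBasis H i, A (stdBasis H k)⟫_ℂ * ⟪stdBasis H k, B (stdBasis H i)⟫_ℂ :=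
        hcomm.symm
    _ = ∑' k, ∑' i, ⟪stdBasis H k, B (stdBasis H i)⟫_ℂ * ⟪stdBasis H i, A (stdBasis H k)⟫_ℂ :=
        tsum_congr fun k => tsum_congr fun i => mul_comm _ _
    _ = trace (B * A) :=
        tsum_congr fun k => (inner_mul_basis_eq_tsum (stdBasis H) B A k).symm

/-- `X Y` is the product of the Hilbert–Schmidt operators `X^{1/2}` and `X^{1/2} Y`. -/
theorem trace_mul_comm_of_nonneg {X : H →L[ℂ] H} (hX : 0 ≤ X) {C : ℝ} (h : TraceBound X C)
    (Y : H →L[ℂ] H) : trace (X * Y) = trace (Y * X) := by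
  set R := CFC.sqrt X with hR
  have h1 : R * R = X := (sqrt_facts hX).2
  have hRs : hsSq R ≠ ⊤ := by
    have := h.isTraceClass (IsSelfAdjoint.of_nonneg hX)
    rw [IsTraceClass, traceNorm, CFC.abs_of_nonneg X hX, ← hsSq_sqrt hX] at this
    exact this.ne
  have hRY : hsSq (R * Y) ≠ ⊤ := ne_top_of_le_ne_top
    (ENNReal.mul_ne_top ENNReal.ofReal_ne_top hRs) (hsSq_mul_right_le R Y)
  have hYR : hsSq (Y * R) ≠ ⊤ := ne_top_of_le_ne_top
    (ENNReal.mul_ne_top ENNReal.ofReal_ne_top hRs) (hsSq_mul_left_le Y R)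
  rw [← h1, mul_assoc, trace_mul_comm_of_hsSq hRs hRY, mul_assoc, trace_mul_comm_of_hsSq hRs hYR,
    mul_assoc]

/-- `X = |X| - (|X| - X)` is a difference of positive operators of trace class. -/
theorem trace_mul_comm {X : H →L[ℂ] H} (hX : IsSelfAdjoint X) {C : ℝ} (h : TraceBound X C)
    (Y : H →L[ℂ] H) : trace (X * Y) = trace (Y * X) := by
  have habs : TraceBound (CFC.abs X) C := traceBound_of_nonneg (CFC.abs_nonneg X) h.nonneg
    (h.traceNorm_le hX)
  have hneg : TraceBound (CFC.abs X - X) (C + C) := habs.sub h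
  have hneg0 : 0 ≤ CFC.abs X - X := by
    rw [CFC.abs_sub_self X hX, two_smul]
    exact add_nonneg (CFC.negPart_nonneg X) (CFC.negPart_nonneg X)
  have e1 := trace_mul_comm_of_nonneg (CFC.abs_nonneg X) habs Y
  have e2 := trace_mul_comm_of_nonneg hneg0 hneg Y
  rw [sub_mul, mul_sub, (habs.mul_right Y).trace_sub (h.mul_right Y),
    (habs.mul_left Y).trace_sub (h.mul_left Y), e1] at e2
  linear_combination -e2

/-- The operators `T Π_F`, with `Π_F` the projections onto spans of finitely many basis vectors,
converge to `T` because `∑ ‖T eᵢ‖² = tr T*T < ∞`. -/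
theorem TraceBound.isCompactOperator {T : H →L[ℂ] H} {C : ℝ} (h : TraceBound T C) :
    IsCompactOperator T := by
  classical
  set e := stdBasis H with he
  have hsum : Summable fun i => ‖T (e i)‖ ^ 2 := by
    refine summable_of_sum_le (fun _ => by positivity) fun F =>
      le_trans (Finset.sum_le_sum fun i _ => ?_) ((h.mul_left (Star.star T)).sum_diag_le F)
    rw [mul_apply_eq_comp, ContinuousLinearMap.star_eq_adjoint,
      ContinuousLinearMap.adjoint_inner_right, inner_self_eq_norm_sq_to_K]
    simp [he]
  set TF : Finset (basisIndex H) → H →L[ℂ] H := fun F =>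
    ∑ i ∈ F, (innerSL ℂ (e i)).smulRight (T (e i)) with hTF
  have hcomp : ∀ F, IsCompactOperator (TF F) := by
    intro F
    have : TF F ∈ compactOperator (RingHom.id ℂ) H H := by
      refine Submodule.sum_mem _ fun i _ => ?_
      change IsCompactOperator ((innerSL ℂ (e i)).smulRight (T (e i)))
      exact IsCompactOperator.clm_comp
        ((isCompactOperator_id (E := ℂ)).comp_clm (innerSL ℂ (e i)))
        (ContinuousLinearMap.toSpanSingleton ℂ (T (e i)))
    exact this
  have hbasis : ∀ F i, (T - TF F) (e i) = if i ∈ F then 0 else T (e i) := by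
    intro F i
    have hi : ∀ k, ⟪e k, e i⟫_ℂ = if k = i then 1 else 0 :=
      fun k => orthonormal_iff_ite.1 e.orthonormal k i
    simp only [hTF, _root_.sub_apply, _root_.sum_apply, ContinuousLinearMap.smulRight_apply,
      innerSL_apply_apply, hi, ite_smul, one_smul, zero_smul, Finset.sum_ite_eq']
    split_ifs <;> simp
  have hlim : Tendsto TF atTop (𝓝 T) := by
    rw [tendsto_iff_norm_sub_tendsto_zero]
    have htail := (tendsto_tsum_compl_atTop_zero fun i => ‖T (e i)‖ ^ 2).sqrt
    rw [Real.sqrt_zero] at htail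
    refine squeeze_zero (fun _ => norm_nonneg _) (fun F => ?_) htail
    rw [norm_sub_rev]
    refine Real.le_sqrt_of_sq_le ?_
    have h1 := ofReal_norm_sq_le_hsSq (T - TF F)
    have h2 : hsSq (T - TF F) = ENNReal.ofReal (∑' i : {i // i ∉ F}, ‖T (e i)‖ ^ 2) := by
      have hs : Summable fun i : {i // i ∉ F} => ‖T (e i)‖ ^ 2 := hsum.subtype {i | i ∉ F}
      rw [ENNReal.ofReal_tsum_of_nonneg (fun i : {i // i ∉ F} => sq_nonneg ‖T (e i)‖) hs]
      change ∑' i, ENNReal.ofReal (‖(T - TF F) (e i)‖ ^ 2) = _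
      have := tsum_subtype {i | i ∉ F} fun i => ENNReal.ofReal (‖T (e i)‖ ^ 2)
      refine Eq.trans (tsum_congr fun i => ?_) this.symm
      rw [hbasis, Set.indicator_apply]
      by_cases hi : i ∈ F <;> simp [hi]
    rw [h2] at h1
    exact (ENNReal.ofReal_le_ofReal_iff (tsum_nonneg fun _ => by positivity)).1 h1
  exact isCompactOperator_of_tendsto hlim (Eventually.of_forall hcomp)

theorem hasSum_inner_starProjection (N : Submodule ℂ H) [FiniteDimensional ℂ N] :
    HasSum (fun i => ⟪stdBasis H i, N.starProjection (stdBasis H i)⟫_ℂ)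
      (Module.finrank ℂ N : ℂ) := by
  set b := stdOrthonormalBasis ℂ N
  have h1 : ∀ x : H, ⟪x, N.starProjection x⟫_ℂ = ((∑ j, ‖⟪x, (b j : H)⟫_ℂ‖ ^ 2 : ℝ) : ℂ) := by
    intro x
    have h2 : ⟪x, N.starProjection x⟫_ℂ = ((‖N.starProjection x‖ ^ 2 : ℝ) : ℂ) := by
      have hs : IsSelfAdjoint N.starProjection := isStarProjection_starProjection.isSelfAdjoint
      have hi : N.starProjection (N.starProjection x) = N.starProjection x :=
        congr($(isStarProjection_starProjection.isIdempotentElem) x)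
      rw [← hi, ← ContinuousLinearMap.adjoint_inner_left, ← ContinuousLinearMap.star_eq_adjoint,
        hs.star_eq, inner_self_eq_norm_sq_to_K, hi]
      norm_cast
    rw [h2]
    congr 1
    have h3 : ‖N.starProjection x‖ = ‖N.orthogonalProjectionOnto x‖ := rfl
    rw [h3, ← b.sum_sq_norm_inner_right]
    refine Finset.sum_congr rfl fun j _ => ?_
    congr 1
    rw [← inner_conj_symm, RCLike.norm_conj, ← Submodule.inner_orthogonalProjectionOnto_eq_of_mem_right]
  simp_rw [h1]
  have h4 : HasSum (fun i => ∑ j, ‖⟪stdBasis H i, (b j : H)⟫_ℂ‖ ^ 2)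
      (∑ j : Fin (Module.finrank ℂ N), ‖(b j : H)‖ ^ 2) :=
    hasSum_sum fun j _ => hasSum_norm_sq_inner (stdBasis H) (b j : H)
  have h5 : ∑ j : Fin (Module.finrank ℂ N), ‖(b j : H)‖ ^ 2 = Module.finrank ℂ N := by
    have : ∀ j, ‖(b j : H)‖ = 1 := fun j => b.orthonormal.1 j
    simp [this]
  rw [h5] at h4
  have h6 := h4.mapL Complex.ofRealCLM
  simpa using h6

theorem trace_starProjection (N : Submodule ℂ H) [FiniteDimensional ℂ N] :
    trace N.starProjection = Module.finrank ℂ N :=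
  (hasSum_inner_starProjection N).tsum_eq

theorem traceBound_starProjection (N : Submodule ℂ H) [FiniteDimensional ℂ N] :
    TraceBound N.starProjection (Module.finrank ℂ N) := by
  have hs : IsStarProjection N.starProjection := isStarProjection_starProjection
  refine traceBound_of_nonneg hs.nonneg (by positivity) (le_of_eq ?_)
  have h := Complex.hasSum_re (hasSum_inner_starProjection N)
  rw [← ENNReal.ofReal_tsum_of_nonneg _ h.summable, h.tsum_eq]
  · simp
  · exact fun i => ((ContinuousLinearMap.nonneg_iff_isPositive _).mp
      hs.nonneg).re_inner_nonneg_right _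

end TraceClassTheory

/-! ### Compact perturbations of the identity and Fredholm pairs -/

section Fredholm

variable {X : Type*} [NormedAddCommGroup X] [InnerProductSpace ℂ X] [CompleteSpace X]

/-- In a Hilbert space a compact operator is a norm limit of operators of finite rank: project onto
the span of a finite net of the image of the unit ball. -/
theorem exists_finiteRank_near {K : X →L[ℂ] X} (hK : IsCompactOperator K) {ε : ℝ} (hε : 0 < ε) :
    ∃ F : X →L[ℂ] X, FiniteDimensional ℂ F.range ∧ ‖K - F‖ ≤ ε := by
  have hc := hK.isCompact_closure_image_closedBall 1
  obtain ⟨t, -, ht, hcov⟩ := hc.finite_cover_balls hε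
  set N : Submodule ℂ X := Submodule.span ℂ t
  have : FiniteDimensional ℂ N := FiniteDimensional.span_of_finite ℂ ht
  refine ⟨N.starProjection * K, ?_, ?_⟩
  · refine Submodule.finiteDimensional_of_le (S₂ := N) ?_
    rintro _ ⟨x, rfl⟩
    simp
  · refine ContinuousLinearMap.opNorm_le_of_unit_norm hε.le fun x hx => ?_
    have hx1 : K x ∈ closure (K '' Metric.closedBall 0 1) :=
      subset_closure ⟨x, by simp [hx], rfl⟩
    obtain ⟨y, hy, hxy⟩ := Set.mem_iUnion₂.1 (hcov hx1)
    have h1 : ‖K x - N.starProjection (K x)‖ ≤ ‖K x - y‖ := by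
      rw [Submodule.starProjection_minimal]
      exact ciInf_le ⟨0, by rintro _ ⟨z, rfl⟩; exact norm_nonneg _⟩
        (⟨y, Submodule.subset_span hy⟩ : N)
    simp only [_root_.sub_apply, mul_apply_eq_comp]
    refine h1.trans ?_
    rw [← dist_eq_norm]
    exact (Metric.mem_ball.1 hxy).le

variable {V : Type*} [AddCommGroup V] [Module ℂ V]

/-- `1 + F` and its restriction to `ran F` have isomorphic kernels and cokernels. -/
theorem index_one_add_finiteRank (F : V →ₗ[ℂ] V) [FiniteDimensional ℂ F.range] :
    (LinearMap.id + F).index = 0 := by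
  set G : V →ₗ[ℂ] V := LinearMap.id + F with hG
  have hGx : ∀ x, G x = x + F x := fun x => by simp [hG]
  have hmaps : ∀ x ∈ F.range, G x ∈ F.range := by
    intro x hx
    rw [hGx]
    exact F.range.add_mem hx ⟨x, rfl⟩
  set g : F.range →ₗ[ℂ] F.range := G.restrict hmaps with hg
  have hgi : g.index = 0 := by
    rw [LinearMap.index_eq_of_finiteDimensional]; simp
  have hker : Module.finrank ℂ G.ker = Module.finrank ℂ g.ker := by
    refine LinearEquiv.finrank_eq (LinearEquiv.ofBijective
      (G.ker.subtype.codRestrict F.range ?_ |>.codRestrict g.ker ?_) ⟨?_, ?_⟩)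
    · rintro ⟨x, hx⟩
      refine ⟨-x, ?_⟩
      have := hGx x
      rw [LinearMap.mem_ker.1 hx] at this
      simp only [map_neg, Submodule.subtype_apply]
      exact (eq_neg_of_add_eq_zero_left this.symm).symm
    · rintro ⟨x, hx⟩
      rw [LinearMap.mem_ker]
      ext
      simpa [hg] using hx
    · rintro ⟨x, hx⟩ ⟨y, hy⟩ h
      simpa [Subtype.ext_iff] using h
    · rintro ⟨⟨x, hx⟩, hx'⟩
      refine ⟨⟨x, ?_⟩, rfl⟩
      simpa [hg, Subtype.ext_iff] using hx'
  have hle : g.range ≤ G.range.comap F.range.subtype := by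
    rintro _ ⟨x, rfl⟩
    exact ⟨x, rfl⟩
  have hcoker : Module.finrank ℂ (F.range ⧸ g.range) = Module.finrank ℂ (V ⧸ G.range) := by
    refine LinearEquiv.finrank_eq (LinearEquiv.ofBijective
      (g.range.mapQ G.range F.range.subtype hle) ⟨?_, ?_⟩)
    · rw [← LinearMap.ker_eq_bot, Submodule.ker_mapQ, eq_bot_iff, Submodule.map_le_iff_le_comap,
        ← LinearMap.ker, Submodule.ker_mkQ]
      rintro ⟨x, hx⟩ ⟨y, hy⟩
      have hyF : y ∈ F.range := by
        have : y = x - F y := by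
          have := hGx y
          rw [hy] at this
          simp only [Submodule.subtype_apply] at this
          rw [this]; abel
        rw [this]
        exact F.range.sub_mem hx ⟨y, rfl⟩
      exact ⟨⟨y, hyF⟩, Subtype.ext hy⟩
    · intro q
      obtain ⟨v, rfl⟩ := Submodule.mkQ_surjective _ q
      refine ⟨g.range.mkQ ⟨-F v, ⟨-v, by simp⟩⟩, ?_⟩
      simp only [Submodule.mkQ_apply, Submodule.mapQ_apply, Submodule.subtype_apply]
      rw [Submodule.Quotient.eq]
      exact ⟨-v, by rw [hGx]; simp; abel⟩
  rw [LinearMap.index_eq_finrank_sub, hker, ← hcoker, ← LinearMap.index_eq_finrank_sub, hgi]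

open LinearMap.FiniteRangeSetoid in
/-- If `F` is of finite rank and `‖K - F‖ < 1` then `w = 1 + (K - F)` is invertible and
`1 + K = w (1 + w⁻¹ F)`, a finite rank perturbation of the identity up to an invertible factor. -/
theorem isFredholm_one_add_compact {K : X →L[ℂ] X} (hK : IsCompactOperator K) :
    (1 + K).IsFredholm ∧ (1 + K).toLinearMap.index = 0 := by
  obtain ⟨F, hF, hn⟩ := exists_finiteRank_near hK (ε := 1 / 2) (by norm_num)
  have hu : IsUnit (1 + (K - F)) := by
    have := isUnit_one_sub_of_norm_lt_one (x := -(K - F)) (by rw [norm_neg]; linarith)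
    rwa [sub_neg_eq_add] at this
  obtain ⟨w, hw⟩ := hu
  have h1 : 1 + K = (w : X →L[ℂ] X) * (1 + (↑w⁻¹ : X →L[ℂ] X) * F) := by
    rw [mul_add, ← mul_assoc, Units.mul_inv, hw, mul_one, one_mul]; abel
  have hfr : FiniteDimensional ℂ ((↑w⁻¹ : X →L[ℂ] X) * F).toLinearMap.range := by
    have : ((↑w⁻¹ : X →L[ℂ] X) * F).toLinearMap.range = F.range.map (↑w⁻¹ : X →L[ℂ] X).toLinearMap :=
      LinearMap.range_comp _ _
    rw [this]; infer_instance
  have h2 : ((↑w⁻¹ : X →L[ℂ] X)).toLinearMap.IsQuasiInverse (1 + K).toLinearMap := by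
    have e1 : (↑w⁻¹ : X →L[ℂ] X) * (1 + K) = 1 + (↑w⁻¹ : X →L[ℂ] X) * F := by
      rw [h1, ← mul_assoc, Units.inv_mul, one_mul]
    have e2 : (1 + K) * (↑w⁻¹ : X →L[ℂ] X) = 1 + F * (↑w⁻¹ : X →L[ℂ] X) := by
      have : 1 + K = (w : X →L[ℂ] X) + F := by rw [hw]; abel
      rw [this, add_mul, Units.mul_inv]
    constructor
    · change (↑w⁻¹ * (1 + K) : X →L[ℂ] X).toLinearMap ≈ _
      rw [e1, equiv_iff_hasFiniteRange]
      have : (1 + ↑w⁻¹ * F : X →L[ℂ] X).toLinearMap - LinearMap.id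
        = (↑w⁻¹ * F : X →L[ℂ] X).toLinearMap := by ext; simp
      rw [this]
      exact Module.Finite.iff_fg.1 hfr
    · change ((1 + K) * ↑w⁻¹ : X →L[ℂ] X).toLinearMap ≈ _
      rw [e2, equiv_iff_hasFiniteRange]
      have : (1 + F * ↑w⁻¹ : X →L[ℂ] X).toLinearMap - LinearMap.id
        = F.toLinearMap ∘ₗ (↑w⁻¹ : X →L[ℂ] X).toLinearMap := by ext; simp
      rw [this]
      exact LinearMap.HasFiniteRange.comp_right (Module.Finite.iff_fg.1 hF) _
  have hfred : (1 + K).IsFredholm := .of_isQuasiInverse h2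
  refine ⟨hfred, ?_⟩
  set e : X ≃ₗ[ℂ] X := LinearEquiv.ofLinearMap (↑w⁻¹ : X →L[ℂ] X).toLinearMap
    (w : X →L[ℂ] X).toLinearMap
    (by ext x; exact congr($(Units.inv_mul w) x))
    (by ext x; exact congr($(Units.mul_inv w) x))
  have he : e.toLinearMap ∘ₗ (1 + K).toLinearMap
      = LinearMap.id + (↑w⁻¹ * F : X →L[ℂ] X).toLinearMap := by
    ext x
    rw [h1]
    exact congr($(Units.inv_mul w) (x + (↑w⁻¹ : X →L[ℂ] X) (F x)))
  have := hfred.finite_ker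
  have : FiniteDimensional ℂ (X ⧸ (1 + K).toLinearMap.range) := hfred.finite_coker
  have : FiniteDimensional ℂ e.toLinearMap.ker := by rw [LinearEquiv.ker]; infer_instance
  have : FiniteDimensional ℂ (X ⧸ e.toLinearMap.range) := by
    rw [LinearEquiv.range]; infer_instance
  have h3 := LinearMap.index_comp (f := (1 + K).toLinearMap) e.toLinearMap
  rw [he, index_one_add_finiteRank, LinearEquiv.index_eq_zero] at h3
  linarith

end Fredholm

section FredholmPairs

variable {H : Type u} [NormedAddCommGroup H] [InnerProductSpace ℂ H] [CompleteSpace H]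

theorem apply_apply_of_isStarProjection {P : H →L[ℂ] H} (hP : IsStarProjection P) (x : H) :
    P (P x) = P x := congr($(hP.isIdempotentElem) x)

theorem mem_range_iff_of_isStarProjection {P : H →L[ℂ] H} (hP : IsStarProjection P) {x : H} :
    x ∈ P.range ↔ P x = x :=
  ⟨by rintro ⟨y, rfl⟩; exact apply_apply_of_isStarProjection hP y, fun h => ⟨x, h⟩⟩

theorem isClosed_range_of_isStarProjection {P : H →L[ℂ] H} (hP : IsStarProjection P) :
    IsClosed (P.range : Set H) := by
  have : (P.range : Set H) = {x | P x = x} := by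
    ext x; exact mem_range_iff_of_isStarProjection hP
  rw [this]
  exact isClosed_eq P.continuous continuous_id

theorem completeSpace_range_of_isStarProjection {P : H →L[ℂ] H} (hP : IsStarProjection P) :
    CompleteSpace P.range := (isClosed_range_of_isStarProjection hP).completeSpace_coe

/-- The compression `P T |ran P : ran P → ran P`. -/
def corner (P T : H →L[ℂ] H) : P.range →L[ℂ] P.range :=
  ((P ∘L T) ∘L P.range.subtypeL).codRestrict P.range (fun x => ⟨T (x : H), rfl⟩)

theorem coe_corner_apply (P T : H →L[ℂ] H) (x : P.range) :
    (corner P T x : H) = P (T (x : H)) := rfl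

theorem coe_pairMap_apply (P Q : H →L[ℂ] H) (x : P.range) :
    (pairMap P Q x : H) = Q (P (x : H)) := rfl

theorem isCompactOperator_corner {P T : H →L[ℂ] H} (hP : IsStarProjection P)
    (hT : IsCompactOperator T) : IsCompactOperator (corner P T) :=
  ((hT.comp_clm P.range.subtypeL).clm_comp P).codRestrict
    (fun x => LinearMap.mem_range_self P.toLinearMap (T (x : H)))
    (isClosed_range_of_isStarProjection hP)

theorem isCompactOperator_mul_left {T : H →L[ℂ] H} (hT : IsCompactOperator T) (X : H →L[ℂ] H) :
    IsCompactOperator (X * T : H →L[ℂ] H) := hT.clm_comp X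

theorem isCompactOperator_mul_right {T : H →L[ℂ] H} (hT : IsCompactOperator T) (X : H →L[ℂ] H) :
    IsCompactOperator (T * X : H →L[ℂ] H) := hT.comp_clm X

theorem isCompactOperator_sub_comm {P Q : H →L[ℂ] H} (h : IsCompactOperator (P - Q : H →L[ℂ] H)) :
    IsCompactOperator (Q - P : H →L[ℂ] H) := by
  have e : (Q - P : H →L[ℂ] H) = -(P - Q) := (neg_sub P Q).symm
  rw [e]
  exact h.neg

variable {P Q R : H →L[ℂ] H}

theorem pairMap_comp_pairMap (hP : IsStarProjection P) :
    pairMap Q P ∘L pairMap P Q = 1 + corner P (Q * Q * P - P) := by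
  ext ⟨x, hx⟩
  have hx' := (mem_range_iff_of_isStarProjection hP).1 hx
  simp [coe_pairMap_apply, coe_corner_apply, hx']

theorem pairMap_comp_pairMap_comp_pairMap (hP : IsStarProjection P) :
    pairMap Q P ∘L pairMap R Q ∘L pairMap P R = 1 + corner P (Q * Q * R * R * P - P) := by
  ext ⟨x, hx⟩
  have hx' := (mem_range_iff_of_isStarProjection hP).1 hx
  simp [coe_pairMap_apply, coe_corner_apply, hx']

open LinearMap.FiniteRangeSetoid in
/-- A left and a right inverse modulo finite rank agree modulo finite rank. -/
theorem comp_equiv_id_of_left_right {V W : Type*} [AddCommGroup V] [Module ℂ V] [AddCommGroup W]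
    [Module ℂ W] {u : V →ₗ[ℂ] W} {a b : W →ₗ[ℂ] V} (ha : a ∘ₗ u ≈ LinearMap.id)
    (hb : u ∘ₗ b ≈ LinearMap.id) : u ∘ₗ a ≈ LinearMap.id := by
  have e1 : a ∘ₗ (u ∘ₗ b) ≈ a ∘ₗ LinearMap.id := equiv_comp_left hb
  have e2 : (a ∘ₗ u) ∘ₗ b ≈ LinearMap.id ∘ₗ b := equiv_comp_right ha
  rw [LinearMap.comp_id] at e1
  rw [LinearMap.id_comp, LinearMap.comp_assoc] at e2
  exact Setoid.trans (equiv_comp_left (Setoid.trans (Setoid.symm e1) e2)) hb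

/-- If `v u` and `u v` are Fredholm then so is `u`. -/
theorem isFredholm_of_comp {E F : Type*} [NormedAddCommGroup E] [InnerProductSpace ℂ E]
    [NormedAddCommGroup F] [InnerProductSpace ℂ F]
    {u : E →L[ℂ] F} {v : F →L[ℂ] E} (h1 : (v ∘L u).IsFredholm) (h2 : (u ∘L v).IsFredholm) :
    u.IsFredholm := by
  obtain ⟨a, ha, -⟩ := h1.exists_isQuasiInverse
  obtain ⟨b, -, hb⟩ := h2.exists_isQuasiInverse
  exact .of_isQuasiInverse (v := a ∘L v) ⟨ha, comp_equiv_id_of_left_right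
    (u := u.toLinearMap) (a := (a ∘L v).toLinearMap) (b := (v ∘L b).toLinearMap) ha hb⟩

theorem compact_sub_of_compact (hQ : IsStarProjection Q) (hP : IsStarProjection P)
    (h : IsCompactOperator (P - Q : H →L[ℂ] H)) :
    IsCompactOperator (Q * Q * P - P : H →L[ℂ] H) := by
  have e : Q * Q * P - P = (Q - P) * P := by
    rw [hQ.isIdempotentElem.eq, sub_mul, hP.isIdempotentElem.eq]
  rw [e]
  exact isCompactOperator_mul_right (isCompactOperator_sub_comm h) P

theorem isFredholm_pairMap (hP : IsStarProjection P) (hQ : IsStarProjection Q)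
    (h : IsCompactOperator (P - Q : H →L[ℂ] H)) : (pairMap P Q).IsFredholm := by
  have := completeSpace_range_of_isStarProjection hP
  have := completeSpace_range_of_isStarProjection hQ
  have h1 : IsCompactOperator (corner P (Q * Q * P - P)) :=
    isCompactOperator_corner hP (compact_sub_of_compact hQ hP h)
  have h2 : IsCompactOperator (corner Q (P * P * Q - Q)) :=
    isCompactOperator_corner hQ (compact_sub_of_compact hP hQ (isCompactOperator_sub_comm h))
  have h3 := (isFredholm_one_add_compact h1).1
  have h4 := (isFredholm_one_add_compact h2).1
  rw [← pairMap_comp_pairMap hP] at h3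
  rw [← pairMap_comp_pairMap hQ] at h4
  exact isFredholm_of_comp h3 h4

theorem isFredholmPair_of_compact (hP : IsStarProjection P) (hQ : IsStarProjection Q)
    (h : IsCompactOperator (P - Q : H →L[ℂ] H)) : IsFredholmPair P Q :=
  ⟨hP, hQ, isFredholm_pairMap hP hQ h⟩

theorem index_comp_of_isFredholm {E F G : Type*} [NormedAddCommGroup E] [InnerProductSpace ℂ E]
    [NormedAddCommGroup F] [InnerProductSpace ℂ F] [NormedAddCommGroup G] [InnerProductSpace ℂ G]
    {u : E →L[ℂ] F} {v : F →L[ℂ] G} (hu : u.IsFredholm) (hv : v.IsFredholm) :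
    (v ∘L u).toLinearMap.index = v.toLinearMap.index + u.toLinearMap.index := by
  have := hu.finite_ker
  have := hv.finite_ker
  have : FiniteDimensional ℂ (F ⧸ u.toLinearMap.range) := hu.finite_coker
  have : FiniteDimensional ℂ (G ⧸ v.toLinearMap.range) := hv.finite_coker
  exact LinearMap.index_comp v.toLinearMap

theorem isFredholm_comp {E F G : Type*} [NormedAddCommGroup E] [InnerProductSpace ℂ E]
    [NormedAddCommGroup F] [InnerProductSpace ℂ F] [NormedAddCommGroup G] [InnerProductSpace ℂ G]
    {u : E →L[ℂ] F} {v : F →L[ℂ] G} (hu : u.IsFredholm) (hv : v.IsFredholm) :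
    (v ∘L u).IsFredholm := by
  obtain ⟨a, ha⟩ := hu.exists_isQuasiInverse
  obtain ⟨b, hb⟩ := hv.exists_isQuasiInverse
  exact .of_isQuasiInverse (v := a ∘L b) (ha.comp hb)

theorem pairIndex_eq_index (P Q : H →L[ℂ] H) : pairIndex P Q = (pairMap P Q).toLinearMap.index :=
  LinearMap.index_eq_finrank_sub.symm

theorem pairIndex_add_pairIndex_swap (hP : IsStarProjection P) (hQ : IsStarProjection Q)
    (h : IsCompactOperator (P - Q : H →L[ℂ] H)) : pairIndex Q P + pairIndex P Q = 0 := by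
  have := completeSpace_range_of_isStarProjection hP
  rw [pairIndex_eq_index, pairIndex_eq_index, ← index_comp_of_isFredholm
    (isFredholm_pairMap hP hQ h) (isFredholm_pairMap hQ hP (isCompactOperator_sub_comm h)),
    pairMap_comp_pairMap hP]
  exact (isFredholm_one_add_compact
      (isCompactOperator_corner hP (compact_sub_of_compact hQ hP h))).2

/-- The cycle `ran P → ran R → ran Q → ran P` is a compact perturbation of the identity, so the
indices of its three arrows add up to zero. -/
theorem pairIndex_add (hP : IsStarProjection P) (hQ : IsStarProjection Q)
    (hR : IsStarProjection R) (hPR : IsCompactOperator (P - R : H →L[ℂ] H))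
    (hRQ : IsCompactOperator (R - Q : H →L[ℂ] H)) :
    pairIndex P Q = pairIndex P R + pairIndex R Q := by
  have := completeSpace_range_of_isStarProjection hP
  have hPQ : IsCompactOperator (P - Q : H →L[ℂ] H) := by
    have : P - Q = (P - R) + (R - Q) := by abel
    rw [this]
    exact hPR.add hRQ
  have h1 := isFredholm_pairMap hP hR hPR
  have h2 := isFredholm_pairMap hR hQ hRQ
  have h3 := isFredholm_pairMap hQ hP (isCompactOperator_sub_comm hPQ)
  have hcpt : IsCompactOperator (Q * Q * R * R * P - P : H →L[ℂ] H) := by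
    have : Q * Q * R * R * P - P = Q * ((R - P) * P) + (Q - P) * P := by
      rw [hQ.isIdempotentElem.eq, mul_assoc Q R R, hR.isIdempotentElem.eq, sub_mul, sub_mul,
        hP.isIdempotentElem.eq, mul_sub, mul_assoc]
      abel
    rw [this]
    exact (isCompactOperator_mul_left
      (isCompactOperator_mul_right (isCompactOperator_sub_comm hPR) P) Q).add
      (isCompactOperator_mul_right (isCompactOperator_sub_comm hPQ) P)
  have h4 : pairIndex Q P + (pairIndex R Q + pairIndex P R) = 0 := by
    rw [pairIndex_eq_index, pairIndex_eq_index, pairIndex_eq_index,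
      ← index_comp_of_isFredholm h1 h2, ← index_comp_of_isFredholm (isFredholm_comp h1 h2) h3,
      pairMap_comp_pairMap_comp_pairMap hP]
    exact (isFredholm_one_add_compact (isCompactOperator_corner hP hcpt)).2
  have h5 := pairIndex_add_pairIndex_swap hP hQ hPQ
  linarith

/-- For a Fredholm pair the cokernel of `QP|ran P` is isomorphic to `ran Q ∩ ker P`. -/
theorem pairIndex_eq_finrank_sub (hP : IsStarProjection P) (hQ : IsStarProjection Q)
    (h : (pairMap P Q).IsFredholm) :
    pairIndex P Q = (Module.finrank ℂ (P.range ⊓ Q.ker : Submodule ℂ H) : ℤ)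
      - (Module.finrank ℂ (Q.range ⊓ P.ker : Submodule ℂ H) : ℤ) := by
  have := completeSpace_range_of_isStarProjection hP
  have := completeSpace_range_of_isStarProjection hQ
  have hker : ∀ {P Q : H →L[ℂ] H}, IsStarProjection P →
      Module.finrank ℂ (pairMap P Q).ker
        = Module.finrank ℂ (P.range ⊓ Q.ker : Submodule ℂ H) := by
    intro P Q hP
    have e : (P.range ⊓ Q.ker : Submodule ℂ H) = (pairMap P Q).ker.map P.range.subtype := by
      ext x
      simp only [Submodule.mem_inf, Submodule.mem_map, LinearMap.mem_ker, Submodule.subtype_apply]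
      constructor
      · rintro ⟨hx, hq⟩
        refine ⟨⟨x, hx⟩, ?_, rfl⟩
        ext
        have hx' := (mem_range_iff_of_isStarProjection hP).1 hx
        simpa [coe_pairMap_apply, hx'] using hq
      · rintro ⟨⟨y, hy⟩, hq, rfl⟩
        refine ⟨hy, ?_⟩
        have hx' := (mem_range_iff_of_isStarProjection hP).1 hy
        have hq' := congr_arg Subtype.val hq
        have h2 : Q (P y) = 0 := hq'
        rwa [hx'] at h2
    rw [e]
    exact (LinearEquiv.finrank_eq (Submodule.equivMapOfInjective _
      (Submodule.injective_subtype _) _))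
  have hadj : (pairMap P Q).adjoint = pairMap Q P := by
    symm
    rw [ContinuousLinearMap.eq_adjoint_iff]
    rintro ⟨x, hx⟩ ⟨y, hy⟩
    have hx' := (mem_range_iff_of_isStarProjection hQ).1 hx
    have hy' := (mem_range_iff_of_isStarProjection hP).1 hy
    simp only [Submodule.coe_inner, coe_pairMap_apply, hx', hy']
    have hPs : P.adjoint = P := hP.isSelfAdjoint.star_eq
    have hQs : Q.adjoint = Q := hQ.isSelfAdjoint.star_eq
    rw [← ContinuousLinearMap.adjoint_inner_right, hPs, hy', ← hQs,
      ContinuousLinearMap.adjoint_inner_right, hx']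
  have hcoker : Module.finrank ℂ (Q.range ⧸ (pairMap P Q).range)
      = Module.finrank ℂ (pairMap Q P).ker := by
    have hc : IsClosed ((pairMap P Q).range : Set Q.range) := h.isClosed_range
    have : CompleteSpace (pairMap P Q).range := hc.completeSpace_coe
    have e := ContinuousLinearMap.orthogonal_range (pairMap P Q)
    rw [hadj] at e
    rw [← e]
    exact LinearEquiv.finrank_eq
      (Submodule.quotientEquivOfIsCompl _ _ (Submodule.isCompl_orthogonal _))
  unfold pairIndex
  rw [hcoker, hker hP, hker hQ]

/-- `P - Q` fixes the vectors of `ran P ∩ ker Q`, so this subspace is trivial if `‖P - Q‖ < 1`, and so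
is `ran Q ∩ ker P`. -/
theorem pairIndex_eq_zero_of_norm_lt (hP : IsStarProjection P) (hQ : IsStarProjection Q)
    (h : IsCompactOperator (P - Q : H →L[ℂ] H)) (hn : ‖P - Q‖ < 1) : pairIndex P Q = 0 := by
  have key : ∀ {P Q : H →L[ℂ] H}, IsStarProjection P → ‖P - Q‖ < 1 →
      (P.range ⊓ Q.ker : Submodule ℂ H) = ⊥ := by
    intro P Q hP hn
    rw [eq_bot_iff]
    rintro x ⟨hx, hq⟩
    have hx' := (mem_range_iff_of_isStarProjection hP).1 hx
    have hq' : Q x = 0 := hq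
    by_contra hx0
    have hx0 : 0 < ‖x‖ := norm_pos_iff.2 hx0
    have h1 := (P - Q).le_opNorm x
    rw [_root_.sub_apply, hx', hq', sub_zero] at h1
    nlinarith
  rw [pairIndex_eq_finrank_sub hP hQ (isFredholm_pairMap hP hQ h), key hP hn,
    key hQ (by rwa [norm_sub_rev])]
  simp

end FredholmPairs

/-! ### The index of a pair of projections as a trace -/

section IndexTrace

variable {H : Type u} [NormedAddCommGroup H] [InnerProductSpace ℂ H] [CompleteSpace H]

/-- The Fredholm alternative for compact perturbations of invertible operators. -/
theorem isUnit_of_injective_of_compact {W K : H →L[ℂ] H} (hW : IsUnit W)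
    (hK : IsCompactOperator K) (hinj : ∀ x, (W + K) x = 0 → x = 0) : IsUnit (W + K) := by
  obtain ⟨w, rfl⟩ := hW
  set L : H →L[ℂ] H := ↑w⁻¹ * K with hL
  have hLc : IsCompactOperator L := isCompactOperator_mul_left hK _
  have e : (w : H →L[ℂ] H) + K = w * (1 + L) := by
    rw [hL, mul_add, ← mul_assoc, Units.mul_inv, mul_one, one_mul]
  rcases hLc.hasEigenvalue_or_mem_resolventSet (μ := (-1 : ℂ)) (by simp) with h | h
  · obtain ⟨x, hx⟩ := h.exists_hasEigenvector
    refine absurd (hinj x ?_) hx.2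
    have h1 : L x = -x := by simpa using hx.apply_eq_smul
    rw [e, mul_apply_eq_comp, _root_.add_apply, h1, one_apply_eq_self, add_neg_cancel, map_zero]
  · rw [e]
    refine w.isUnit.mul ?_
    have h2 : IsUnit (algebraMap ℂ (H →L[ℂ] H) (-1) - L) := h
    rw [map_neg, map_one, ← neg_add'] at h2
    exact (IsUnit.neg_iff _).1 h2

theorem finiteDimensional_ker_of_compact {W K : H →L[ℂ] H} (hW : IsUnit W)
    (hK : IsCompactOperator K) : FiniteDimensional ℂ (W + K).ker := by
  obtain ⟨w, rfl⟩ := hW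
  have hF := (isFredholm_one_add_compact (isCompactOperator_mul_left hK (↑w⁻¹ : H →L[ℂ] H))).1
  have hle : ((w : H →L[ℂ] H) + K).ker ≤ (1 + ↑w⁻¹ * K : H →L[ℂ] H).ker := by
    intro x hx
    have hx' : (w : H →L[ℂ] H) x + K x = 0 := hx
    have h1 : K x = -((w : H →L[ℂ] H) x) := (neg_eq_of_add_eq_zero_right hx').symm
    have h2 : (↑w⁻¹ : H →L[ℂ] H) ((w : H →L[ℂ] H) x) = x := congr($(Units.inv_mul w) x)
    change (1 + ↑w⁻¹ * K : H →L[ℂ] H) x = 0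
    rw [_root_.add_apply, mul_apply_eq_comp, h1, map_neg, h2, one_apply_eq_self, add_neg_cancel]
  have hfin : FiniteDimensional ℂ (1 + ↑w⁻¹ * K : H →L[ℂ] H).ker := hF.finite_ker
  exact Submodule.finiteDimensional_of_le hle

/-- Let `T` be a compact perturbation of an invertible operator such that `ker T ⊆ ker T*`. Then
`ker T` reduces `T`, and adding the projection onto it to `T` makes `T` invertible. -/
theorem isUnit_add_starProjection_ker {T W K : H →L[ℂ] H} (hW : IsUnit W)
    (hK : IsCompactOperator K) (hT : T = W + K) (hker : ∀ x, T x = 0 → star T x = 0) :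
    ∃ N : Submodule ℂ H, ∃ _ : FiniteDimensional ℂ N, N = T.ker ∧ T * N.starProjection = 0 ∧
      N.starProjection * T = 0 ∧ IsUnit (T + N.starProjection) := by
  have hfin : FiniteDimensional ℂ T.ker := by
    rw [hT]; exact finiteDimensional_ker_of_compact hW hK
  refine ⟨T.ker, hfin, rfl, ?_⟩
  set P := T.ker.starProjection with hP
  have hPs : star P = P := isStarProjection_starProjection.isSelfAdjoint.star_eq
  have hmem : ∀ x, P x ∈ T.ker := fun x => Submodule.starProjection_apply_mem _ _
  have h1 : T * P = 0 := by
    ext x; exact hmem x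
  have h2 : P * T = 0 := by
    have h3 : star T * P = 0 := by
      ext x; exact hker _ (hmem x)
    have := congr_arg star h3
    rwa [star_mul, star_star, hPs, star_zero] at this
  refine ⟨h1, h2, ?_⟩
  have e : T + P = W + (K + P) := by rw [hT]; abel
  have hPc : IsCompactOperator P := (traceBound_starProjection T.ker).isCompactOperator
  rw [e]
  refine isUnit_of_injective_of_compact hW (hK.add hPc) fun x hx => ?_
  rw [← e, _root_.add_apply] at hx
  have hPx : P x = 0 := by
    have h3 : P (T x) = 0 := congr($h2 x)
    have h4 : P (P x) = P x := congr($(isStarProjection_starProjection.isIdempotentElem) x)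
    have := congr_arg P hx
    rwa [map_add, h3, h4, zero_add, map_zero] at this
  have hTx : x ∈ T.ker := by rwa [hPx, add_zero] at hx
  rw [← hPx]
  exact (Submodule.starProjection_eq_self_iff.2 hTx).symm

theorem trace_smul (c : ℂ) (T : H →L[ℂ] H) : trace (c • T) = c * trace T := by
  unfold trace
  rw [← tsum_mul_left]
  simp

/-- The Avron–Seiler–Simon formula. With `D = P - Q` and `C = 1 - P - Q` one has `C D = -D C`. Off
`ker C` the operator `C` is invertible, so that part of `D` is similar to its negative and has trace
zero; on `ker C = (ran P ∩ ker Q) ⊕ (ran Q ∩ ker P)` the operator `D` is `1 ⊕ -1`. -/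
theorem trace_sub_eq_pairIndex {P Q : H →L[ℂ] H} (hP : IsStarProjection P)
    (hQ : IsStarProjection Q) {c : ℝ} (h : TraceBound (P - Q) c) :
    trace (P - Q) = pairIndex P Q := by
  have hPP : P * P = P := hP.isIdempotentElem
  have hQQ : Q * Q = Q := hQ.isIdempotentElem
  have hPs : star P = P := hP.isSelfAdjoint
  have hQs : star Q = Q := hQ.isSelfAdjoint
  set C : H →L[ℂ] H := 1 - P - Q with hC
  have hCs : star C = C := by simp [hC, hPs, hQs]
  -- `C = (1 - 2 Q) - (P - Q)` is a compact perturbation of an involution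
  have hW : IsUnit (1 - 2 • Q : H →L[ℂ] H) := by
    have e : (1 - 2 • Q) * (1 - 2 • Q : H →L[ℂ] H) = 1 := by
      simp only [two_smul, mul_sub, sub_mul, mul_one, one_mul, mul_add, add_mul, hQQ]
      abel
    exact ⟨⟨_, _, e, e⟩, rfl⟩
  obtain ⟨N, hN, hNk, hCP, hPC, hU⟩ := isUnit_add_starProjection_ker (T := C) hW
    (K := -(P - Q)) h.isCompactOperator.neg (by rw [hC, two_smul]; abel)
    (fun x hx => by rwa [hCs])
  set R := N.starProjection with hR
  have hRs : star R = R := isStarProjection_starProjection.isSelfAdjoint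
  have hRR : R * R = R := isStarProjection_starProjection.isIdempotentElem
  have hmemN : ∀ x, x ∈ N ↔ P x + Q x = x := by
    intro x
    rw [hNk]
    change (1 - P - Q) x = 0 ↔ _
    rw [_root_.sub_apply, _root_.sub_apply, one_apply_eq_self, sub_sub, sub_eq_zero, eq_comm]
  -- `P R` and `Q R` are the projections onto the eigenspaces of `D` at `1` and `-1`
  have hsub : ∀ {P Q : H →L[ℂ] H}, IsStarProjection P → IsStarProjection Q →
      (∀ x, x ∈ N ↔ P x + Q x = x) →
      ∃ _ : FiniteDimensional ℂ (P.range ⊓ Q.ker : Submodule ℂ H),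
        P * R = (P.range ⊓ Q.ker : Submodule ℂ H).starProjection := by
    intro P Q hP hQ hmemN
    have hle : (P.range ⊓ Q.ker : Submodule ℂ H) ≤ N := by
      rintro x ⟨hx, hq⟩
      have hx' := (mem_range_iff_of_isStarProjection hP).1 hx
      have hq' : Q x = 0 := hq
      rw [hmemN, hx', hq', add_zero]
    have hfin := Submodule.finiteDimensional_of_le hle
    refine ⟨hfin, ?_⟩
    ext x
    symm
    refine Submodule.eq_starProjection_of_mem_of_inner_eq_zero ⟨⟨R x, rfl⟩, ?_⟩ ?_
    · have hx := (hmemN (R x)).1 (Submodule.starProjection_apply_mem _ _)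
      have h1 := congr_arg Q hx
      rw [map_add, apply_apply_of_isStarProjection hQ] at h1
      exact left_eq_add.1 (by rw [add_comm]; exact h1.symm)
    · rintro n ⟨hn, hq⟩
      have hn' := (mem_range_iff_of_isStarProjection hP).1 hn
      have hRn : R n = n := Submodule.starProjection_eq_self_iff.2 (hle ⟨hn, hq⟩)
      have hPa : P.adjoint = P := hP.isSelfAdjoint.star_eq
      have hRa : R.adjoint = R := hRs
      rw [inner_sub_left, mul_apply_eq_comp, ← ContinuousLinearMap.adjoint_inner_right, hPa, hn',
        ← ContinuousLinearMap.adjoint_inner_right, hRa, hRn, sub_self]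
  obtain ⟨hf1, e1⟩ := hsub hP hQ hmemN
  obtain ⟨hf2, e2⟩ := hsub hQ hP (fun x => by rw [hmemN, add_comm])
  set N1 := (P.range ⊓ Q.ker : Submodule ℂ H)
  set N2 := (Q.range ⊓ P.ker : Submodule ℂ H)
  have hb1 := traceBound_starProjection N1
  have hb2 := traceBound_starProjection N2
  set E := N1.starProjection - N2.starProjection with hE
  have hDR : (P - Q) * R = E := by rw [sub_mul, e1, e2]
  have hEs : star E = E := by
    rw [hE, star_sub, isStarProjection_starProjection.isSelfAdjoint.star_eq,
      isStarProjection_starProjection.isSelfAdjoint.star_eq]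
  have hRD : R * (P - Q) = E := by
    have := congr_arg star hDR
    rwa [star_mul, hRs, star_sub, hPs, hQs, hEs] at this
  -- `D'` is `D` off `ker C`; the invertible operator `C + R` anticommutes with it
  set D' := P - Q - E with hD'
  have hD'b : TraceBound D' _ := h.sub (hb1.sub hb2)
  have hanti : C * (P - Q) = -((P - Q) * C) := by
    simp only [hC, mul_sub, sub_mul, mul_one, one_mul, hPP, hQQ]
    abel
  have hCE : C * E = 0 := by
    rw [← hDR, ← mul_assoc, hanti, neg_mul, mul_assoc, hCP, mul_zero, neg_zero]
  have hEC : E * C = 0 := by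
    rw [← hRD, mul_assoc]
    have : (P - Q) * C = -(C * (P - Q)) := by rw [hanti, neg_neg]
    rw [this, mul_neg, ← mul_assoc, hPC, zero_mul, neg_zero]
  have hRE : R * E = E := by rw [← hRD, ← mul_assoc, hRR]
  have hER : E * R = E := by rw [← hDR, mul_assoc, hRR]
  have hUD : (C + R) * D' = -(D' * (C + R)) := by
    have e3 : C * D' = -((P - Q) * C) := by rw [hD', mul_sub C (P - Q) E, hCE, hanti, sub_zero]
    have e4 : R * D' = 0 := by rw [hD', mul_sub R (P - Q) E, hRD, hRE, sub_self]
    have e5 : D' * C = (P - Q) * C := by rw [hD', sub_mul (P - Q) E C, hEC, sub_zero]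
    have e6 : D' * R = 0 := by rw [hD', sub_mul (P - Q) E R, hDR, hER, sub_self]
    rw [add_mul, mul_add, e3, e4, e5, e6, add_zero, add_zero]
  have htr0 : trace D' = 0 := by
    obtain ⟨w, hw⟩ := hU
    -- `D'` and `-D'` are `X (C + R)⁻¹` and `(C + R)⁻¹ X`, with `X* = -X`
    obtain ⟨X, hX⟩ : ∃ X, X = D' * (C + R) := ⟨_, rfl⟩
    have hD's : star D' = D' := by rw [hD', star_sub, star_sub, hPs, hQs, hEs]
    have hXs : IsSelfAdjoint (Complex.I • X) := by
      rw [IsSelfAdjoint, star_smul, hX, star_mul, star_add, hCs, hRs, hD's, hUD]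
      simp
    have h1 := trace_mul_comm hXs ((hX ▸ hD'b.mul_right (C + R)).smul Complex.I) (↑w⁻¹ : H →L[ℂ] H)
    have h2 : X * ↑w⁻¹ = D' := by rw [hX, ← hw, mul_assoc, Units.mul_inv, mul_one]
    have h3 : ↑w⁻¹ * X = -D' := by
      rw [← neg_eq_iff_eq_neg, ← mul_neg, hX, ← hUD, ← hw, ← mul_assoc, Units.inv_mul, one_mul]
    rw [smul_mul_assoc, mul_smul_comm, trace_smul, trace_smul, h2, h3, trace_neg] at h1
    have h4 := mul_left_cancel₀ Complex.I_ne_zero h1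
    linear_combination h4 / 2
  have hsum : P - Q = D' + E := by rw [hD']; abel
  rw [hsum, hD'b.trace_add (hb1.sub hb2), htr0, zero_add, hb1.trace_sub hb2,
    trace_starProjection, trace_starProjection,
    pairIndex_eq_finrank_sub hP hQ (isFredholm_pairMap hP hQ h.isCompactOperator)]
  push_cast
  rfl

/-- The trindex may be computed from any projection `P` that differs from `A` by a trace class
operator and from `Q` by a compact one: two projections `P`, `P'` that differ from `A` by trace
class operators satisfy `tr (P - P') = index (P, P')`, and the index is additive. -/
theorem trindex_eq {A P Q : H →L[ℂ] H} (hA : IsSelfAdjoint A) (hP : IsStarProjection P)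
    (hQ : IsStarProjection Q) (hAP : IsTraceClass (A - P))
    (hPQ : IsCompactOperator (P - Q : H →L[ℂ] H)) :
    HasTrindex A Q ∧ trindex A Q = trace (A - P) + (pairIndex P Q : ℂ) := by
  have hh : HasTrindex A Q := ⟨P, hAP, isFredholmPair_of_compact hP hQ hPQ⟩
  refine ⟨hh, ?_⟩
  rw [trindex, dif_pos hh]
  obtain ⟨h1, h2⟩ := hh.choose_spec
  set P' := hh.choose
  have hP' : IsStarProjection P' := h2.left_proj
  have b := traceBound_of_isTraceClass (hA.sub hP.isSelfAdjoint) hAP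
  have b' := traceBound_of_isTraceClass (hA.sub hP'.isSelfAdjoint) h1
  have e : P - P' = (A - P') - (A - P) := by abel
  have b'' := b'.sub b
  rw [← e] at b''
  have h3 := trace_sub_eq_pairIndex hP hP' b''
  have hc : IsCompactOperator (P' - Q : H →L[ℂ] H) := by
    have : P' - Q = (P' - P) + (P - Q) := by abel
    rw [this]
    exact (isCompactOperator_sub_comm b''.isCompactOperator).add hPQ
  have h4 := pairIndex_add hP hQ hP' b''.isCompactOperator hc
  rw [e, b'.trace_sub b] at h3
  rw [h4]
  push_cast
  linear_combination h3

end IndexTrace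

/-! ### The resolvent of a dissipative operator along the imaginary axis -/

section Resolvent

variable {H : Type u} [NormedAddCommGroup H] [InnerProductSpace ℂ H] [CompleteSpace H]

/-- `Im T ≥ 0`, in terms of the quadratic form. -/
def IsDissipative (T : H →L[ℂ] H) : Prop := ∀ x, 0 ≤ (⟪x, T x⟫_ℂ).im

theorem inner_self_im {S : H →L[ℂ] H} (hS : IsSelfAdjoint S) (x : H) : (⟪x, S x⟫_ℂ).im = 0 := by
  have h1 : S.adjoint = S := hS
  have h2 : (starRingEnd ℂ) ⟪x, S x⟫_ℂ = ⟪x, S x⟫_ℂ := by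
    rw [inner_conj_symm, ← ContinuousLinearMap.adjoint_inner_right, h1]
  exact Complex.conj_eq_iff_im.1 h2

theorem isDissipative_of_isSelfAdjoint {S : H →L[ℂ] H} (hS : IsSelfAdjoint S) :
    IsDissipative S := fun x => (inner_self_im hS x).ge

theorem im_inner_add_I_smul {S B : H →L[ℂ] H} (hS : IsSelfAdjoint S) (x : H) :
    (⟪x, (S + Complex.I • B) x⟫_ℂ).im = (⟪x, B x⟫_ℂ).re := by
  rw [_root_.add_apply, _root_.smul_apply, inner_add_right, inner_smul_right, Complex.add_im,
    inner_self_im hS, zero_add, Complex.I_mul_im]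

theorem isDissipative_add_I_smul {S B : H →L[ℂ] H} (hS : IsSelfAdjoint S) (hB : B.IsPositive) :
    IsDissipative (S + Complex.I • B) := fun x => by
  rw [im_inner_add_I_smul hS]
  exact hB.re_inner_nonneg_right x

/-- The resolvent `(T + iy)⁻¹`; by convention it is zero where `T + iy` is not invertible. -/
def resAt (T : H →L[ℂ] H) (y : ℝ) : H →L[ℂ] H :=
  Ring.inverse (T + ((y : ℂ) * Complex.I) • (1 : H →L[ℂ] H))

theorem im_inner_add_smul_one (T : H →L[ℂ] H) (y : ℝ) (x : H) :
    (⟪x, (T + ((y : ℂ) * Complex.I) • (1 : H →L[ℂ] H)) x⟫_ℂ).im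
      = (⟪x, T x⟫_ℂ).im + y * ‖x‖ ^ 2 := by
  rw [_root_.add_apply, _root_.smul_apply, one_apply_eq_self, inner_add_right, inner_smul_right,
    inner_self_eq_norm_sq_to_K, Complex.add_im]
  congr 1
  change ((y : ℂ) * Complex.I * (‖x‖ : ℂ) ^ 2).im = _
  rw [← Complex.ofReal_pow, Complex.im_mul_ofReal]
  simp

theorem IsDissipative.mul_norm_le {T : H →L[ℂ] H} (hT : IsDissipative T) (y : ℝ) (x : H) :
    y * ‖x‖ ≤ ‖(T + ((y : ℂ) * Complex.I) • (1 : H →L[ℂ] H)) x‖ := by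
  set z := (T + ((y : ℂ) * Complex.I) • (1 : H →L[ℂ] H)) x with hz
  have h1 : (⟪x, z⟫_ℂ).im = (⟪x, T x⟫_ℂ).im + y * ‖x‖ ^ 2 := im_inner_add_smul_one T y x
  have h2 : y * ‖x‖ ^ 2 ≤ ‖x‖ * ‖z‖ := by
    have := (Complex.im_le_norm _).trans (norm_inner_le_norm (𝕜 := ℂ) x z)
    linarith [hT x]
  rcases (norm_nonneg x).eq_or_lt with h0 | h0
  · rw [← h0, mul_zero]; exact norm_nonneg _
  · nlinarith

theorem IsDissipative.isUnit_add {T : H →L[ℂ] H} (hT : IsDissipative T) {y : ℝ} (hy : 0 < y) :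
    IsUnit (T + ((y : ℂ) * Complex.I) • (1 : H →L[ℂ] H)) := by
  refine ContinuousLinearMap.isUnit_of_forall_le_norm_inner_map _ (c := ⟨y, hy.le⟩) hy fun x => ?_
  rw [norm_inner_symm]
  refine le_trans ?_ (Complex.im_le_norm _)
  rw [im_inner_add_smul_one]
  change ‖x‖ ^ 2 * y ≤ _
  linarith [hT x]

/-- `T + iy` is invertible for all `y ≥ 0`, with inverse of norm at most `M / (1 + y)`. -/
structure ResolventBound (T : H →L[ℂ] H) (M : ℝ) : Prop where
  isUnit : ∀ y : ℝ, 0 ≤ y → IsUnit (T + ((y : ℂ) * Complex.I) • (1 : H →L[ℂ] H))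
  norm_le : ∀ y : ℝ, 0 ≤ y → ‖resAt T y‖ ≤ M * (1 + y)⁻¹

/-- For large `y` the bound comes from `y ‖x‖ ≤ ‖(T + iy) x‖`, for small `y` from `‖x‖ ≤ ‖T⁻¹‖ ‖T x‖`;
adding the two covers all `y`. -/
theorem IsDissipative.resolventBound {T : H →L[ℂ] H} (hT : IsDissipative T) (hu : IsUnit T) :
    ResolventBound T (2 * ‖Ring.inverse T‖ + 1) := by
  have hU : ∀ y : ℝ, 0 ≤ y → IsUnit (T + ((y : ℂ) * Complex.I) • (1 : H →L[ℂ] H)) := by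
    intro y hy
    rcases hy.eq_or_lt with rfl | hy
    · simpa using hu
    · exact hT.isUnit_add hy
  refine ⟨hU, fun y hy => ?_⟩
  refine ContinuousLinearMap.opNorm_le_bound _ (by positivity) fun u => ?_
  set x := resAt T y u with hx
  have hxu : (T + ((y : ℂ) * Complex.I) • (1 : H →L[ℂ] H)) x = u :=
    congr($(Ring.mul_inverse_cancel _ (hU y hy)) u)
  have h1 := hT.mul_norm_le y x
  rw [hxu] at h1
  have h2 : ‖x‖ ≤ ‖Ring.inverse T‖ * ‖T x‖ := by
    have : Ring.inverse T (T x) = x := congr($(Ring.inverse_mul_cancel _ hu) x)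
    conv_lhs => rw [← this]
    exact ContinuousLinearMap.le_opNorm _ _
  have h3 : ‖T x‖ ≤ ‖u‖ + y * ‖x‖ := by
    have : T x = u - ((y : ℂ) * Complex.I) • x := by
      rw [← hxu, _root_.add_apply, _root_.smul_apply, one_apply_eq_self, add_sub_cancel_right]
    rw [this]
    refine (norm_sub_le _ _).trans ?_
    rw [norm_smul]
    simp [abs_of_nonneg hy]
  have h4 : ‖x‖ ≤ ‖Ring.inverse T‖ * (2 * ‖u‖) :=
    h2.trans (mul_le_mul_of_nonneg_left (by linarith) (norm_nonneg _))
  rw [mul_right_comm, ← div_eq_mul_inv, le_div_iff₀ (by linarith)]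
  linarith

namespace ResolventBound

variable {T T' : H →L[ℂ] H} {M M' : ℝ}

theorem nonneg (h : ResolventBound T M) : 0 ≤ M := by
  have := (norm_nonneg _).trans (h.norm_le 0 le_rfl)
  simpa using this

theorem continuousOn (h : ResolventBound T M) : ContinuousOn (resAt T) (Set.Ici 0) := by
  intro y hy
  refine ContinuousAt.continuousWithinAt ?_
  obtain ⟨w, hw⟩ := h.isUnit y hy
  have h1 := NormedRing.inverse_continuousAt w
  rw [hw] at h1
  exact h1.comp (f := fun y : ℝ => T + ((y : ℂ) * Complex.I) • (1 : H →L[ℂ] H)) (by fun_prop)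

theorem mul_inv_sq_le {a y : ℝ} (ha : 0 ≤ a) (hy : 0 ≤ y) :
    a * (1 + y)⁻¹ * (1 + y)⁻¹ ≤ a * (1 + y ^ 2)⁻¹ := by
  rw [mul_assoc, ← mul_inv]
  refine mul_le_mul_of_nonneg_left (inv_anti₀ (by positivity) ?_) ha
  nlinarith

theorem norm_mul_mul_le (h : ResolventBound T M) (h' : ResolventBound T' M') {y : ℝ} (hy : 0 ≤ y)
    {c : ℝ} (hc : 0 ≤ c) :
    ‖resAt T y‖ * c * ‖resAt T' y‖ ≤ M * c * M' * (1 + y ^ 2)⁻¹ := by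
  refine le_trans ?_ (mul_inv_sq_le
    (mul_nonneg (mul_nonneg h.nonneg hc) h'.nonneg) hy)
  have h1 := h.norm_le y hy
  have h2 := h'.norm_le y hy
  calc _ ≤ (M * (1 + y)⁻¹) * c * (M' * (1 + y)⁻¹) :=
        mul_le_mul (mul_le_mul_of_nonneg_right h1 hc) h2 (norm_nonneg _)
          (mul_nonneg ((norm_nonneg _).trans h1) hc)
    _ = _ := by ring

theorem sub_eq (h : ResolventBound T M) (h' : ResolventBound T' M') {y : ℝ} (hy : 0 ≤ y) :
    resAt T y - resAt T' y = resAt T y * (T' - T) * resAt T' y := by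
  have h1 := Ring.inverse_sub_inverse (iff_of_true (h.isUnit y hy) (h'.isUnit y hy))
  rw [resAt, resAt, h1]
  congr 2
  abel

/-- The real part of the resolvent decays like `y⁻²`, while `(T + iy)⁻¹` itself is not integrable. -/
theorem resAt_add_star (h : ResolventBound T M) {y : ℝ} (hy : 0 ≤ y) :
    resAt T y + star (resAt T y) = resAt T y * (T + star T) * star (resAt T y) := by
  set R := T + ((y : ℂ) * Complex.I) • (1 : H →L[ℂ] H) with hR
  have hu : IsUnit R := h.isUnit y hy
  have h1 : T + star T = R + star R := by
    rw [hR, star_add, star_smul, star_one]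
    simp only [star_mul', RCLike.star_def, Complex.conj_ofReal, Complex.conj_I, mul_neg, neg_smul]
    abel
  have h2 : Ring.inverse R * R = 1 := Ring.inverse_mul_cancel _ hu
  have h3 : star R * star (Ring.inverse R) = 1 := by rw [← star_mul, h2, star_one]
  change Ring.inverse R + star (Ring.inverse R)
    = Ring.inverse R * (T + star T) * star (Ring.inverse R)
  rw [h1, mul_add, add_mul, h2, one_mul, mul_assoc _ (star R), h3, mul_one, add_comm]

theorem integrableOn (h : ResolventBound T M) :
    IntegrableOn (fun y => resAt T y + star (resAt T y)) (Set.Ioi 0) := by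
  have hm : AEStronglyMeasurable (fun y => resAt T y + star (resAt T y))
      (volume.restrict (Set.Ioi 0)) := by
    have h1 := h.continuousOn.mono Set.Ioi_subset_Ici_self
    exact (h1.add h1.star).aestronglyMeasurable measurableSet_Ioi
  refine Integrable.mono' ((integrable_inv_one_add_sq.integrableOn (s := Set.Ioi 0)).const_mul
    (M * ‖T + star T‖ * M)) hm ?_
  refine ae_restrict_of_forall_mem measurableSet_Ioi fun y hy => ?_
  rw [h.resAt_add_star (le_of_lt hy)]
  refine le_trans ?_ (h.norm_mul_mul_le h (le_of_lt hy) (norm_nonneg (T + star T)))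
  refine (norm_mul_le _ _).trans ?_
  rw [norm_star]
  exact mul_le_mul_of_nonneg_right (norm_mul_le _ _) (norm_nonneg _)

end ResolventBound

/-- The operator `½ - π⁻¹ ∫₀^∞ Re (T + iy)⁻¹ dy`, which for invertible self-adjoint `T` is the
spectral projection of `T` for the negative half-line. -/
def negSpec (T : H →L[ℂ] H) : H →L[ℂ] H :=
  (2⁻¹ : ℂ) • 1 - ((2 * Real.pi : ℝ) : ℂ)⁻¹ •
    ∫ y in Set.Ioi (0 : ℝ), (resAt T y + star (resAt T y))

theorem isSelfAdjoint_negSpec (T : H →L[ℂ] H) : IsSelfAdjoint (negSpec T) := by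
  have h1 : star (∫ y in Set.Ioi (0 : ℝ), (resAt T y + star (resAt T y)))
      = ∫ y in Set.Ioi (0 : ℝ), (resAt T y + star (resAt T y)) := by
    have := ((starL' ℝ : (H →L[ℂ] H) ≃L[ℝ] (H →L[ℂ] H)).integral_comp_comm
      (μ := volume.restrict (Set.Ioi (0 : ℝ))) (fun y => resAt T y + star (resAt T y))).symm
    refine this.trans (integral_congr_ae (Eventually.of_forall fun y => ?_))
    change star (resAt T y + star (resAt T y)) = _
    rw [star_add, star_star, add_comm]
  rw [IsSelfAdjoint, negSpec, star_sub, star_smul, star_smul, h1, star_one]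
  simp

section Difference

variable {T T' : H →L[ℂ] H} {M M' : ℝ}

/-- The second resolvent identity under the integral. It makes `T' - T` a factor of the integrand, so
that compactness and trace bounds of `T' - T` carry over to the difference. -/
theorem negSpec_sub (h : ResolventBound T M) (h' : ResolventBound T' M') :
    negSpec T - negSpec T' = -(((2 * Real.pi : ℝ) : ℂ)⁻¹ •
      ∫ y in Set.Ioi (0 : ℝ), (resAt T y * (T' - T) * resAt T' y
        + star (resAt T y * (T' - T) * resAt T' y))) := by
  have h1 : ∫ y in Set.Ioi (0 : ℝ), (resAt T y * (T' - T) * resAt T' y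
        + star (resAt T y * (T' - T) * resAt T' y))
      = (∫ y in Set.Ioi (0 : ℝ), (resAt T y + star (resAt T y)))
        - ∫ y in Set.Ioi (0 : ℝ), (resAt T' y + star (resAt T' y)) := by
    rw [← integral_sub h.integrableOn h'.integrableOn]
    refine setIntegral_congr_fun measurableSet_Ioi fun y hy => ?_
    rw [← h.sub_eq h' (le_of_lt hy), star_sub]
    abel
  rw [h1, negSpec, negSpec, smul_sub]
  abel

theorem integrableOn_resAt_mul (h : ResolventBound T M) (h' : ResolventBound T' M') :
    IntegrableOn (fun y => resAt T y * (T' - T) * resAt T' y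
        + star (resAt T y * (T' - T) * resAt T' y)) (Set.Ioi 0) := by
  refine (h.integrableOn.sub h'.integrableOn).congr ?_
  refine ae_restrict_of_forall_mem measurableSet_Ioi fun y hy => ?_
  simp only [Pi.sub_apply]
  rw [← h.sub_eq h' (le_of_lt hy), star_sub]
  abel

theorem integral_const_mul_inv_one_add_sq (c : ℝ) :
    ∫ y in Set.Ioi (0 : ℝ), c * (1 + y ^ 2)⁻¹ = c * (Real.pi / 2) := by
  rw [integral_const_mul, integral_Ioi_inv_one_add_sq, Real.arctan_zero, sub_zero]

theorem norm_inv_two_pi : ‖((2 * Real.pi : ℝ) : ℂ)⁻¹‖ = (2 * Real.pi)⁻¹ := by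
  rw [norm_inv, Complex.norm_real, Real.norm_of_nonneg (by positivity)]

theorem traceBound_negSpec_sub (h : ResolventBound T M) (h' : ResolventBound T' M') {c : ℝ}
    (hc : TraceBound (T' - T) c) : TraceBound (negSpec T - negSpec T') (M * c * M' / 2) := by
  rw [negSpec_sub h h']
  have hint : TraceBound _ _ := TraceBound.integral
    (g := fun y : ℝ => (M * c * M' + M * c * M') * (1 + y ^ 2)⁻¹)
    (integrableOn_resAt_mul h h') (integrable_inv_one_add_sq.integrableOn.const_mul _)
    (ae_restrict_of_forall_mem measurableSet_Ioi fun y hy => by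
      have h1 := (hc.mul_mul (resAt T y) (resAt T' y)).mono
        (h.norm_mul_mul_le h' (le_of_lt hy) hc.nonneg)
      rw [add_mul]
      exact h1.add h1.star)
  refine ((hint.smul _).neg).mono (le_of_eq ?_)
  rw [integral_const_mul_inv_one_add_sq, norm_inv_two_pi]
  field_simp
  ring

theorem norm_negSpec_sub_le (h : ResolventBound T M) (h' : ResolventBound T' M') :
    ‖negSpec T - negSpec T'‖ ≤ M * ‖T' - T‖ * M' / 2 := by
  rw [negSpec_sub h h', norm_neg, norm_smul, norm_inv_two_pi]
  have h1 : ‖∫ y in Set.Ioi (0 : ℝ), (resAt T y * (T' - T) * resAt T' y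
        + star (resAt T y * (T' - T) * resAt T' y))‖
      ≤ ∫ y in Set.Ioi (0 : ℝ), (2 * (M * ‖T' - T‖ * M')) * (1 + y ^ 2)⁻¹ := by
    refine norm_integral_le_of_norm_le (integrable_inv_one_add_sq.integrableOn.const_mul _) ?_
    refine ae_restrict_of_forall_mem measurableSet_Ioi fun y hy => ?_
    refine (norm_add_le _ _).trans ?_
    rw [norm_star, ← two_mul, mul_assoc 2]
    refine mul_le_mul_of_nonneg_left ?_ zero_le_two
    refine le_trans ?_ (h.norm_mul_mul_le h' (le_of_lt hy) (norm_nonneg (T' - T)))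
    exact (norm_mul_le _ _).trans
      (mul_le_mul_of_nonneg_right (norm_mul_le _ _) (norm_nonneg _))
  rw [integral_const_mul_inv_one_add_sq] at h1
  calc _ ≤ (2 * Real.pi)⁻¹ * (2 * (M * ‖T' - T‖ * M') * (Real.pi / 2)) :=
        mul_le_mul_of_nonneg_left h1 (by positivity)
    _ = _ := by field_simp

/-- The compact operators form a closed subspace. -/
theorem isCompactOperator_integral {α : Type*} [MeasurableSpace α] {μ : Measure α}
    {f : α → H →L[ℂ] H} (hf : ∀ a, IsCompactOperator (f a)) :
    IsCompactOperator (∫ a, f a ∂μ : H →L[ℂ] H) := by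
  let C : Submodule ℂ (H →L[ℂ] H) := compactOperator (RingHom.id ℂ) H H
  have hC : IsClosed (C : Set (H →L[ℂ] H)) := isClosed_setOfPred_isCompactOperator
  have hcomp : CompleteSpace C := hC.completeSpace_coe
  have h1 := C.subtypeₗᵢ.integral_comp_comm (μ := μ) (fun a => (⟨f a, hf a⟩ : C))
  have h2 : (∫ a, f a ∂μ) ∈ C := by
    change (∫ a, C.subtypeₗᵢ (⟨f a, hf a⟩ : C) ∂μ) ∈ C
    rw [h1]
    exact (∫ a, (⟨f a, hf a⟩ : C) ∂μ).2
  exact h2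

theorem isCompactOperator_negSpec_sub (h : ResolventBound T M) (h' : ResolventBound T' M')
    (hc : IsCompactOperator (T' - T : H →L[ℂ] H))
    (hc' : IsCompactOperator (star (T' - T) : H →L[ℂ] H)) :
    IsCompactOperator (negSpec T - negSpec T' : H →L[ℂ] H) := by
  rw [negSpec_sub h h']
  refine IsCompactOperator.neg ?_
  refine IsCompactOperator.smul ?_ _
  refine isCompactOperator_integral fun y => ?_
  have h1 := isCompactOperator_mul_right (isCompactOperator_mul_left hc (resAt T y)) (resAt T' y)
  have h2 := isCompactOperator_mul_left
    (isCompactOperator_mul_right hc' (star (resAt T y))) (star (resAt T' y))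
  rw [← star_mul, ← star_mul] at h2
  exact h1.add h2

end Difference

/-- The value is `π sgn t`, also at `t = 0`, where division by zero makes both sides vanish. -/
theorem integral_two_mul_div_sq_add_sq (t : ℝ) :
    ∫ y in Set.Ioi (0 : ℝ), 2 * t / (t ^ 2 + y ^ 2) = Real.pi * (t / |t|) := by
  rcases eq_or_ne t 0 with rfl | ht
  · simp
  have ha : 0 < |t| := abs_pos.2 ht
  have h1 := integral_comp_mul_left_Ioi (fun y : ℝ => (1 + y ^ 2)⁻¹) 0 (inv_pos.2 ha)
  rw [mul_zero, integral_Ioi_inv_one_add_sq, Real.arctan_zero, sub_zero, inv_inv, smul_eq_mul] at h1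
  have h2 : ∀ y : ℝ, 2 * t / (t ^ 2 + y ^ 2) = 2 * t / |t| ^ 2 * (1 + (|t|⁻¹ * y) ^ 2)⁻¹ := by
    intro y
    have : 0 < t ^ 2 := by positivity
    rw [mul_pow, inv_pow, sq_abs]
    field_simp
  simp_rw [h2]
  rw [integral_const_mul, h1]
  field_simp

section SelfAdjoint

theorem resAt_eq_cfc {T : H →L[ℂ] H} (hT : IsSelfAdjoint T) {y : ℝ} (hy : 0 < y) :
    resAt T y + star (resAt T y) = cfc (fun t : ℝ => 2 * t / (t ^ 2 + y ^ 2)) T := by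
  have hne : ∀ t : ℝ, t ^ 2 + y ^ 2 ≠ 0 := fun t => by positivity
  set X : H →L[ℂ] H := cfc (fun t : ℝ => t / (t ^ 2 + y ^ 2)) T with hX
  set Z : H →L[ℂ] H := cfc (fun t : ℝ => 1 / (t ^ 2 + y ^ 2)) T with hZ
  have hcX : Continuous fun t : ℝ => t / (t ^ 2 + y ^ 2) := by
    exact continuous_id.div (by fun_prop) hne
  have hcZ : Continuous fun t : ℝ => 1 / (t ^ 2 + y ^ 2) :=
    continuous_const.div (by fun_prop) hne
  have hXs : star X = X := (cfc_predicate (fun t : ℝ => t / (t ^ 2 + y ^ 2)) T : IsSelfAdjoint X)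
  have hZs : star Z = Z := (cfc_predicate (fun t : ℝ => 1 / (t ^ 2 + y ^ 2)) T : IsSelfAdjoint Z)
  have e1 : T * Z = X := by
    conv_lhs => rw [← cfc_id' ℝ T]
    rw [hZ, ← cfc_mul _ _ T (by fun_prop) hcZ.continuousOn]
    congr 1; funext t; ring
  have e2 : T * X + ((y : ℂ) ^ 2) • Z = 1 := by
    conv_lhs => rw [← cfc_id' ℝ T]
    have : ((y : ℂ) ^ 2) • Z = (y ^ 2 : ℝ) • Z := by
      rw [← Complex.ofReal_pow]; exact Complex.coe_smul _ _
    rw [this, cfc_id' ℝ T, hX, hZ, ← cfc_const_mul _ _ T hcZ.continuousOn]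
    conv_lhs => enter [1, 1]; rw [← cfc_id' ℝ T]
    rw [← cfc_mul _ _ T (by fun_prop) hcX.continuousOn,
      ← cfc_add T (fun t : ℝ => t * (t / (t ^ 2 + y ^ 2)))
        (fun t : ℝ => y ^ 2 * (1 / (t ^ 2 + y ^ 2))) (continuousOn_id.mul hcX.continuousOn)
        (continuousOn_const.mul hcZ.continuousOn), ← cfc_one ℝ T]
    congr 1; funext t
    have := hne t
    field_simp
    simp
  have hu := (isDissipative_of_isSelfAdjoint hT).isUnit_add hy
  have e3 : (T + ((y : ℂ) * Complex.I) • (1 : H →L[ℂ] H)) * (X - ((y : ℂ) * Complex.I) • Z) = 1 := by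
    rw [add_mul, mul_sub, mul_sub, mul_smul_comm, e1, smul_mul_assoc, one_mul, smul_mul_assoc,
      one_mul, smul_smul, ← e2]
    have : (y : ℂ) * Complex.I * (y * Complex.I) = -(y : ℂ) ^ 2 := by
      linear_combination (y : ℂ) ^ 2 * Complex.I_sq
    rw [this, neg_smul]
    abel
  have e4 : resAt T y = X - ((y : ℂ) * Complex.I) • Z := by
    have e6 := Ring.inverse_mul_cancel_left _ (X - ((y : ℂ) * Complex.I) • Z) hu
    rw [e3, mul_one] at e6
    exact e6
  rw [e4, star_sub, star_smul, hXs, hZs]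
  simp only [star_mul', RCLike.star_def, Complex.conj_ofReal, Complex.conj_I, mul_neg, neg_smul]
  have e5 : cfc (fun t : ℝ => 2 * t / (t ^ 2 + y ^ 2)) T = (2 : ℝ) • X := by
    rw [hX, ← cfc_const_mul _ _ T hcX.continuousOn]
    congr 1; funext t; ring
  rw [e5, two_smul]
  abel

/-- In the functional calculus `negSpec T` is `½ - ½ sgn T`. -/
theorem isStarProjection_negSpec {T : H →L[ℂ] H} (hT : IsSelfAdjoint T) (hu : IsUnit T) :
    IsStarProjection (negSpec T) := by
  have h0 : ∀ t ∈ spectrum ℝ T, t ≠ 0 := fun t ht h => by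
    rw [h] at ht; exact (spectrum.zero_notMem_iff ℝ).2 hu ht
  have hcomp : IsCompact (spectrum ℝ T) := spectrum.isCompact T
  have hcb : ContinuousOn (fun t : ℝ => 2 * (1 + t ^ 2) / |t|) (spectrum ℝ T) :=
    ContinuousOn.div (by fun_prop) (by fun_prop) fun t ht => abs_ne_zero.2 (h0 t ht)
  obtain ⟨C, hC⟩ := hcomp.exists_bound_of_continuousOn hcb
  have key : ∫ y in Set.Ioi (0 : ℝ), (resAt T y + star (resAt T y))
      = cfc (fun t : ℝ => Real.pi * (t / |t|)) T := by
    simp_rw [← integral_two_mul_div_sq_add_sq]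
    rw [cfc_setIntegral measurableSet_Ioi (fun (y t : ℝ) => 2 * t / (t ^ 2 + y ^ 2))
      (fun y => C * (1 + y ^ 2)⁻¹) T]
    · exact setIntegral_congr_fun measurableSet_Ioi fun y hy => resAt_eq_cfc hT hy
    · refine ContinuousOn.div (by fun_prop) (by fun_prop) ?_
      rintro ⟨y, t⟩ ⟨hy, -⟩
      have : 0 < y := hy
      simp only
      positivity
    · refine Eventually.of_forall fun y t ht => ?_
      have hb := hC t ht
      have ht0 : 0 < |t| := abs_pos.2 (h0 t ht)
      rw [Real.norm_of_nonneg (by positivity)] at hb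
      refine le_trans ?_ (mul_le_mul_of_nonneg_right hb (by positivity))
      have ht2 : 0 < t ^ 2 := by have := h0 t ht; positivity
      rw [norm_div, Real.norm_of_nonneg (by positivity : 0 ≤ t ^ 2 + y ^ 2), norm_mul,
        Real.norm_eq_abs t, ← div_eq_mul_inv, div_div, div_le_div_iff₀ (by positivity)
        (by positivity)]
      norm_num
      have : |t| * |t| = t ^ 2 := by rw [← sq, sq_abs]
      nlinarith [sq_nonneg (t * y), sq_nonneg (t ^ 2), sq_nonneg y]
    · exact (integrable_inv_one_add_sq.integrableOn.const_mul _).2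
  have hcs : ContinuousOn (fun t : ℝ => t / |t|) (spectrum ℝ T) :=
    ContinuousOn.div (by fun_prop) (by fun_prop) fun t ht => abs_ne_zero.2 (h0 t ht)
  have e : negSpec T = cfc (fun t : ℝ => 1 / 2 - 1 / 2 * (t / |t|)) T := by
    have e1 : cfc (fun t : ℝ => 1 / 2 - 1 / 2 * (t / |t|)) T
        = (2⁻¹ : ℝ) • 1 - (2 * Real.pi)⁻¹ • cfc (fun t : ℝ => Real.pi * (t / |t|)) T := by
      rw [cfc_sub (fun _ => 1 / 2) _ T (by fun_prop) (hcs.const_mul _), cfc_const _ _,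
        ← cfc_const_mul _ _ T (hcs.const_mul _)]
      congr 1
      · rw [Algebra.algebraMap_eq_smul_one]; norm_num
      · congr 1; funext t; field_simp
    rw [e1, ← key, negSpec, ← Complex.ofReal_inv]
    congr 1
    rw [← Complex.coe_smul]; norm_num
  refine ⟨?_, isSelfAdjoint_negSpec T⟩
  rw [IsIdempotentElem, e]
  have hce : ContinuousOn (fun t : ℝ => 1 / 2 - 1 / 2 * (t / |t|)) (spectrum ℝ T) :=
    continuousOn_const.sub (continuousOn_const.mul hcs)
  rw [← cfc_mul _ _ T hce hce]
  refine cfc_congr fun t ht => ?_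
  have : t / |t| * (t / |t|) = 1 := by
    have := h0 t ht
    rw [div_mul_div_comm, abs_mul_abs_self, div_self (mul_ne_zero this this)]
  linear_combination this / 4

end SelfAdjoint

end Resolvent

/-! ### The compression of the spectral projection of a dilation -/

section MeasureIntegrals

variable (μ : Measure ℝ) [IsFiniteMeasure μ]

theorem integrableOn_two_mul_div (t : ℝ) :
    IntegrableOn (fun y : ℝ => 2 * t / (t ^ 2 + y ^ 2)) (Set.Ioi 0) := by
  rcases eq_or_ne t 0 with rfl | ht
  · simp
  · refine Integrable.of_integral_ne_zero ?_
    rw [integral_two_mul_div_sq_add_sq]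
    exact mul_ne_zero Real.pi_ne_zero (div_ne_zero ht (abs_ne_zero.2 ht))

theorem abs_div_abs_le_one (t : ℝ) : abs (t / |t|) ≤ 1 := by
  rw [abs_div, abs_abs]; exact div_self_le_one _

/-- Fubini for the kernel `2t / (t² + y²)`, whose integral in `y` is `π sgn t`. -/
theorem integral_integral_two_mul_div :
    ∫ y in Set.Ioi (0 : ℝ), ∫ t, 2 * t / (t ^ 2 + y ^ 2) ∂μ
      = Real.pi * (μ.real (Set.Ioi 0) - μ.real (Set.Iio 0)) := by
  have hint : Integrable (fun p : ℝ × ℝ => 2 * p.1 / (p.1 ^ 2 + p.2 ^ 2))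
      (μ.prod (volume.restrict (Set.Ioi 0))) := by
    have hm : Measurable fun p : ℝ × ℝ => 2 * p.1 / (p.1 ^ 2 + p.2 ^ 2) := by fun_prop
    refine (integrable_prod_iff hm.aestronglyMeasurable).2
      ⟨Eventually.of_forall fun t => integrableOn_two_mul_div t, ?_⟩
    have e : (fun t : ℝ => ∫ y in Set.Ioi (0 : ℝ), ‖2 * t / (t ^ 2 + y ^ 2)‖)
        = fun t => Real.pi * (|t| / |(|t|)|) := by
      funext t
      rw [← integral_two_mul_div_sq_add_sq]
      refine integral_congr_ae (Eventually.of_forall fun y => ?_)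
      simp only [norm_div, norm_mul, Real.norm_eq_abs, sq_abs, Nat.abs_ofNat]
      rw [abs_of_nonneg (by positivity : 0 ≤ t ^ 2 + y ^ 2)]
    rw [e]
    refine Integrable.mono' (integrable_const Real.pi)
      (Measurable.aestronglyMeasurable (by fun_prop)) (Eventually.of_forall fun t => ?_)
    rw [Real.norm_eq_abs, abs_mul, abs_of_pos Real.pi_pos]
    exact mul_le_of_le_one_right Real.pi_pos.le (abs_div_abs_le_one _)
  rw [← integral_integral_swap hint]
  simp_rw [integral_two_mul_div_sq_add_sq]
  rw [integral_const_mul]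
  congr 1
  have e : (fun t : ℝ => t / |t|) = fun t => (Set.Ioi (0 : ℝ)).indicator (fun _ => (1 : ℝ)) t
      - (Set.Iio (0 : ℝ)).indicator (fun _ => (1 : ℝ)) t := by
    funext t
    rcases lt_trichotomy t 0 with h | h | h
    · simp [h, h.le, h.ne, abs_of_neg h]
    · simp [h]
    · simp [h, h.le, h.ne', abs_of_pos h]
  rw [e, integral_sub ((integrable_const 1).indicator measurableSet_Ioi)
    ((integrable_const 1).indicator measurableSet_Iio), integral_indicator_const _ measurableSet_Ioi,
    integral_indicator_const _ measurableSet_Iio]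
  simp

/-- The functions `iy / (t + iy)` tend boundedly to the indicator function of `{0}` as `y → 0`. -/
theorem tendsto_integral_mul_inv :
    Tendsto (fun y : ℝ => ∫ t : ℝ, ((y : ℂ) * Complex.I) * ((t : ℂ) + y * Complex.I)⁻¹ ∂μ)
      (𝓝[>] 0) (𝓝 ((μ.real {0} : ℝ) : ℂ)) := by
  have e : ((μ.real {0} : ℝ) : ℂ) = ∫ t : ℝ, ({0} : Set ℝ).indicator (fun _ => (1 : ℂ)) t ∂μ := by
    rw [integral_indicator_const _ (measurableSet_singleton 0)]
    simp
  rw [e]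
  refine tendsto_integral_filter_of_dominated_convergence (fun _ => (1 : ℝ))
    (Eventually.of_forall fun y => ?_) ?_ (integrable_const 1) (Eventually.of_forall fun t => ?_)
  · exact Measurable.aestronglyMeasurable (by fun_prop)
  · filter_upwards [self_mem_nhdsWithin] with y hy
    refine Eventually.of_forall fun t => ?_
    have hy' : 0 < y := hy
    rw [norm_mul, norm_inv, ← div_eq_mul_inv]
    refine div_le_one_of_le₀ ?_ (norm_nonneg _)
    have h1 := Complex.abs_im_le_norm ((t : ℂ) + y * Complex.I)
    simpa using h1
  · rcases eq_or_ne t 0 with rfl | ht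
    · refine tendsto_const_nhds.congr' ?_
      filter_upwards [self_mem_nhdsWithin] with y hy
      have hy' : (y : ℂ) ≠ 0 := by exact_mod_cast (ne_of_gt hy)
      have h1 : (y : ℂ) * Complex.I ≠ 0 := mul_ne_zero hy' Complex.I_ne_zero
      rw [Complex.ofReal_zero, zero_add, mul_inv_cancel₀ h1, Set.indicator_of_mem (Set.mem_singleton 0)]
    · have hc : ContinuousAt (fun y : ℝ => ((y : ℂ) * Complex.I) * ((t : ℂ) + y * Complex.I)⁻¹) 0 := by
        refine ContinuousAt.mul (by fun_prop) (ContinuousAt.inv₀ (by fun_prop) ?_)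
        simpa using ht
      have := hc.tendsto.mono_left (nhdsWithin_le_nhds (s := Set.Ioi 0))
      simpa [ht] using this

end MeasureIntegrals

section Compression

variable {H : Type u} [NormedAddCommGroup H] [InnerProductSpace ℂ H] [CompleteSpace H]

theorem SpectralMeasure.measure_univ {K : Type u} [NormedAddCommGroup K] [InnerProductSpace ℂ K]
    [CompleteSpace K] (E : SpectralMeasure K) (x : K) :
    E.measure x Set.univ = ENNReal.ofReal (‖x‖ ^ 2) := by
  rw [E.measure_apply x MeasurableSet.univ, E.proj_univ, one_apply_eq_self,
    inner_self_eq_norm_sq_to_K]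
  norm_cast

theorem SpectralMeasure.isFiniteMeasure {K : Type u} [NormedAddCommGroup K] [InnerProductSpace ℂ K]
    [CompleteSpace K] (E : SpectralMeasure K) (x : K) : IsFiniteMeasure (E.measure x) :=
  ⟨by rw [E.measure_univ]; exact ENNReal.ofReal_lt_top⟩

/-- `T` and `T + P` agree on `ker P`; on `ran P` they are `0` and `1`. -/
theorem resAt_eq_add_of_mul_eq_zero {T P : H →L[ℂ] H} (hT : IsDissipative T)
    (hP : IsStarProjection P) (h1 : T * P = 0) (h2 : P * T = 0) {M : ℝ}
    (hM : ResolventBound (T + P) M) {y : ℝ} (hy : 0 < y) :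
    resAt T y = resAt (T + P) y
      + (((y : ℂ) * Complex.I)⁻¹ - (1 + (y : ℂ) * Complex.I)⁻¹) • P := by
  set s : ℂ := (y : ℂ) * Complex.I with hs
  have hPP : P * P = P := hP.isIdempotentElem
  have hs0 : s ≠ 0 := by simp [hs, hy.ne']
  have hs1 : 1 + s ≠ 0 := fun h => by
    have := congr_arg Complex.re h
    simp [hs] at this
  have hu := hT.isUnit_add hy
  have hu' := hM.isUnit y hy.le
  rw [← hs] at hu hu'
  have e1 : P * (T + P + s • (1 : H →L[ℂ] H)) = (1 + s) • P := by
    rw [mul_add, mul_add, h2, hPP, zero_add, mul_smul_comm, mul_one, add_smul, one_smul]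
  have e2 : P * resAt (T + P) y = (1 + s)⁻¹ • P := by
    have := congr_arg (fun X => (1 + s)⁻¹ • (X * resAt (T + P) y)) e1
    simp only [smul_mul_assoc, smul_smul, inv_mul_cancel₀ hs1, one_smul, mul_assoc] at this
    rw [← this, resAt, ← hs, Ring.mul_inverse_cancel _ hu', mul_one]
  have e3 : (T + s • (1 : H →L[ℂ] H)) * resAt (T + P) y = 1 - (1 + s)⁻¹ • P := by
    have : T + s • (1 : H →L[ℂ] H) = (T + P + s • (1 : H →L[ℂ] H)) - P := by abel
    rw [this, sub_mul, e2, resAt, ← hs, Ring.mul_inverse_cancel _ hu']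
  have e4 : (T + s • (1 : H →L[ℂ] H)) * (resAt (T + P) y + (s⁻¹ - (1 + s)⁻¹) • P) = 1 := by
    rw [mul_add, e3, mul_smul_comm, add_mul, h1, zero_add, smul_mul_assoc, one_mul, smul_smul,
      sub_add, ← sub_smul]
    have : (1 + s)⁻¹ - (s⁻¹ - (1 + s)⁻¹) * s = 0 := by
      field_simp
      ring
    rw [this, zero_smul, sub_zero]
  have e5 := Ring.inverse_mul_cancel_left _ (resAt (T + P) y + (s⁻¹ - (1 + s)⁻¹) • P) hu
  rw [e4, mul_one] at e5
  exact e5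

namespace SelfAdjointDilation

variable {T P : H →L[ℂ] H}

theorem inner_resAt (D : SelfAdjointDilation T) {y : ℝ} (hy : 0 < y) (x : H) :
    ⟪x, resAt T y x⟫_ℂ = ∫ t : ℝ, ((t : ℂ) + y * Complex.I)⁻¹ ∂(D.E.measure (D.V x)) := by
  have h := D.resolvent_eq (-((y : ℂ) * Complex.I)) (by simpa using hy) x
  simp only [neg_smul, sub_neg_eq_add] at h
  exact h

/-- `iy (T + iy)⁻¹` tends to `P` as `y → 0`. -/
theorem measure_real_singleton_zero (D : SelfAdjointDilation T) (hT : IsDissipative T)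
    (hP : IsStarProjection P) (h1 : T * P = 0) (h2 : P * T = 0) {M : ℝ}
    (hM : ResolventBound (T + P) M) (x : H) :
    (((D.E.measure (D.V x)).real {0} : ℝ) : ℂ) = ⟪x, P x⟫_ℂ := by
  have := D.E.isFiniteMeasure (D.V x)
  refine tendsto_nhds_unique (tendsto_integral_mul_inv (D.E.measure (D.V x))) ?_
  have hlim : Tendsto (fun y : ℝ => ⟪x, (((y : ℂ) * Complex.I) • resAt (T + P) y
      + (1 - ((y : ℂ) * Complex.I) * (1 + (y : ℂ) * Complex.I)⁻¹) • P) x⟫_ℂ) (𝓝[>] 0)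
      (𝓝 ⟪x, (((0 : ℝ) * Complex.I) • resAt (T + P) 0
      + (1 - ((0 : ℝ) * Complex.I) * (1 + (0 : ℝ) * Complex.I)⁻¹) • P) x⟫_ℂ) := by
    have hr : Tendsto (resAt (T + P)) (𝓝[>] 0) (𝓝 (resAt (T + P) 0)) :=
      (hM.continuousOn 0 Set.self_mem_Ici).mono_left (nhdsWithin_mono _ Set.Ioi_subset_Ici_self)
    have hc : Tendsto (fun y : ℝ => (y : ℂ) * Complex.I) (𝓝[>] 0) (𝓝 (((0 : ℝ) : ℂ) * Complex.I)) :=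
      (Continuous.tendsto (by fun_prop) 0).mono_left nhdsWithin_le_nhds
    have hc' : Tendsto (fun y : ℝ => (1 + (y : ℂ) * Complex.I)⁻¹) (𝓝[>] 0)
        (𝓝 (1 + ((0 : ℝ) : ℂ) * Complex.I)⁻¹) := (hc.const_add 1).inv₀ (by simp)
    have h3 := (hc.smul hr).add (((tendsto_const_nhds (x := (1 : ℂ))).sub (hc.mul hc')).smul
      (tendsto_const_nhds (x := P)))
    exact tendsto_const_nhds.inner
      (((ContinuousLinearMap.apply ℂ H x).continuous.tendsto _).comp h3)
  have e0 : ⟪x, (((0 : ℝ) * Complex.I) • resAt (T + P) 0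
      + (1 - ((0 : ℝ) * Complex.I) * (1 + (0 : ℝ) * Complex.I)⁻¹) • P) x⟫_ℂ = ⟪x, P x⟫_ℂ := by
    simp
  rw [e0] at hlim
  refine hlim.congr' ?_
  filter_upwards [self_mem_nhdsWithin] with y hy
  have hy' : 0 < y := hy
  have hs0 : (y : ℂ) * Complex.I ≠ 0 := by simp [hy'.ne']
  rw [integral_const_mul, ← D.inner_resAt hy', ← inner_smul_right, ← _root_.smul_apply,
    resAt_eq_add_of_mul_eq_zero hT hP h1 h2 hM hy', smul_add, smul_smul, mul_sub,
    mul_inv_cancel₀ hs0]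

theorem inner_compression (D : SelfAdjointDilation T) (x : H) :
    ⟪x, D.compression x⟫_ℂ = ((D.E.measure (D.V x)).real (Set.Iio 0) : ℝ) := by
  have e1 : ⟪x, D.compression x⟫_ℂ = ⟪D.V x, D.E.proj (Set.Iio 0) (D.V x)⟫_ℂ := by
    change ⟪x, D.V.toContinuousLinearMap.adjoint (D.E.proj (Set.Iio 0) (D.V x))⟫_ℂ = _
    rw [ContinuousLinearMap.adjoint_inner_right]
    rfl
  have hs := (D.E.isStarProjection _ (measurableSet_Iio (a := (0 : ℝ)))).isSelfAdjoint
  have e2 : (D.E.measure (D.V x)).real (Set.Iio 0)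
      = (⟪D.V x, D.E.proj (Set.Iio 0) (D.V x)⟫_ℂ).re := by
    rw [Measure.real, D.E.measure_apply _ measurableSet_Iio, ENNReal.toReal_ofReal
      (D.E.inner_proj_nonneg measurableSet_Iio _)]
  rw [e1, e2]
  refine Complex.ext (by simp) ?_
  rw [inner_self_im hs, Complex.ofReal_im]

theorem re_inner_resAt (D : SelfAdjointDilation T) {y : ℝ} (hy : 0 < y) (x : H) :
    (⟪x, resAt T y x⟫_ℂ).re = ∫ t, t / (t ^ 2 + y ^ 2) ∂(D.E.measure (D.V x)) := by
  have hfin := D.E.isFiniteMeasure (D.V x)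
  have hint : Integrable (fun t : ℝ => ((t : ℂ) + y * Complex.I)⁻¹) (D.E.measure (D.V x)) := by
    refine Integrable.mono' (integrable_const y⁻¹)
      (Measurable.aestronglyMeasurable (by fun_prop)) (Eventually.of_forall fun t => ?_)
    rw [norm_inv]
    refine inv_anti₀ hy ?_
    have h1 := Complex.abs_im_le_norm ((t : ℂ) + y * Complex.I)
    exact (le_abs_self y).trans (by simpa using h1)
  rw [D.inner_resAt hy, ← Complex.reCLM_apply, ← Complex.reCLM.integral_comp_comm hint]
  refine integral_congr_ae (Eventually.of_forall fun t => ?_)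
  simp [Complex.inv_re, Complex.normSq_apply, sq]

/-- `½ - (2π)⁻¹ ∫₀^∞ 2t / (t² + y²) dy` is the indicator function of the negative half-line, up to
the value `½` at `t = 0`, which the projection `P` accounts for. -/
theorem compression_eq (D : SelfAdjointDilation T) (hT : IsDissipative T)
    (hP : IsStarProjection P) (h1 : T * P = 0) (h2 : P * T = 0) {M : ℝ}
    (hM : ResolventBound (T + P) M) : D.compression = negSpec (T + P) := by
  refine ContinuousLinearMap.coe_inj.1 ((ext_inner_map _ _).1 fun x => ?_)
  change ⟪D.compression x, x⟫_ℂ = ⟪negSpec (T + P) x, x⟫_ℂ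
  rw [← inner_conj_symm, ← inner_conj_symm (negSpec _ _)]
  congr 1
  have hfin := D.E.isFiniteMeasure (D.V x)
  set μ := D.E.measure (D.V x) with hμ
  have hPr : ∃ p : ℝ, ⟪x, P x⟫_ℂ = p := ⟨_, (D.measure_real_singleton_zero hT hP h1 h2 hM x).symm⟩
  have h0 := D.measure_real_singleton_zero hT hP h1 h2 hM x
  obtain ⟨p, hp⟩ := hPr
  rw [hp, ← hμ] at h0
  have h0' : μ.real {0} = p := by exact_mod_cast h0
  have hL : ⟪x, D.compression x⟫_ℂ = (μ.real (Set.Iio 0) : ℝ) := D.inner_compression x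
  have hre : ∀ y : ℝ, 0 < y → ⟪x, (resAt (T + P) y + star (resAt (T + P) y)) x⟫_ℂ
      = ((∫ t, 2 * t / (t ^ 2 + y ^ 2) ∂μ + 2 * p * (1 + y ^ 2)⁻¹ : ℝ) : ℂ) := by
    intro y hy
    have e1 : ⟪x, resAt (T + P) y x⟫_ℂ = ⟪x, resAt T y x⟫_ℂ
        - (((y : ℂ) * Complex.I)⁻¹ - (1 + (y : ℂ) * Complex.I)⁻¹) * p := by
      rw [resAt_eq_add_of_mul_eq_zero hT hP h1 h2 hM hy, _root_.add_apply, _root_.smul_apply,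
        inner_add_right, inner_smul_right, hp, add_sub_cancel_right]
    have e2 : ⟪x, star (resAt (T + P) y) x⟫_ℂ = (starRingEnd ℂ) ⟪x, resAt (T + P) y x⟫_ℂ := by
      rw [inner_conj_symm, ContinuousLinearMap.star_eq_adjoint,
        ContinuousLinearMap.adjoint_inner_right]
    have e3 := D.re_inner_resAt hy x
    rw [← hμ] at e3
    rw [_root_.add_apply, inner_add_right, e2, Complex.add_conj, e1]
    congr 1
    have e4 : ∫ t, 2 * t / (t ^ 2 + y ^ 2) ∂μ = 2 * ∫ t, t / (t ^ 2 + y ^ 2) ∂μ := by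
      rw [← integral_const_mul]
      refine integral_congr_ae (Eventually.of_forall fun t => ?_)
      simp only; ring
    rw [Complex.sub_re, e3, e4, Complex.re_mul_ofReal]
    simp [Complex.inv_re, Complex.normSq_apply, sq]
    ring
  have hI : ⟪x, (∫ y in Set.Ioi (0 : ℝ), (resAt (T + P) y + star (resAt (T + P) y))) x⟫_ℂ
      = ((Real.pi * (μ.real (Set.Ioi 0) - μ.real (Set.Iio 0)) + Real.pi * p : ℝ) : ℂ) := by
    rw [ContinuousLinearMap.integral_apply hM.integrableOn,
      ← integral_inner (hM.integrableOn.apply_continuousLinearMap x),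
      setIntegral_congr_fun measurableSet_Ioi fun y hy => hre y hy, integral_complex_ofReal]
    congr 1
    have hi1 : IntegrableOn (fun y : ℝ => 2 * p * (1 + y ^ 2)⁻¹) (Set.Ioi 0) :=
      integrable_inv_one_add_sq.integrableOn.const_mul _
    have hi2 : IntegrableOn (fun y : ℝ => ∫ t, 2 * t / (t ^ 2 + y ^ 2) ∂μ) (Set.Ioi 0) := by
      have h3 := ((hM.integrableOn.apply_continuousLinearMap x).const_inner (𝕜 := ℂ) x).re
      refine (h3.sub hi1).congr ?_
      refine ae_restrict_of_forall_mem measurableSet_Ioi fun y hy => ?_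
      simp only [Pi.sub_apply]
      rw [hre y hy, ← Complex.coe_algebraMap, RCLike.algebraMap_eq_ofReal, RCLike.ofReal_re,
        add_sub_cancel_right]
    rw [integral_add hi2 hi1, integral_integral_two_mul_div, integral_const_mul,
      integral_Ioi_inv_one_add_sq, Real.arctan_zero]
    ring
  have hx : μ.real Set.univ = ‖x‖ ^ 2 := by
    rw [Measure.real, D.E.measure_univ, ENNReal.toReal_ofReal (by positivity), D.V.norm_map]
  have hsplit : μ.real Set.univ = μ.real (Set.Iio 0) + μ.real {0} + μ.real (Set.Ioi 0) := by
    rw [← measureReal_union (by simp) (measurableSet_singleton _),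
      ← measureReal_union (by
        rw [Set.disjoint_left]
        rintro a (ha | ha) hb
        · exact lt_asymm (show a < 0 from ha) (show 0 < a from hb)
        · exact (ne_of_gt hb) ha) measurableSet_Ioi]
    congr 1
    ext a
    simp
  have hR : ⟪x, negSpec (T + P) x⟫_ℂ = (2⁻¹ * ‖x‖ ^ 2 - (2 * Real.pi)⁻¹ *
      (Real.pi * (μ.real (Set.Ioi 0) - μ.real (Set.Iio 0)) + Real.pi * p) : ℝ) := by
    rw [negSpec, _root_.sub_apply, _root_.smul_apply, _root_.smul_apply, inner_sub_right,
      inner_smul_right, inner_smul_right, hI, one_apply_eq_self, inner_self_eq_norm_sq_to_K]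
    push_cast
    rfl
  rw [hL, hR]
  congr 1
  rw [← hx, hsplit, h0']
  field_simp
  ring

end SelfAdjointDilation

end Compression

/-! ### The Poisson kernel of a contraction and its boundary measures -/

section Poisson

variable {H : Type u} [NormedAddCommGroup H] [InnerProductSpace ℂ H] [CompleteSpace H]

theorem integral_fourier (n : ℤ) :
    ∫ θ : UnitAddCircle, fourier n θ ∂AddCircle.haarAddCircle = if n = 0 then (1 : ℂ) else 0 := by
  split_ifs with h
  · subst h; simp
  · exact integral_eq_zero_of_add_right_eq_neg (μ := AddCircle.haarAddCircle)
      (fourier_add_half_inv_index h one_pos)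

theorem norm_fourier_apply (n : ℤ) (θ : UnitAddCircle) : ‖fourier n θ‖ = 1 := by
  rw [fourier_apply]; exact Circle.norm_coe _

theorem fourier_pow (n : ℕ) (m : ℤ) (θ : UnitAddCircle) :
    (fourier m θ) ^ n = fourier (n * m) θ := by
  induction n with
  | zero => simp
  | succ k ih => rw [pow_succ, ih, ← fourier_add]; push_cast; ring_nf

/-- The operator `r e^{-iθ} c`. -/
def rotated (c : H →L[ℂ] H) (r : ℝ) (θ : UnitAddCircle) : H →L[ℂ] H :=
  ((r : ℂ) * fourier (-1) θ) • c

theorem norm_rotated_lt {c : H →L[ℂ] H} (hc : ‖c‖ ≤ 1) {r : ℝ} (hr0 : 0 ≤ r) (hr : r < 1)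
    (θ : UnitAddCircle) : ‖rotated c r θ‖ < 1 := by
  rw [rotated, norm_smul, norm_mul, norm_fourier_apply, mul_one, Complex.norm_real,
    Real.norm_of_nonneg hr0]
  exact lt_of_le_of_lt (mul_le_of_le_one_right hr0 hc) hr

theorem continuous_rotated (c : H →L[ℂ] H) (r : ℝ) : Continuous (rotated c r) := by
  unfold rotated
  have := (fourier (T := 1) (-1)).continuous
  fun_prop

/-- The Poisson kernel `2 Re (1 - r e^{-iθ} c)⁻¹ - 1` of the contraction `c`. -/
def poissonOp (c : H →L[ℂ] H) (r : ℝ) (θ : UnitAddCircle) : H →L[ℂ] H :=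
  Ring.inverse (1 - rotated c r θ) + star (Ring.inverse (1 - rotated c r θ)) - 1

/-- The quadratic form of the Poisson kernel, see `poisson_eq_inner`. -/
def poisson (c : H →L[ℂ] H) (r : ℝ) (x : H) (θ : UnitAddCircle) : ℝ :=
  2 * (⟪x, Ring.inverse (1 - rotated c r θ) x⟫_ℂ).re - ‖x‖ ^ 2

theorem poisson_eq_inner (c : H →L[ℂ] H) (r : ℝ) (x : H) (θ : UnitAddCircle) :
    (poisson c r x θ : ℂ) = ⟪x, poissonOp c r θ x⟫_ℂ := by
  have e2 : ⟪x, star (Ring.inverse (1 - rotated c r θ)) x⟫_ℂ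
      = (starRingEnd ℂ) ⟪x, Ring.inverse (1 - rotated c r θ) x⟫_ℂ := by
    rw [inner_conj_symm, ContinuousLinearMap.star_eq_adjoint,
      ContinuousLinearMap.adjoint_inner_right]
  rw [poissonOp, _root_.sub_apply, _root_.add_apply, inner_sub_right, inner_add_right, e2,
    Complex.add_conj, one_apply_eq_self, inner_self_eq_norm_sq_to_K, poisson]
  push_cast
  rfl

variable {c : H →L[ℂ] H} {r : ℝ}

/-- With `y = (1 - a)⁻¹ x` this is `‖y‖² - ‖a y‖² ≥ 0`. -/
theorem poisson_nonneg (hc : ‖c‖ ≤ 1) (hr0 : 0 ≤ r) (hr : r < 1) (x : H) (θ : UnitAddCircle) :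
    0 ≤ poisson c r x θ := by
  have ha := norm_rotated_lt hc hr0 hr θ
  set a := rotated c r θ
  set y := Ring.inverse (1 - a) x with hy
  have h1 : y - a y = x :=
    congr($(Ring.mul_inverse_cancel _ (isUnit_one_sub_of_norm_lt_one ha)) x)
  have h2 : ‖a y‖ ≤ ‖y‖ :=
    (a.le_opNorm y).trans (mul_le_of_le_one_left (norm_nonneg _) ha.le)
  have h3 : a y = y - x := by rw [← h1]; abel
  have h4 := @norm_sub_sq ℂ _ _ _ _ x y
  rw [h3, norm_sub_rev] at h2
  have h5 : ‖x - y‖ ^ 2 ≤ ‖y‖ ^ 2 := pow_le_pow_left₀ (norm_nonneg _) h2 2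
  rw [h4] at h5
  change 0 ≤ 2 * (⟪x, y⟫_ℂ).re - ‖x‖ ^ 2
  change ‖x‖ ^ 2 - 2 * (⟪x, y⟫_ℂ).re + ‖y‖ ^ 2 ≤ ‖y‖ ^ 2 at h5
  linarith

theorem continuous_inverse_one_sub_rotated (hc : ‖c‖ ≤ 1) (hr0 : 0 ≤ r) (hr : r < 1) :
    Continuous fun θ => Ring.inverse (1 - rotated c r θ) := by
  refine continuous_iff_continuousAt.2 fun θ => ?_
  obtain ⟨w, hw⟩ := isUnit_one_sub_of_norm_lt_one (norm_rotated_lt hc hr0 hr θ)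
  have h1 := NormedRing.inverse_continuousAt w
  rw [hw] at h1
  exact h1.comp (f := fun θ => 1 - rotated c r θ)
    (continuous_const.sub (continuous_rotated c r)).continuousAt

theorem continuous_poisson (hc : ‖c‖ ≤ 1) (hr0 : 0 ≤ r) (hr : r < 1) (x : H) :
    Continuous (poisson c r x) := by
  have h1 := continuous_inverse_one_sub_rotated hc hr0 hr
  unfold poisson
  fun_prop

theorem norm_inner_pow_le (hc : ‖c‖ ≤ 1) (n : ℕ) (x : H) : ‖⟪x, (c ^ n) x⟫_ℂ‖ ≤ ‖x‖ ^ 2 := by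
  have h : ‖(c ^ n) x‖ ≤ ‖x‖ := by
    induction n with
    | zero => simp
    | succ k ih =>
      rw [pow_succ', mul_apply_eq_comp]
      exact ((c.le_opNorm _).trans (mul_le_of_le_one_left (norm_nonneg _) hc)).trans ih
  refine (norm_inner_le_norm _ _).trans ?_
  rw [sq]
  exact mul_le_mul_of_nonneg_left h (norm_nonneg _)

/-- The Fourier coefficients of the geometric series `∑ rⁿ e^{-inθ} ⟨x, cⁿ x⟩`. -/
theorem integral_fourier_mul_inner (hc : ‖c‖ ≤ 1) (hr0 : 0 ≤ r) (hr : r < 1) (x : H) (k : ℤ) :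
    ∫ θ : UnitAddCircle, fourier k θ * ⟪x, Ring.inverse (1 - rotated c r θ) x⟫_ℂ
        ∂AddCircle.haarAddCircle
      = if 0 ≤ k then (r : ℂ) ^ k.toNat * ⟪x, (c ^ k.toNat) x⟫_ℂ else 0 := by
  set F : ℕ → UnitAddCircle → ℂ := fun n θ =>
    ((r : ℂ) ^ n * ⟪x, (c ^ n) x⟫_ℂ) * fourier (k - n) θ with hF
  have hsum : ∀ θ, HasSum (fun n => F n θ)
      (fourier k θ * ⟪x, Ring.inverse (1 - rotated c r θ) x⟫_ℂ) := by
    intro θ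
    have h1 := hasSum_geom_series_inverse _ (norm_rotated_lt hc hr0 hr θ)
    have h2 := ((h1.mapL (ContinuousLinearMap.apply ℂ H x)).mapL (innerSL ℂ x)).mul_left
      (fourier k θ)
    refine h2.congr_fun fun n => ?_
    change F n θ = fourier k θ * ⟪x, (rotated c r θ ^ n) x⟫_ℂ
    rw [rotated, smul_pow, _root_.smul_apply, inner_smul_right, mul_pow, fourier_pow, hF]
    have : fourier (k - n) θ = fourier k θ * fourier (n * -1) θ := by
      rw [← fourier_add]; ring_nf
    simp only
    rw [this]
    ring
  have hn : ∀ n θ, ‖F n θ‖ ≤ r ^ n * ‖x‖ ^ 2 := by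
    intro n θ
    rw [hF]
    simp only [norm_mul, norm_fourier_apply, mul_one, norm_pow, Complex.norm_real,
      Real.norm_of_nonneg hr0]
    refine mul_le_mul_of_nonneg_left ?_ (by positivity)
    exact norm_inner_pow_le hc n x
  have h3 := hasSum_integral_of_dominated_convergence (μ := AddCircle.haarAddCircle (T := 1))
    (fun n (_ : UnitAddCircle) => r ^ n * ‖x‖ ^ 2)
    (F := F) (fun n => (continuous_const.mul (fourier (k - n)).continuous).aestronglyMeasurable)
    (fun n => Eventually.of_forall (hn n))
    (Eventually.of_forall fun _ => (summable_geometric_of_lt_one hr0 hr).mul_right _)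
    (integrable_const _) (Eventually.of_forall hsum)
  refine h3.unique ?_
  have h4 : ∀ n : ℕ, ∫ θ : UnitAddCircle, F n θ ∂AddCircle.haarAddCircle
      = if (n : ℤ) = k then (r : ℂ) ^ n * ⟪x, (c ^ n) x⟫_ℂ else 0 := by
    intro n
    rw [hF]
    simp only
    rw [integral_const_mul, integral_fourier]
    by_cases h : (n : ℤ) = k
    · rw [if_pos h, if_pos (by omega), mul_one]
    · rw [if_neg h, if_neg (by omega), mul_zero]
  simp_rw [h4]
  split_ifs with hk
  · have h5 := hasSum_ite_eq k.toNat ((r : ℂ) ^ k.toNat * ⟪x, (c ^ k.toNat) x⟫_ℂ)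
    refine h5.congr_fun fun n => ?_
    by_cases h : n = k.toNat
    · rw [if_pos h, if_pos (by omega), h]
    · rw [if_neg h, if_neg (by omega)]
  · refine hasSum_zero.congr_fun fun n => ?_
    rw [if_neg (by omega)]

theorem integral_fourier_mul_poisson (hc : ‖c‖ ≤ 1) (hr0 : 0 ≤ r) (hr : r < 1) (x : H) (k : ℕ) :
    ∫ θ : UnitAddCircle, fourier k θ * (poisson c r x θ : ℂ) ∂AddCircle.haarAddCircle
      = (r : ℂ) ^ k * ⟪x, (c ^ k) x⟫_ℂ := by
  have hcont := continuous_inverse_one_sub_rotated hc hr0 hr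
  set g : UnitAddCircle → ℂ := fun θ => ⟪x, Ring.inverse (1 - rotated c r θ) x⟫_ℂ with hg
  have hgc : Continuous g := by rw [hg]; fun_prop
  have hfc := (fourier (T := 1) k).continuous
  have hint : ∀ {f : UnitAddCircle → ℂ}, Continuous f → Integrable f AddCircle.haarAddCircle :=
    fun h => h.integrable_of_hasCompactSupport (HasCompactSupport.of_compactSpace _)
  have e : ∀ θ, fourier k θ * (poisson c r x θ : ℂ) = fourier k θ * g θ
      + (starRingEnd ℂ) (fourier (-k : ℤ) θ * g θ) - (‖x‖ : ℂ) ^ 2 * fourier k θ := by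
    intro θ
    rw [map_mul, fourier_neg, Complex.conj_conj, poisson, Complex.ofReal_sub, Complex.ofReal_mul,
      ← Complex.ofReal_mul, ← Complex.add_conj]
    push_cast
    ring
  have hfc' := (fourier (T := 1) (-k : ℤ)).continuous
  simp_rw [e]
  rw [integral_sub (hint (by fun_prop)) (hint (by fun_prop)),
    integral_add (hint (by fun_prop)) (hint (by fun_prop)),
    integral_const_mul, integral_conj, integral_fourier, hg,
    integral_fourier_mul_inner hc hr0 hr, integral_fourier_mul_inner hc hr0 hr]
  rcases Nat.eq_zero_or_pos k with rfl | hk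
  · simp [inner_self_eq_norm_sq_to_K]
  · rw [if_pos (by omega), if_neg (by omega), if_neg (by omega)]
    simp

/-- The measure with density the Poisson kernel at radius `r`. -/
def poissonMeasure (c : H →L[ℂ] H) (r : ℝ) (x : H) : Measure UnitAddCircle :=
  AddCircle.haarAddCircle.withDensity fun θ => ENNReal.ofReal (poisson c r x θ)

theorem integral_poissonMeasure (hc : ‖c‖ ≤ 1) (hr0 : 0 ≤ r) (hr : r < 1) (x : H)
    {E : Type*} [NormedAddCommGroup E] [NormedSpace ℝ E] (f : UnitAddCircle → E) :
    ∫ θ, f θ ∂poissonMeasure c r x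
      = ∫ θ, poisson c r x θ • f θ ∂AddCircle.haarAddCircle := by
  rw [poissonMeasure, integral_withDensity_eq_integral_toReal_smul
    (continuous_poisson hc hr0 hr x).measurable.ennreal_ofReal
    (Eventually.of_forall fun _ => ENNReal.ofReal_lt_top)]
  simp_rw [ENNReal.toReal_ofReal (poisson_nonneg hc hr0 hr x _)]

theorem poissonMeasure_univ (hc : ‖c‖ ≤ 1) (hr0 : 0 ≤ r) (hr : r < 1) (x : H) :
    poissonMeasure c r x Set.univ = ENNReal.ofReal (‖x‖ ^ 2) := by
  have hp := continuous_poisson hc hr0 hr x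
  rw [poissonMeasure, withDensity_apply _ MeasurableSet.univ, Measure.restrict_univ,
    ← ofReal_integral_eq_lintegral_ofReal
      (hp.integrable_of_hasCompactSupport (HasCompactSupport.of_compactSpace _))
      (Eventually.of_forall fun θ => poisson_nonneg hc hr0 hr x θ)]
  congr 1
  have h := integral_fourier_mul_poisson hc hr0 hr x 0
  simp only [Nat.cast_zero, fourier_zero, one_mul, pow_zero, one_apply_eq_self,
    inner_self_eq_norm_sq_to_K] at h
  rw [integral_complex_ofReal] at h
  exact Complex.ofReal_injective (h.trans (by push_cast; rfl))

end Poisson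

section Boundary

/-- A finite family of finite measures whose real linear combination annihilates all continuous
functions also annihilates all Borel sets. -/
theorem sum_mul_real_eq_zero {X ι : Type*} [TopologicalSpace X] [MeasurableSpace X] [BorelSpace X]
    [HasOuterApproxClosed X] (t : Finset ι) (b : ι → ℝ) (μ : ι → Measure X)
    [∀ i, IsFiniteMeasure (μ i)]
    (h : ∀ f : BoundedContinuousFunction X ℝ, ∑ i ∈ t, b i * ∫ x, f x ∂μ i = 0) (s : Set X) :
    ∑ i ∈ t, b i * (μ i).real s = 0 := by
  set P : Measure X := ∑ i ∈ t, (b i).toNNReal • μ i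
  set N : Measure X := ∑ i ∈ t, (-b i).toNNReal • μ i
  have hb : ∀ i, ((b i).toNNReal : ℝ) - ((-b i).toNNReal : ℝ) = b i := fun i => by
    rw [Real.coe_toNNReal', Real.coe_toNNReal']
    rcases le_total 0 (b i) with h | h
    · rw [max_eq_left h, max_eq_right (by linarith)]; ring
    · rw [max_eq_right h, max_eq_left (by linarith)]; ring
  have hPN : P = N := by
    refine ext_of_forall_integral_eq_of_IsFiniteMeasure fun f => ?_
    rw [integral_finsetSum_measure fun i _ => (f.integrable _),
      integral_finsetSum_measure fun i _ => (f.integrable _), ← sub_eq_zero,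
      ← Finset.sum_sub_distrib, ← h f]
    refine Finset.sum_congr rfl fun i _ => ?_
    rw [integral_smul_nnreal_measure, integral_smul_nnreal_measure, NNReal.smul_def,
      NNReal.smul_def, smul_eq_mul, smul_eq_mul, ← sub_mul, hb]
  have h1 : P.real s = N.real s := by rw [hPN]
  have h2 : ∀ d : ι → NNReal, (∑ i ∈ t, d i • μ i : Measure X).real s
      = ∑ i ∈ t, (d i : ℝ) * (μ i).real s := by
    intro d
    rw [Measure.real, Measure.finsetSum_apply, ENNReal.toReal_sum (fun i _ => measure_ne_top _ _)]
    refine Finset.sum_congr rfl fun i _ => ?_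
    rw [Measure.smul_apply, ENNReal.smul_def, smul_eq_mul, ENNReal.toReal_mul]
    rfl
  rw [h2, h2, ← sub_eq_zero, ← Finset.sum_sub_distrib] at h1
  rw [← h1]
  exact Finset.sum_congr rfl fun i _ => by rw [← sub_mul, hb]

end Boundary

section BoundaryMeasure

variable {H : Type u} [NormedAddCommGroup H] [InnerProductSpace ℂ H] [CompleteSpace H]

/-- The value at the operator `M` of the functional `∑ a_x ⟨x, · x⟩`. -/
def quadComb (M : H →L[ℂ] H) : (H →₀ ℂ) →ₗ[ℂ] ℂ := Finsupp.linearCombination ℂ fun x => ⟪x, M x⟫_ℂ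

/-- A combination of quadratic forms that vanishes on all operators still does so after the
coefficients are replaced by their real or imaginary parts. -/
theorem quadComb_re_im {a : H →₀ ℂ} (ha : ∀ M : H →L[ℂ] H, quadComb M a = 0) {M : H →L[ℂ] H}
    {p : H → ℝ} (hp : ∀ x, (p x : ℂ) = ⟪x, M x⟫_ℂ) :
    ∑ x ∈ a.support, (a x).re * p x = 0 ∧ ∑ x ∈ a.support, (a x).im * p x = 0 := by
  have h := ha M
  rw [quadComb, Finsupp.linearCombination_apply, Finsupp.sum] at h
  simp_rw [← hp, smul_eq_mul] at h
  have h1 := congr_arg Complex.re h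
  have h2 := congr_arg Complex.im h
  simp only [Complex.re_sum, Complex.im_sum, Complex.re_mul_ofReal, Complex.im_mul_ofReal,
    Complex.zero_re, Complex.zero_im] at h1 h2
  exact ⟨h1, h2⟩

/-- The weak limits as `r → 1` of the Poisson measures of a contraction `c` represent its moments. The
last clause says that `x ↦ μ_x(s)` satisfies every linear relation that the quadratic forms of all
operators satisfy; it is what makes `x ↦ μ_x(s)` itself the quadratic form of an operator. -/
theorem exists_boundary_measure {c : H →L[ℂ] H} (hc : ‖c‖ ≤ 1) :
    ∃ μ : H → Measure UnitAddCircle, (∀ x, IsFiniteMeasure (μ x)) ∧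
      (∀ x (k : ℕ), ∫ θ, fourier k θ ∂μ x = ⟪x, (c ^ k) x⟫_ℂ) ∧
      ∀ a : H →₀ ℂ, (∀ M : H →L[ℂ] H, quadComb M a = 0) → ∀ s : Set UnitAddCircle,
        Finsupp.linearCombination ℂ (fun x => (((μ x).real s : ℝ) : ℂ)) a = 0 := by
  set r : ℕ → ℝ := fun n => 1 - 1 / ((n : ℝ) + 1) with hr
  have hr0 : ∀ n, 0 ≤ r n := fun n => by
    rw [hr]
    have : 1 / ((n : ℝ) + 1) ≤ 1 := by
      rw [div_le_one (by positivity)]; linarith [(Nat.cast_nonneg n : (0 : ℝ) ≤ n)]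
    simp only; linarith
  have hr1 : ∀ n, r n < 1 := fun n => by
    rw [hr]
    have : 0 < 1 / ((n : ℝ) + 1) := by positivity
    simp only; linarith
  have hrlim : Tendsto r atTop (𝓝 1) := by
    have := (tendsto_one_div_add_atTop_nhds_zero_nat (𝕜 := ℝ)).const_sub 1
    rwa [sub_zero] at this
  have hfin : ∀ n x, IsFiniteMeasure (poissonMeasure c (r n) x) := fun n x =>
    ⟨by rw [poissonMeasure_univ hc (hr0 n) (hr1 n)]; exact ENNReal.ofReal_lt_top⟩
  set ν : H → ℕ → FiniteMeasure UnitAddCircle := fun x n => ⟨poissonMeasure c (r n) x, hfin n x⟩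
  -- one ultrafilter for all `x`, so that linear relations between the densities pass to the limit
  set U : Ultrafilter ℕ := hyperfilter ℕ
  have hU : (U : Filter ℕ) ≤ atTop := by
    rw [← Nat.cofinite_eq_atTop]; exact hyperfilter_le_cofinite
  have hlim : ∀ x, ∃ μ : FiniteMeasure UnitAddCircle, Tendsto (ν x) U (𝓝 μ) := by
    intro x
    obtain ⟨μ, -, hμ⟩ := (isCompact_setOfPred_finiteMeasure_le_of_compactSpace UnitAddCircle
      (‖x‖₊ ^ 2)).ultrafilter_le_nhds (U.map (ν x)) (by
        rw [le_principal_iff]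
        refine Filter.mem_map.2 (Eventually.of_forall fun n => ?_)
        change (ν x n).mass ≤ ‖x‖₊ ^ 2
        rw [← ENNReal.coe_le_coe, FiniteMeasure.ennreal_mass]
        change poissonMeasure c (r n) x Set.univ ≤ _
        rw [poissonMeasure_univ hc (hr0 n) (hr1 n), ENNReal.ofReal_pow (norm_nonneg _)]
        simp [enorm])
    exact ⟨μ, hμ⟩
  choose μ hμ using hlim
  have hint := fun x => FiniteMeasure.tendsto_iff_forall_integral_tendsto.1 (hμ x)
  refine ⟨fun x => (μ x : Measure UnitAddCircle), fun x => inferInstance, fun x k => ?_, ?_⟩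
  · have hcl : Tendsto (fun n => ∫ θ, fourier k θ ∂(ν x n : Measure UnitAddCircle)) U
        (𝓝 (∫ θ, fourier k θ ∂(μ x : Measure UnitAddCircle))) := by
      have hcont := (fourier (T := 1) k).continuous
      let fr : BoundedContinuousFunction UnitAddCircle ℝ :=
        BoundedContinuousFunction.mkOfCompact ⟨fun θ => (fourier k θ).re, by fun_prop⟩
      let fi : BoundedContinuousFunction UnitAddCircle ℝ :=
        BoundedContinuousFunction.mkOfCompact ⟨fun θ => (fourier k θ).im, by fun_prop⟩
      have e : ∀ ρ : FiniteMeasure UnitAddCircle, ∫ θ, fourier k θ ∂(ρ : Measure UnitAddCircle)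
          = ((∫ θ, fr θ ∂(ρ : Measure UnitAddCircle) : ℝ) : ℂ)
            + ((∫ θ, fi θ ∂(ρ : Measure UnitAddCircle) : ℝ) : ℂ) * Complex.I := fun ρ =>
        (integral_re_add_im (𝕜 := ℂ)
          (hcont.integrable_of_hasCompactSupport (HasCompactSupport.of_compactSpace _))).symm
      simp_rw [e]
      exact ((Complex.continuous_ofReal.tendsto _).comp (hint x fr)).add
        (((Complex.continuous_ofReal.tendsto _).comp (hint x fi)).mul_const _)
    refine tendsto_nhds_unique hcl ?_
    have h1 : Tendsto (fun n => (r n : ℂ) ^ k * ⟪x, (c ^ k) x⟫_ℂ) U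
        (𝓝 (((1 : ℝ) : ℂ) ^ k * ⟪x, (c ^ k) x⟫_ℂ)) :=
      (((Complex.continuous_ofReal.tendsto 1).comp (hrlim.mono_left hU)).pow k).mul_const _
    rw [Complex.ofReal_one, one_pow, one_mul] at h1
    refine h1.congr fun n => ?_
    rw [← integral_fourier_mul_poisson hc (hr0 n) (hr1 n)]
    change _ = ∫ θ, fourier k θ ∂poissonMeasure c (r n) x
    rw [integral_poissonMeasure hc (hr0 n) (hr1 n)]
    refine integral_congr_ae (Eventually.of_forall fun θ => ?_)
    simp only
    rw [Complex.real_smul, mul_comm]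
  · intro a ha s
    have key : ∀ b : H → ℝ, (∀ (M : H →L[ℂ] H) (p : H → ℝ), (∀ x, (p x : ℂ) = ⟪x, M x⟫_ℂ) →
        ∑ x ∈ a.support, b x * p x = 0) →
        ∑ x ∈ a.support, b x * (μ x : Measure UnitAddCircle).real s = 0 := by
      intro b hb
      refine sum_mul_real_eq_zero _ _ _ (fun f => ?_) s
      have h1 : Tendsto (fun n => ∑ x ∈ a.support, b x * ∫ θ, f θ ∂(ν x n : Measure UnitAddCircle))
          U (𝓝 (∑ x ∈ a.support, b x * ∫ θ, f θ ∂(μ x : Measure UnitAddCircle))) :=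
        tendsto_finsetSum _ fun x _ => (hint x f).const_mul _
      refine tendsto_nhds_unique h1 (tendsto_const_nhds.congr fun n => ?_)
      change 0 = ∑ x ∈ a.support, b x * ∫ θ, f θ ∂poissonMeasure c (r n) x
      simp_rw [integral_poissonMeasure hc (hr0 n) (hr1 n), ← integral_const_mul]
      rw [← integral_finsetSum]
      · symm
        refine integral_eq_zero_of_ae (Eventually.of_forall fun θ => ?_)
        have h2 := hb (poissonOp c (r n) θ) (fun x => poisson c (r n) x θ)
          (fun x => poisson_eq_inner c (r n) x θ)
        simp only [smul_eq_mul, ← mul_assoc]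
        rw [← Finset.sum_mul, h2, zero_mul]
        rfl
      · intro x _
        refine Continuous.integrable_of_hasCompactSupport ?_ (HasCompactSupport.of_compactSpace _)
        exact continuous_const.mul ((continuous_poisson hc (hr0 n) (hr1 n) x).smul f.continuous)
    have h1 := key (fun x => (a x).re) fun M p hp => (quadComb_re_im ha hp).1
    have h2 := key (fun x => (a x).im) fun M p hp => (quadComb_re_im ha hp).2
    rw [Finsupp.linearCombination_apply, Finsupp.sum]
    refine Complex.ext ?_ ?_
    · simpa [Complex.re_sum] using h1
    · simpa [Complex.im_sum] using h2

end BoundaryMeasure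

/-! ### The scalar spectral measures of a dissipative operator -/

section Cayley

variable {H : Type u} [NormedAddCommGroup H] [InnerProductSpace ℂ H] [CompleteSpace H]

/-- The Cayley transform `(T - i)(T + i)⁻¹ = 1 - 2i (T + i)⁻¹`. -/
def cayley (T : H →L[ℂ] H) : H →L[ℂ] H := 1 - (2 * Complex.I) • resAt T 1

variable {T : H →L[ℂ] H}

theorem isUnit_smul_of_ne_zero {a : ℂ} (ha : a ≠ 0) {X : H →L[ℂ] H} (hX : IsUnit X) :
    IsUnit (a • X) := by
  obtain ⟨w, rfl⟩ := hX
  exact (Units.mk0 a ha • w).isUnit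

theorem isUnit_add_I (hT : IsDissipative T) : IsUnit (T + Complex.I • (1 : H →L[ℂ] H)) := by
  simpa using hT.isUnit_add one_pos

theorem resAt_one (T : H →L[ℂ] H) : resAt T 1 = Ring.inverse (T + Complex.I • (1 : H →L[ℂ] H)) := by
  simp [resAt]

theorem norm_cayley_le (hT : IsDissipative T) : ‖cayley T‖ ≤ 1 := by
  refine ContinuousLinearMap.opNorm_le_bound _ zero_le_one fun u => ?_
  set x := resAt T 1 u with hx
  have hxu : T x + Complex.I • x = u := by
    have := congr($(Ring.mul_inverse_cancel _ (isUnit_add_I hT)) u)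
    rw [← resAt_one] at this
    exact this
  have hcu : cayley T u = T x - Complex.I • x := by
    rw [cayley, _root_.sub_apply, one_apply_eq_self, _root_.smul_apply, ← hx, ← hxu, mul_smul,
      two_smul]
    abel
  rw [hcu, one_mul, ← hxu]
  refine le_of_sq_le_sq ?_ (norm_nonneg _)
  rw [@norm_sub_sq ℂ, @norm_add_sq ℂ]
  have h1 : RCLike.re ⟪T x, Complex.I • x⟫_ℂ = (⟪x, T x⟫_ℂ).im := by
    rw [inner_smul_right, ← inner_conj_symm]
    change (Complex.I * _).re = _
    rw [Complex.I_mul_re, Complex.conj_im, neg_neg]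
  rw [h1]
  linarith [hT x]

theorem isUnit_one_sub_cayley (hT : IsDissipative T) : IsUnit (1 - cayley T) := by
  have e : 1 - cayley T = (2 * Complex.I) • resAt T 1 := by rw [cayley]; abel
  have h1 : IsUnit (resAt T 1) := by
    rw [resAt_one]; exact (isUnit_add_I hT).ringInverse
  rw [e]
  exact isUnit_smul_of_ne_zero (by simp) h1

/-- The resolvent of `T` at `z` in terms of that of its Cayley transform at `-ζ⁻¹`, where
`ζ = (i + z) / (i - z)`. -/
theorem sub_smul_mul_one_sub_cayley (hT : IsDissipative T) {z ζ : ℂ}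
    (hζ : (Complex.I - z) * ζ = Complex.I + z) :
    (T - z • (1 : H →L[ℂ] H)) * (1 - cayley T) = (Complex.I - z) • (1 + ζ • cayley T) := by
  have h1 : (T + Complex.I • (1 : H →L[ℂ] H)) * resAt T 1 = 1 := by
    rw [resAt_one]; exact Ring.mul_inverse_cancel _ (isUnit_add_I hT)
  have h2 : T * resAt T 1 = 1 - Complex.I • resAt T 1 := by
    rw [add_mul, smul_mul_assoc, one_mul] at h1
    exact eq_sub_of_add_eq h1
  have e : 1 - cayley T = (2 * Complex.I) • resAt T 1 := by rw [cayley]; abel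
  rw [e, sub_mul, mul_smul_comm, h2, smul_mul_assoc, one_mul, smul_add, smul_smul (Complex.I - z) ζ, hζ, cayley]
  simp only [smul_sub, smul_smul]
  have e1 : 2 * Complex.I * Complex.I = -2 := by linear_combination 2 * Complex.I_sq
  have e2 : (Complex.I + z) * (2 * Complex.I) = -2 + z * (2 * Complex.I) := by
    linear_combination 2 * Complex.I_sq
  rw [e1, e2]
  module

theorem norm_lt_one_of_im_neg {z ζ : ℂ} (hz : z.im < 0)
    (hζ : (Complex.I - z) * ζ = Complex.I + z) : ‖ζ‖ < 1 := by
  have h1 : ‖Complex.I + z‖ ^ 2 < ‖Complex.I - z‖ ^ 2 := by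
    rw [← Complex.normSq_eq_norm_sq, ← Complex.normSq_eq_norm_sq, Complex.normSq_apply,
      Complex.normSq_apply]
    simp
    nlinarith
  have h2 : ‖Complex.I + z‖ < ‖Complex.I - z‖ := lt_of_pow_lt_pow_left₀ 2 (norm_nonneg _) h1
  rw [← hζ, norm_mul] at h2
  by_contra h
  have := mul_le_mul_of_nonneg_left (not_lt.1 h) (norm_nonneg (Complex.I - z))
  linarith

end Cayley

section Moments

variable {H : Type u} [NormedAddCommGroup H] [InnerProductSpace ℂ H] [CompleteSpace H]
  {c : H →L[ℂ] H} {μ : Measure UnitAddCircle} [IsFiniteMeasure μ] {x : H}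

theorem norm_smul_lt_one (hc : ‖c‖ ≤ 1) {ζ : ℂ} (hζ : ‖ζ‖ < 1) : ‖ζ • c‖ < 1 := by
  rw [norm_smul]
  exact lt_of_le_of_lt (mul_le_of_le_one_right (norm_nonneg _) hc) hζ

/-- The geometric series turns the moments `∫ wᵏ dμ = ⟨x, cᵏ x⟩` into resolvents. -/
theorem integral_fourier_mul_inv (hc : ‖c‖ ≤ 1)
    (hμ : ∀ k : ℕ, ∫ θ, fourier k θ ∂μ = ⟪x, (c ^ k) x⟫_ℂ) (k : ℕ) {ζ : ℂ} (hζ : ‖ζ‖ < 1) :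
    ∫ θ, fourier k θ * (1 - ζ * fourier 1 θ)⁻¹ ∂μ
      = ⟪x, (c ^ k * Ring.inverse (1 - ζ • c)) x⟫_ℂ := by
  have hn : ∀ θ : UnitAddCircle, ‖ζ * fourier 1 θ‖ < 1 := fun θ => by
    rwa [norm_mul, norm_fourier_apply, mul_one]
  have h1 : HasSum (fun n : ℕ => ∫ θ, ζ ^ n * fourier (k + n : ℕ) θ ∂μ)
      (∫ θ, fourier k θ * (1 - ζ * fourier 1 θ)⁻¹ ∂μ) := by
    refine hasSum_integral_of_dominated_convergence (fun n _ => ‖ζ‖ ^ n)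
      (fun n => (continuous_const.mul (fourier _).continuous).aestronglyMeasurable)
      (fun n => Eventually.of_forall fun θ => ?_)
      (Eventually.of_forall fun _ => summable_geometric_of_lt_one (norm_nonneg _) hζ)
      (integrable_const _) (Eventually.of_forall fun θ => ?_)
    · rw [norm_mul, norm_fourier_apply, mul_one, norm_pow]
    · refine ((hasSum_geometric_of_norm_lt_one (hn θ)).mul_left (fourier k θ)).congr_fun
        fun n => ?_
      rw [mul_pow, fourier_pow, Nat.cast_add, fourier_add, mul_one]
      ring
  have h2 : HasSum (fun n : ℕ => ζ ^ n * ⟪x, (c ^ (k + n)) x⟫_ℂ)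
      ⟪x, (c ^ k * Ring.inverse (1 - ζ • c)) x⟫_ℂ := by
    have h3 := (hasSum_geom_series_inverse _ (norm_smul_lt_one hc hζ)).mul_left (c ^ k)
    refine ((h3.mapL (ContinuousLinearMap.apply ℂ H x)).mapL (innerSL ℂ x)).congr_fun fun n => ?_
    change _ = ⟪x, (c ^ k * (ζ • c) ^ n) x⟫_ℂ
    rw [smul_pow, mul_smul_comm, ← pow_add, _root_.smul_apply, inner_smul_right]
  refine h1.unique (h2.congr_fun fun n => ?_)
  rw [integral_const_mul, hμ]

theorem measurableSet_fourier_eq_one : MeasurableSet {θ : UnitAddCircle | fourier 1 θ = 1} :=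
  (isClosed_eq (fourier 1).continuous continuous_const).measurableSet

/-- The representing measure has no atom at `w = 1` if `1 - c` is invertible, because
`μ {1} = lim (1 - ρ) ⟨x, (1 - ρ c)⁻¹ x⟩` as `ρ → 1`. -/
theorem measure_fourier_eq_one (hc : ‖c‖ ≤ 1) (hu : IsUnit (1 - c))
    (hμ : ∀ k : ℕ, ∫ θ, fourier k θ ∂μ = ⟪x, (c ^ k) x⟫_ℂ) :
    μ {θ | fourier 1 θ = 1} = 0 := by
  have e : ((μ.real {θ | fourier 1 θ = 1} : ℝ) : ℂ)
      = ∫ θ, {θ : UnitAddCircle | fourier 1 θ = 1}.indicator (fun _ => (1 : ℂ)) θ ∂μ := by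
    rw [integral_indicator_const _ measurableSet_fourier_eq_one]
    simp
  have h1 : Tendsto (fun ρ : ℝ => ∫ θ, (1 - ρ : ℂ) * (1 - ρ * fourier 1 θ)⁻¹ ∂μ) (𝓝[<] 1)
      (𝓝 ((μ.real {θ | fourier 1 θ = 1} : ℝ) : ℂ)) := by
    rw [e]
    have hev0 : ∀ᶠ ρ : ℝ in 𝓝[<] 1, 0 < ρ := nhdsWithin_le_nhds (lt_mem_nhds one_pos)
    have hev : ∀ᶠ ρ : ℝ in 𝓝[<] 1, 0 < ρ ∧ ρ < 1 := hev0.and self_mem_nhdsWithin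
    refine tendsto_integral_filter_of_dominated_convergence (fun _ => (1 : ℝ))
      (Eventually.of_forall fun ρ => ?_) ?_ (integrable_const 1) (Eventually.of_forall fun θ => ?_)
    · have := (fourier (T := 1) 1).continuous.measurable
      exact Measurable.aestronglyMeasurable (by fun_prop)
    · filter_upwards [hev] with ρ hρ
      refine Eventually.of_forall fun θ => ?_
      rw [norm_mul, norm_inv, ← div_eq_mul_inv]
      refine div_le_one_of_le₀ ?_ (norm_nonneg _)
      have h2 := norm_sub_norm_le (1 : ℂ) (ρ * fourier 1 θ)
      rw [norm_mul, norm_fourier_apply, norm_one, mul_one, Complex.norm_real,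
        Real.norm_of_nonneg hρ.1.le] at h2
      refine le_trans (le_of_eq ?_) h2
      rw [← Complex.ofReal_one, ← Complex.ofReal_sub, Complex.norm_real, Real.norm_of_nonneg]
      linarith [hρ.2]
    · by_cases hθ : fourier 1 θ = 1
      · refine tendsto_const_nhds.congr' ?_
        filter_upwards [hev] with ρ hρ
        have h3 : (1 - ρ : ℂ) ≠ 0 := sub_ne_zero.2 (by exact_mod_cast hρ.2.ne')
        rw [Set.indicator_of_mem (by exact hθ), hθ, mul_one, mul_inv_cancel₀ h3]
      · rw [Set.indicator_of_notMem (by exact hθ)]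
        have h3 : 1 - ((1 : ℝ) : ℂ) * fourier 1 θ ≠ 0 := by
          rw [Complex.ofReal_one, one_mul]; exact sub_ne_zero.2 (Ne.symm hθ)
        have hcont : ContinuousAt (fun ρ : ℝ => (1 - ρ : ℂ) * (1 - ρ * fourier 1 θ)⁻¹) 1 :=
          ContinuousAt.mul (by fun_prop) (ContinuousAt.inv₀ (by fun_prop) h3)
        have := hcont.tendsto.mono_left (nhdsWithin_le_nhds (s := Set.Iio 1))
        simpa using this
  have h2 : Tendsto (fun ρ : ℝ => (1 - ρ : ℂ) * ⟪x, Ring.inverse (1 - (ρ : ℂ) • c) x⟫_ℂ) (𝓝[<] 1)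
      (𝓝 ((1 - ((1 : ℝ) : ℂ)) * ⟪x, Ring.inverse (1 - ((1 : ℝ) : ℂ) • c) x⟫_ℂ)) := by
    refine Tendsto.mono_left ?_ (nhdsWithin_le_nhds (s := Set.Iio 1))
    have hci : ContinuousAt (fun ρ : ℝ => Ring.inverse (1 - (ρ : ℂ) • c)) 1 := by
      obtain ⟨w, hw⟩ := hu
      have h1 := NormedRing.inverse_continuousAt w
      rw [hw] at h1
      have e1 : (1 : H →L[ℂ] H) - c = 1 - ((1 : ℝ) : ℂ) • c := by simp
      rw [e1] at h1
      exact h1.comp (f := fun ρ : ℝ => (1 : H →L[ℂ] H) - (ρ : ℂ) • c) (by fun_prop)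
    have hci' : ContinuousAt (fun ρ : ℝ => Ring.inverse (1 - (ρ : ℂ) • c) x) 1 :=
      (ContinuousLinearMap.apply ℂ H x).continuous.continuousAt.comp hci
    exact ContinuousAt.mul (by fun_prop) (continuousAt_const.inner hci')
  have h3 := tendsto_nhds_unique h1 (h2.congr' ?_)
  · rw [Complex.ofReal_one, sub_self, zero_mul] at h3
    exact (measureReal_eq_zero_iff).1 (by exact_mod_cast h3)
  · filter_upwards [nhdsWithin_le_nhds (lt_mem_nhds one_pos), self_mem_nhdsWithin] with ρ h0 h1
    have hρ : ‖(ρ : ℂ)‖ < 1 := by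
      rw [Complex.norm_real, Real.norm_of_nonneg (le_of_lt h0)]; exact h1
    have h4 := integral_fourier_mul_inv hc hμ 0 hρ
    simp only [Nat.cast_zero, fourier_zero, one_mul, pow_zero] at h4
    rw [← h4, integral_const_mul]

/-- The inverse Cayley transform `i (1 + w) / (1 - w)` from the circle to the line. -/
def circleToLine (θ : UnitAddCircle) : ℝ :=
  (Complex.I * (1 + fourier 1 θ) / (1 - fourier 1 θ)).re

theorem measurable_circleToLine : Measurable circleToLine := by
  have := (fourier (T := 1) 1).continuous.measurable
  unfold circleToLine
  fun_prop

theorem coe_circleToLine {θ : UnitAddCircle} (hθ : fourier 1 θ ≠ 1) :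
    (circleToLine θ : ℂ) = Complex.I * (1 + fourier 1 θ) / (1 - fourier 1 θ) := by
  set w : ℂ := fourier 1 θ with hw
  have hw0 : w ≠ 0 := fun h => by
    have := norm_fourier_apply 1 θ
    rw [← hw, h, norm_zero] at this
    exact zero_ne_one this
  have h1 : 1 - w ≠ 0 := sub_ne_zero.2 (Ne.symm hθ)
  have h1' : w - 1 ≠ 0 := sub_ne_zero.2 hθ
  have hconj : (starRingEnd ℂ) w = w⁻¹ := by
    rw [Complex.inv_def, Complex.normSq_eq_norm_sq, hw, norm_fourier_apply]
    simp
  have e : circleToLine θ = (Complex.I * (1 + w) / (1 - w)).re := rfl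
  rw [e]
  refine Complex.conj_eq_iff_re.1 ?_
  simp only [map_div₀, map_mul, map_add, map_sub, map_one, Complex.conj_I, hconj]
  have h2 : 1 - w⁻¹ ≠ 0 := by
    rw [sub_ne_zero]; intro h; exact hθ (by rw [eq_comm, inv_eq_one] at h; exact h)
  rw [div_eq_div_iff h2 h1]
  field_simp
  ring

end Moments

section SpectralMeasures

variable {H : Type u} [NormedAddCommGroup H] [InnerProductSpace ℂ H] [CompleteSpace H]

/-- The images under the inverse Cayley transform of the boundary measures of the Cayley transform
of `T`. -/
theorem exists_spectral_measures {T : H →L[ℂ] H} (hT : IsDissipative T) :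
    ∃ μ : H → Measure ℝ, (∀ x, IsFiniteMeasure (μ x)) ∧
      (∀ x, (μ x).real Set.univ = ‖x‖ ^ 2) ∧
      (∀ z : ℂ, z.im < 0 → ∀ x : H, ⟪x, Ring.inverse (T - z • (1 : H →L[ℂ] H)) x⟫_ℂ
        = ∫ t : ℝ, ((t : ℂ) - z)⁻¹ ∂μ x) ∧
      ∀ a : H →₀ ℂ, (∀ M : H →L[ℂ] H, quadComb M a = 0) → ∀ s : Set ℝ, MeasurableSet s →
        Finsupp.linearCombination ℂ (fun x => (((μ x).real s : ℝ) : ℂ)) a = 0 := by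
  have hc := norm_cayley_le hT
  obtain ⟨μ, hfin, hmom, hrel⟩ := exists_boundary_measure hc
  have hreal : ∀ x (s : Set ℝ), MeasurableSet s →
      ((μ x).map circleToLine).real s = (μ x).real (circleToLine ⁻¹' s) := fun x s hs => by
    rw [Measure.real, Measure.map_apply measurable_circleToLine hs]
    rfl
  refine ⟨fun x => (μ x).map circleToLine, fun x => inferInstance, fun x => ?_, fun z hz x => ?_,
    fun a ha s hs => ?_⟩
  · rw [hreal x _ MeasurableSet.univ, Set.preimage_univ]
    have h := hmom x 0
    simp only [Nat.cast_zero, fourier_zero, integral_const, pow_zero, one_apply_eq_self,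
      inner_self_eq_norm_sq_to_K] at h
    refine Complex.ofReal_injective (Eq.trans ?_ (h.trans (by push_cast; rfl)))
    simp
  · have hz' : Complex.I - z ≠ 0 := fun h => by
      have := congr_arg Complex.im h
      simp at this
      linarith
    obtain ⟨ζ, hζ⟩ : ∃ ζ : ℂ, (Complex.I - z) * ζ = Complex.I + z :=
      ⟨(Complex.I + z) / (Complex.I - z), mul_div_cancel₀ _ hz'⟩
    have hζ1 : ‖-ζ‖ < 1 := by rw [norm_neg]; exact norm_lt_one_of_im_neg hz hζ
    have hu1 := isUnit_one_sub_cayley hT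
    have hu2 : IsUnit (1 - (-ζ) • cayley T) :=
      isUnit_one_sub_of_norm_lt_one (norm_smul_lt_one hc hζ1)
    have e1 := sub_smul_mul_one_sub_cayley hT hζ
    have e0 : 1 - (-ζ) • cayley T = 1 + ζ • cayley T := by rw [neg_smul, sub_neg_eq_add]
    rw [← e0] at e1
    have hu3 : IsUnit (T - z • (1 : H →L[ℂ] H)) := by
      have h : IsUnit ((T - z • (1 : H →L[ℂ] H)) * (1 - cayley T)) := by
        rw [e1]; exact isUnit_smul_of_ne_zero hz' hu2
      obtain ⟨w, hw⟩ := hu1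
      rw [← hw] at h
      exact (Units.isUnit_mul_units _ w).1 h
    have e2 : Ring.inverse (T - z • (1 : H →L[ℂ] H))
        = (Complex.I - z)⁻¹ • ((1 - cayley T) * Ring.inverse (1 - (-ζ) • cayley T)) := by
      have h := congr_arg (fun X => Ring.inverse (T - z • (1 : H →L[ℂ] H)) * X *
        Ring.inverse (1 - (-ζ) • cayley T)) e1
      rw [Ring.inverse_mul_cancel_left _ _ hu3, mul_assoc, smul_mul_assoc,
        Ring.mul_inverse_cancel _ hu2, mul_smul_comm, mul_one] at h
      rw [h, smul_smul, inv_mul_cancel₀ hz', one_smul]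
    have h0 := integral_fourier_mul_inv hc (hmom x) 0 hζ1
    have h1 := integral_fourier_mul_inv hc (hmom x) 1 hζ1
    have hden : ∀ θ : UnitAddCircle, 1 - -ζ * fourier 1 θ ≠ 0 := fun θ h => by
      have h2 : ‖-ζ * fourier 1 θ‖ = 1 := by rw [← sub_eq_zero.1 h, norm_one]
      rw [norm_mul, norm_fourier_apply, mul_one] at h2
      exact hζ1.ne h2
    have hcont : Continuous fun θ : UnitAddCircle => (1 - -ζ * fourier 1 θ)⁻¹ :=
      Continuous.inv₀ (continuous_const.sub (continuous_const.mul (fourier 1).continuous)) hden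
    have hint : ∀ k : ℕ, Integrable (fun θ : UnitAddCircle =>
        fourier k θ * (1 - -ζ * fourier 1 θ)⁻¹) (μ x) := fun k =>
      ((fourier (k : ℤ)).continuous.mul hcont).integrable_of_hasCompactSupport
        (HasCompactSupport.of_compactSpace _)
    rw [e2, _root_.smul_apply, inner_smul_right, sub_mul, _root_.sub_apply, inner_sub_right]
    rw [pow_zero] at h0
    rw [pow_one] at h1
    rw [← h0, ← h1, ← integral_sub (hint 0) (hint 1), ← integral_const_mul,
      integral_map measurable_circleToLine.aemeasurable
        (Measurable.aestronglyMeasurable (by fun_prop))]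
    have hae : ∀ᵐ θ ∂μ x, fourier 1 θ ≠ 1 :=
      measure_eq_zero_iff_ae_notMem.1 (measure_fourier_eq_one hc hu1 (hmom x))
    refine integral_congr_ae ?_
    filter_upwards [hae] with θ hθ
    rw [coe_circleToLine hθ]
    have hd := hden θ
    simp only [Nat.cast_zero, fourier_zero, Nat.cast_one]
    set w : ℂ := fourier 1 θ
    have h3 : 1 - w ≠ 0 := sub_ne_zero.2 (Ne.symm hθ)
    have h4 : Complex.I * (1 + w) / (1 - w) - z
        = (Complex.I - z) * (1 - -ζ * w) / (1 - w) := by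
      field_simp
      linear_combination -w * hζ
    rw [h4, inv_div, ← sub_mul, div_eq_mul_inv, mul_inv]
    ring
  · simp_rw [hreal _ _ hs]
    exact hrel a ha _

end SpectralMeasures

/-! ### From scalar measures to positive operator measures -/

section Polarization

variable {H : Type u} [NormedAddCommGroup H] [InnerProductSpace ℂ H] [CompleteSpace H]

/-- The combination of quadratic forms that polarises to `⟨x, · y⟩`. -/
def polComb (x y : H) : H →₀ ℂ :=
  (4⁻¹ : ℂ) • (Finsupp.single (x + y) 1 - Finsupp.single (x - y) 1
    - Finsupp.single (x + Complex.I • y) Complex.I + Finsupp.single (x - Complex.I • y) Complex.I)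

theorem quadComb_polComb (M : H →L[ℂ] H) (x y : H) : quadComb M (polComb x y) = ⟪x, M y⟫_ℂ := by
  rw [quadComb, polComb]
  simp only [map_smul, map_add, map_sub, Finsupp.linearCombination_single, smul_eq_mul,
    inner_add_left, inner_add_right, inner_sub_left, inner_sub_right, inner_smul_left,
    inner_smul_right, Complex.conj_I]
  linear_combination (-⟪x, M y⟫_ℂ / 2 + ⟪y, M x⟫_ℂ / 2) * Complex.I_sq

/-- A bounded nonnegative function that satisfies all the linear relations between quadratic forms
of operators is itself the quadratic form of an operator. -/
theorem exists_operator_of_quadratic {q : H → ℝ} (h0 : ∀ x, 0 ≤ q x) (h1 : ∀ x, q x ≤ ‖x‖ ^ 2)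
    (hq : ∀ a : H →₀ ℂ, (∀ M : H →L[ℂ] H, quadComb M a = 0) →
      Finsupp.linearCombination ℂ (fun x => (q x : ℂ)) a = 0) :
    ∃ F : H →L[ℂ] H, ∀ x, ⟪x, F x⟫_ℂ = q x := by
  set L : (H →₀ ℂ) →ₗ[ℂ] ℂ := Finsupp.linearCombination ℂ (fun x => (q x : ℂ)) with hL
  have hadd_left : ∀ x x' y, L (polComb (x + x') y) = L (polComb x y) + L (polComb x' y) := by
    intro x x' y
    rw [← sub_eq_zero, ← map_add, ← map_sub]
    refine hq _ fun M => ?_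
    rw [map_sub, map_add, quadComb_polComb, quadComb_polComb, quadComb_polComb, inner_add_left,
      sub_self]
  have hadd_right : ∀ x y y', L (polComb x (y + y')) = L (polComb x y) + L (polComb x y') := by
    intro x y y'
    rw [← sub_eq_zero, ← map_add, ← map_sub]
    refine hq _ fun M => ?_
    rw [map_sub, map_add, quadComb_polComb, quadComb_polComb, quadComb_polComb, map_add,
      inner_add_right, sub_self]
  have hsmul_left : ∀ (c : ℂ) x y, L (polComb (c • x) y) = (starRingEnd ℂ) c • L (polComb x y) := by
    intro c x y
    rw [← sub_eq_zero, ← map_smul, ← map_sub]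
    refine hq _ fun M => ?_
    rw [map_sub, map_smul, quadComb_polComb, quadComb_polComb, inner_smul_left, smul_eq_mul,
      sub_self]
  have hsmul_right : ∀ (c : ℂ) x y, L (polComb x (c • y)) = c • L (polComb x y) := by
    intro c x y
    rw [← sub_eq_zero, ← map_smul, ← map_sub]
    refine hq _ fun M => ?_
    rw [map_sub, map_smul, quadComb_polComb, quadComb_polComb, map_smul, inner_smul_right,
      smul_eq_mul, sub_self]
  have hdiag : ∀ x, L (polComb x x) = q x := by
    intro x
    have : (q x : ℂ) = L (Finsupp.single x 1) := by
      rw [hL, Finsupp.linearCombination_single, one_smul]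
    rw [this, ← sub_eq_zero, ← map_sub]
    refine hq _ fun M => ?_
    rw [map_sub, quadComb_polComb, quadComb, Finsupp.linearCombination_single, one_smul, sub_self]
  have hbound1 : ∀ x y, ‖L (polComb x y)‖ ≤ (‖x‖ + ‖y‖) ^ 2 := by
    intro x y
    have e : L (polComb x y) = 4⁻¹ * ((q (x + y) : ℂ) - q (x - y) - Complex.I * q (x + Complex.I • y)
        + Complex.I * q (x - Complex.I • y)) := by
      rw [hL, polComb]
      simp only [map_smul, map_add, map_sub, Finsupp.linearCombination_single, smul_eq_mul,
        one_mul]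
    have hb : ∀ z, ‖z‖ ≤ ‖x‖ + ‖y‖ → ‖(q z : ℂ)‖ ≤ (‖x‖ + ‖y‖) ^ 2 := fun z hz => by
      rw [Complex.norm_real, Real.norm_of_nonneg (h0 z)]
      exact (h1 z).trans (pow_le_pow_left₀ (norm_nonneg _) hz 2)
    have hI : ‖Complex.I • y‖ = ‖y‖ := by rw [norm_smul, Complex.norm_I, one_mul]
    have b1 := hb (x + y) (norm_add_le _ _)
    have b2 := hb (x - y) (norm_sub_le _ _)
    have b3 := hb (x + Complex.I • y) ((norm_add_le _ _).trans_eq (by rw [hI]))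
    have b4 := hb (x - Complex.I • y) ((norm_sub_le _ _).trans_eq (by rw [hI]))
    rw [e, norm_mul]
    have b5 : ‖(q (x + y) : ℂ) - q (x - y) - Complex.I * q (x + Complex.I • y)
        + Complex.I * q (x - Complex.I • y)‖ ≤ 4 * (‖x‖ + ‖y‖) ^ 2 := by
      refine (norm_add_le _ _).trans ((add_le_add_left ((norm_sub_le _ _).trans
        (add_le_add_left (norm_sub_le _ _) _)) _).trans ?_)
      rw [norm_mul, norm_mul, Complex.norm_I, one_mul, one_mul]
      linarith
    have b6 : ‖(4⁻¹ : ℂ)‖ = 4⁻¹ := by norm_num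
    rw [b6]
    linarith
  have hbound : ∀ x y, ‖L (polComb x y)‖ ≤ 4 * ‖x‖ * ‖y‖ := by
    intro x y
    have hz : ∀ z : H, ∃ e : H, ‖e‖ ≤ 1 ∧ z = ((‖z‖ : ℝ) : ℂ) • e := by
      intro z
      rcases eq_or_ne z 0 with rfl | hz
      · exact ⟨0, by simp, by simp⟩
      · have hz' : ((‖z‖ : ℝ) : ℂ) ≠ 0 := by exact_mod_cast norm_ne_zero_iff.2 hz
        refine ⟨((‖z‖ : ℝ) : ℂ)⁻¹ • z, ?_, by rw [smul_smul, mul_inv_cancel₀ hz', one_smul]⟩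
        rw [norm_smul, norm_inv, Complex.norm_real, norm_norm,
          inv_mul_cancel₀ (norm_ne_zero_iff.2 hz)]
    obtain ⟨e, he, hxe⟩ := hz x
    obtain ⟨f, hf, hyf⟩ := hz y
    have h2 := hbound1 e f
    have h3 : (‖e‖ + ‖f‖) ^ 2 ≤ 4 := by nlinarith [norm_nonneg e, norm_nonneg f]
    have h4 : ‖L (polComb x y)‖ = ‖x‖ * (‖y‖ * ‖L (polComb e f)‖) := by
      conv_lhs => rw [hxe, hyf, hsmul_left, hsmul_right]
      rw [smul_eq_mul, smul_eq_mul, Complex.conj_ofReal, norm_mul, norm_mul, Complex.norm_real,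
        Complex.norm_real, norm_norm, norm_norm]
    rw [h4]
    have h5 : ‖y‖ * ‖L (polComb e f)‖ ≤ ‖y‖ * 4 :=
      mul_le_mul_of_nonneg_left (h2.trans h3) (norm_nonneg _)
    have h6 := mul_le_mul_of_nonneg_left h5 (norm_nonneg x)
    linarith
  let B : H →L⋆[ℂ] H →L[ℂ] ℂ := LinearMap.mkContinuous₂
    (LinearMap.mk₂'ₛₗ (starRingEnd ℂ) (RingHom.id ℂ) (fun x y => L (polComb x y))
      hadd_left hsmul_left hadd_right hsmul_right) 4 hbound
  refine ⟨InnerProductSpace.continuousLinearMapOfBilin B, fun x => ?_⟩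
  rw [← inner_conj_symm, InnerProductSpace.continuousLinearMapOfBilin_apply]
  change (starRingEnd ℂ) (L (polComb x x)) = _
  rw [hdiag, Complex.conj_ofReal]

end Polarization

section OperatorMeasure

variable {H : Type u} [NormedAddCommGroup H] [InnerProductSpace ℂ H] [CompleteSpace H]

theorem eq_of_inner_self_eq {S T : H →L[ℂ] H} (h : ∀ x, ⟪x, S x⟫_ℂ = ⟪x, T x⟫_ℂ) : S = T := by
  refine ContinuousLinearMap.coe_inj.1 ((ext_inner_map _ _).1 fun x => ?_)
  change ⟪S x, x⟫_ℂ = ⟪T x, x⟫_ℂ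
  rw [← inner_conj_symm, h, inner_conj_symm]

theorem isSelfAdjoint_of_inner_self_real {S : H →L[ℂ] H} {q : H → ℝ}
    (h : ∀ x, ⟪x, S x⟫_ℂ = q x) : IsSelfAdjoint S := by
  refine eq_of_inner_self_eq fun x => ?_
  rw [ContinuousLinearMap.star_eq_adjoint, ContinuousLinearMap.adjoint_inner_right,
    ← inner_conj_symm, h, Complex.conj_ofReal]

/-- The positive operator measure `F` with `⟨x, F(s) x⟩ = μ_x(s)`. -/
theorem exists_operator_measure {μ : H → Measure ℝ} [∀ x, IsFiniteMeasure (μ x)]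
    (huniv : ∀ x, (μ x).real Set.univ = ‖x‖ ^ 2)
    (hrel : ∀ a : H →₀ ℂ, (∀ M : H →L[ℂ] H, quadComb M a = 0) → ∀ s : Set ℝ, MeasurableSet s →
        Finsupp.linearCombination ℂ (fun x => (((μ x).real s : ℝ) : ℂ)) a = 0) :
    ∃ F : {s : Set ℝ // MeasurableSet s} → H →L[ℂ] H, ∀ s x, ⟪x, F s x⟫_ℂ = (μ x).real s.1 := by
  have h : ∀ s : {s : Set ℝ // MeasurableSet s}, ∃ F : H →L[ℂ] H, ∀ x, ⟪x, F x⟫_ℂ = (μ x).real s.1 :=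
    fun s => exists_operator_of_quadratic (fun x => measureReal_nonneg)
      (fun x => (measureReal_mono (Set.subset_univ _)).trans_eq (huniv x))
      fun a ha => hrel a ha s.1 s.2
  choose F hF using h
  exact ⟨F, hF⟩

/-- The intersection of measurable sets. -/
def interSet (s t : {s : Set ℝ // MeasurableSet s}) : {s : Set ℝ // MeasurableSet s} :=
  ⟨s.1 ∩ t.1, s.2.inter t.2⟩

variable {μ : H → Measure ℝ} [∀ x, IsFiniteMeasure (μ x)]
  {F : {s : Set ℝ // MeasurableSet s} → H →L[ℂ] H}

/-- Positivity of the kernel `F(s ∩ t)`: splitting `u` along one of the sets at a time reduces the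
form to a sum of values `⟨v, F(u) v⟩ ≥ 0`. -/
theorem re_sum_inner_nonneg (hF : ∀ s x, ⟪x, F s x⟫_ℂ = (μ x).real s.1)
    (w : {s : Set ℝ // MeasurableSet s} → H) (S : Finset {s : Set ℝ // MeasurableSet s}) :
    ∀ (u : {s : Set ℝ // MeasurableSet s}) (v : H),
      0 ≤ (⟪F u v, v⟫_ℂ + ∑ i ∈ S, (⟪F (interSet u i) (w i), v⟫_ℂ + ⟪F (interSet u i) v, w i⟫_ℂ)
        + ∑ i ∈ S, ∑ j ∈ S, ⟪F (interSet u (interSet i j)) (w i), w j⟫_ℂ).re := by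
  classical
  induction S using Finset.induction_on with
  | empty =>
    intro u v
    simp only [Finset.sum_empty, add_zero]
    rw [← inner_conj_symm, Complex.conj_re, hF, Complex.ofReal_re]
    exact measureReal_nonneg
  | insert a S ha ih =>
    intro u v
    let ud : {s : Set ℝ // MeasurableSet s} := ⟨u.1 \ a.1, u.2.diff a.2⟩
    have hsplit : ∀ t x y, ⟪F (interSet u t) x, y⟫_ℂ
        = ⟪F (interSet (interSet u a) t) x, y⟫_ℂ + ⟪F (interSet ud t) x, y⟫_ℂ := by
      intro t x y
      have e : F (interSet u t) = F (interSet (interSet u a) t) + F (interSet ud t) := by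
        refine eq_of_inner_self_eq fun x => ?_
        rw [_root_.add_apply, inner_add_right, hF, hF, hF, ← Complex.ofReal_add,
          ← measureReal_union _ (interSet ud t).2]
        · congr 2
          ext r
          simp only [interSet, ud, Set.mem_inter_iff, Set.mem_union, Set.mem_sdiff]
          tauto
        · rw [Set.disjoint_left]
          rintro r ⟨⟨-, hr⟩, -⟩ ⟨⟨-, hr'⟩, -⟩
          exact hr' hr
      rw [e, _root_.add_apply, inner_add_left]
    have i1 : ∀ t, interSet (interSet u a) (interSet a t) = interSet (interSet u a) t := fun t => by
      refine Subtype.ext ?_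
      ext r; simp only [interSet, Set.mem_inter_iff]; tauto
    have i2 : ∀ t, interSet (interSet u a) (interSet t a) = interSet (interSet u a) t := fun t => by
      refine Subtype.ext ?_
      ext r; simp only [interSet, Set.mem_inter_iff]; tauto
    have i5 : interSet (interSet u a) a = interSet u a := by
      refine Subtype.ext ?_
      ext r; simp only [interSet, Set.mem_inter_iff]; tauto
    have hempty : ∀ t : {s : Set ℝ // MeasurableSet s}, t.1 = ∅ → F t = 0 := fun t ht => by
      refine eq_of_inner_self_eq fun x => ?_
      rw [hF, ht]; simp
    have i3 : ∀ t, F (interSet ud (interSet a t)) = 0 := fun t => hempty _ (by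
      ext r; simp only [interSet, ud, Set.mem_inter_iff, Set.mem_sdiff, Set.mem_empty_iff_false]
      tauto)
    have i4 : ∀ t, F (interSet ud (interSet t a)) = 0 := fun t => hempty _ (by
      ext r; simp only [interSet, ud, Set.mem_inter_iff, Set.mem_sdiff, Set.mem_empty_iff_false]
      tauto)
    have i6 : F (interSet ud a) = 0 := hempty _ (by
      ext r; simp only [interSet, ud, Set.mem_inter_iff, Set.mem_sdiff, Set.mem_empty_iff_false]
      tauto)
    have hu : ∀ x y, ⟪F u x, y⟫_ℂ = ⟪F (interSet u a) x, y⟫_ℂ + ⟪F ud x, y⟫_ℂ := by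
      intro x y
      have e : F u = F (interSet u a) + F ud := by
        refine eq_of_inner_self_eq fun x => ?_
        rw [_root_.add_apply, inner_add_right, hF, hF, hF, ← Complex.ofReal_add,
          ← measureReal_union _ ud.2]
        · congr 2
          exact (Set.inter_union_sdiff u.1 a.1).symm
        · exact Set.disjoint_sdiff_inter.symm
      rw [e, _root_.add_apply, inner_add_left]
    have h1 := add_nonneg (ih (interSet u a) (v + w a)) (ih ud v)
    rw [← Complex.add_re] at h1
    refine h1.trans_eq (congr_arg Complex.re ?_)
    rw [Finset.sum_insert ha, Finset.sum_insert ha]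
    simp_rw [Finset.sum_insert ha]
    simp_rw [hsplit]
    rw [hu v v]
    simp only [i1, i2, i3, i4, i5, i6, _root_.zero_apply, inner_zero_left, add_zero, map_add,
      inner_add_left, inner_add_right, Finset.sum_add_distrib]
    ring

end OperatorMeasure

/-! ### The dilation of a positive operator measure -/

section Kernel

variable {H : Type u} [NormedAddCommGroup H] [InnerProductSpace ℂ H] [CompleteSpace H]
  {μ : H → Measure ℝ} [∀ x, IsFiniteMeasure (μ x)]
  {F : {s : Set ℝ // MeasurableSet s} → H →L[ℂ] H}

theorem posSemidef_kernel (hF : ∀ s x, ⟪x, F s x⟫_ℂ = (μ x).real s.1) :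
    (Matrix.of fun s t => F (interSet s t)).PosSemidef := by
  have h := (RKHS.posSemidef_tfae (𝕜 := ℂ) (K := Matrix.of fun s t => F (interSet s t))).out 0 2
  refine h.2 ⟨?_, fun w => ?_⟩
  · ext1 s t
    change star (F (interSet t s)) = F (interSet s t)
    have e : interSet t s = interSet s t := Subtype.ext (Set.inter_comm _ _)
    rw [e]
    exact isSelfAdjoint_of_inner_self_real (hF _)
  · have h1 := re_sum_inner_nonneg hF w w.support ⟨Set.univ, MeasurableSet.univ⟩ 0
    simp only [inner_zero_right, map_zero, inner_zero_left, add_zero, Finset.sum_const_zero,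
      zero_add] at h1
    refine h1.trans_eq ?_
    change _ = Complex.re _
    congr 1
    refine Finset.sum_congr rfl fun i _ => Finset.sum_congr rfl fun j _ => ?_
    congr 3
    refine Subtype.ext ?_
    ext r
    simp only [interSet, Set.mem_inter_iff, Set.mem_univ, true_and]
    tauto

/-- The Hilbert space with reproducing kernel `F(s ∩ t)`. -/
theorem exists_kernel_space (hF : ∀ s x, ⟪x, F s x⟫_ℂ = (μ x).real s.1) :
    ∃ (K : Type u) (_ : NormedAddCommGroup K) (_ : InnerProductSpace ℂ K) (_ : CompleteSpace K)
      (k : {s : Set ℝ // MeasurableSet s} → H →L[ℂ] K),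
      (∀ s t x y, ⟪k s x, k t y⟫_ℂ = ⟪x, F (interSet s t) y⟫_ℂ) ∧
      Dense (Submodule.span ℂ {v : K | ∃ s x, k s x = v} : Set K) := by
  have hfact : Fact (Matrix.of fun s t => F (interSet s t)).PosSemidef := ⟨posSemidef_kernel hF⟩
  refine ⟨RKHS.OfKernel (Matrix.of fun s t => F (interSet s t)), inferInstance, inferInstance,
    inferInstance, RKHS.kerFun _, fun s t x y => ?_, ?_⟩
  · rw [← RKHS.kernel_inner, RKHS.OfKernel.kernel_ofKernel, ← ContinuousLinearMap.adjoint_inner_right]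
    have e : interSet t s = interSet s t := Subtype.ext (Set.inter_comm _ _)
    change ⟪x, star (F (interSet t s)) y⟫_ℂ = _
    rw [e, (isSelfAdjoint_of_inner_self_real (hF _)).star_eq]
  · have h := RKHS.kerFun_dense (𝕜 := ℂ)
      (RKHS.OfKernel (Matrix.of fun s t => F (interSet s t)))
    exact Submodule.dense_iff_topologicalClosure_eq_top.2 h

end Kernel

section Naimark

variable {H : Type u} [NormedAddCommGroup H] [InnerProductSpace ℂ H] [CompleteSpace H]
  {μ : H → Measure ℝ} [∀ x, IsFiniteMeasure (μ x)]
  {F : {s : Set ℝ // MeasurableSet s} → H →L[ℂ] H}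
  {K : Type u} [NormedAddCommGroup K] [InnerProductSpace ℂ K] [CompleteSpace K]
  {k : {s : Set ℝ // MeasurableSet s} → H →L[ℂ] K}

/-- The closed span of the vectors `k t x` with `t ⊆ s`: the subspace of the vectors that live
on `s`. -/
def supportSpace (k : {s : Set ℝ // MeasurableSet s} → H →L[ℂ] K) (s : Set ℝ) : Submodule ℂ K :=
  (Submodule.span ℂ {v : K | ∃ t x, t.1 ⊆ s ∧ k t x = v}).topologicalClosure

theorem completeSpace_supportSpace (k : {s : Set ℝ // MeasurableSet s} → H →L[ℂ] K) (s : Set ℝ) :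
    CompleteSpace (supportSpace k s) :=
  (Submodule.isClosed_topologicalClosure _).completeSpace_coe

/-- The orthogonal projection onto the vectors that live on `s`: the spectral projection of the
dilation. -/
def supportProj (k : {s : Set ℝ // MeasurableSet s} → H →L[ℂ] K) (s : Set ℝ) : K →L[ℂ] K :=
  have := completeSpace_supportSpace k s
  (supportSpace k s).starProjection

theorem isStarProjection_supportProj (k : {s : Set ℝ // MeasurableSet s} → H →L[ℂ] K)
    (s : Set ℝ) : IsStarProjection (supportProj k s) :=
  have := completeSpace_supportSpace k s
  isStarProjection_starProjection

theorem supportProj_apply (hk : ∀ s t x y, ⟪k s x, k t y⟫_ℂ = ⟪x, F (interSet s t) y⟫_ℂ)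
    (s t : {s : Set ℝ // MeasurableSet s}) (x : H) :
    supportProj k s.1 (k t x) = k (interSet t s) x := by
  have := completeSpace_supportSpace k s.1
  change (supportSpace k s.1).starProjection (k t x) = k (interSet t s) x
  refine Submodule.eq_starProjection_of_mem_of_inner_eq_zero ?_ ?_
  · exact Submodule.le_topologicalClosure _
      (Submodule.subset_span ⟨interSet t s, x, Set.inter_subset_right, rfl⟩)
  · intro g hg
    have hle : supportSpace k s.1 ≤ (ℂ ∙ (k t x - k (interSet t s) x))ᗮ := by
      refine Submodule.topologicalClosure_minimal _ (Submodule.span_le.2 ?_)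
        (Submodule.isClosed_orthogonal _)
      rintro _ ⟨r, y, hr, rfl⟩
      refine Submodule.mem_orthogonal_singleton_iff_inner_right.2 ?_
      have e : interSet (interSet t s) r = interSet t r := by
        refine Subtype.ext ?_
        ext a
        simp only [interSet, Set.mem_inter_iff]
        exact ⟨fun h => ⟨h.1.1, h.2⟩, fun h => ⟨⟨h.1, hr h.2⟩, h.2⟩⟩
      rw [inner_sub_left, hk, hk, e, sub_self]
    exact Submodule.mem_orthogonal_singleton_iff_inner_right.1 (hle hg)

/-- The defect in additivity of the vectors `k s x` is the defect in additivity of `μ_x`. -/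
theorem norm_sub_sum_sq (hF : ∀ s x, ⟪x, F s x⟫_ℂ = (μ x).real s.1)
    (hk : ∀ s t x y, ⟪k s x, k t y⟫_ℂ = ⟪x, F (interSet s t) y⟫_ℂ) {ι : Type*} (I : Finset ι) (f : ι → {s : Set ℝ // MeasurableSet s})
    (hd : Pairwise (Function.onFun Disjoint fun i => (f i).1)) (s : {s : Set ℝ // MeasurableSet s})
    (hs : ∀ i, (f i).1 ⊆ s.1) (x : H) :
    ‖k s x - ∑ i ∈ I, k (f i) x‖ ^ 2 = (μ x).real s.1 - ∑ i ∈ I, (μ x).real (f i).1 := by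
  classical
  have h1 : ∀ i, interSet s (f i) = f i := fun i =>
    Subtype.ext (Set.inter_eq_right.2 (hs i))
  have h2 : ∀ i, interSet (f i) s = f i := fun i =>
    Subtype.ext (Set.inter_eq_left.2 (hs i))
  have h3 : ∀ i j, ⟪x, F (interSet (f i) (f j)) x⟫_ℂ
      = if i = j then ((μ x).real (f i).1 : ℂ) else 0 := by
    intro i j
    rw [hF]
    split_ifs with h
    · subst h
      rw [show interSet (f i) (f i) = f i from Subtype.ext (Set.inter_self _)]
    · have : (interSet (f i) (f j)).1 = ∅ := Set.disjoint_iff_inter_eq_empty.1 (hd h)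
      rw [this]; simp
  have h4 : interSet s s = s := Subtype.ext (Set.inter_self _)
  have h5 : ⟪k s x - ∑ i ∈ I, k (f i) x, k s x - ∑ i ∈ I, k (f i) x⟫_ℂ
      = (((μ x).real s.1 - ∑ i ∈ I, (μ x).real (f i).1 : ℝ) : ℂ) := by
    simp only [inner_sub_left, inner_sub_right, sum_inner, inner_sum, hk, h1, h2, h3, h4, hF]
    push_cast
    simp
  rw [inner_self_eq_norm_sq_to_K] at h5
  exact Complex.ofReal_injective (Eq.trans (by push_cast; rfl) h5)

theorem sum_supportProj (hF : ∀ s x, ⟪x, F s x⟫_ℂ = (μ x).real s.1)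
    (hk : ∀ s t x y, ⟪k s x, k t y⟫_ℂ = ⟪x, F (interSet s t) y⟫_ℂ)
    (hdense : Dense (Submodule.span ℂ {v : K | ∃ s x, k s x = v} : Set K))
    {ι : Type*} (I : Finset ι) (f : ι → {s : Set ℝ // MeasurableSet s})
    (hd : Pairwise (Function.onFun Disjoint fun i => (f i).1)) :
    ∑ i ∈ I, supportProj k (f i).1 = supportProj k (⋃ i ∈ I, (f i).1) := by
  classical
  refine ContinuousLinearMap.ext_on hdense ?_
  rintro _ ⟨t, x, rfl⟩
  have hm : MeasurableSet (⋃ i ∈ I, (f i).1) := I.measurableSet_biUnion fun i _ => (f i).2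
  have e := supportProj_apply hk ⟨_, hm⟩ t x
  rw [_root_.sum_apply]
  change _ = supportProj k (⟨_, hm⟩ : {s : Set ℝ // MeasurableSet s}).1 (k t x)
  rw [e]
  simp_rw [supportProj_apply hk]
  have hd' : Pairwise (Function.onFun Disjoint fun i => (interSet t (f i)).1) := fun i j hij =>
    (hd hij).mono Set.inter_subset_right Set.inter_subset_right
  have h1 := norm_sub_sum_sq hF hk (Finset.univ : Finset I) (fun i => interSet t (f i))
    (fun i j hij => hd' (Subtype.coe_injective.ne hij)) (interSet t ⟨_, hm⟩)
    (fun i => Set.inter_subset_inter_right _ 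
      (Set.subset_iUnion₂ (s := fun j (_ : j ∈ I) => (f j).1) i.1 i.2)) x
  rw [Finset.sum_coe_sort I fun i => k (interSet t (f i)) x,
    Finset.sum_coe_sort I fun i => (μ x).real (interSet t (f i)).1] at h1
  have h2 : (interSet t ⟨_, hm⟩).1 = ⋃ i ∈ I, (interSet t (f i)).1 := Set.inter_iUnion₂ _ _
  rw [h2, measureReal_biUnion_finset (fun i _ j _ hij => hd' hij) (fun i _ => (interSet t (f i)).2),
    sub_self, sq_eq_zero_iff, norm_eq_zero, sub_eq_zero] at h1
  exact h1.symm

/-- The finite partial sums are projections, hence equicontinuous, so it is enough to treat the vectors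
`k t x`, which span a dense subspace. -/
theorem hasSum_supportProj (hF : ∀ s x, ⟪x, F s x⟫_ℂ = (μ x).real s.1)
    (hk : ∀ s t x y, ⟪k s x, k t y⟫_ℂ = ⟪x, F (interSet s t) y⟫_ℂ)
    (hdense : Dense (Submodule.span ℂ {v : K | ∃ s x, k s x = v} : Set K))
    (f : ℕ → {s : Set ℝ // MeasurableSet s})
    (hd : Pairwise (Function.onFun Disjoint fun i => (f i).1)) (v : K) :
    HasSum (fun n => supportProj k (f n).1 v) (supportProj k (⋃ n, (f n).1) v) := by
  set E := supportProj k (⋃ n, (f n).1)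
  set A : Finset ℕ → K → K := fun I v => ∑ n ∈ I, supportProj k (f n).1 v with hA
  have hA' : ∀ I v, A I v = supportProj k (⋃ i ∈ I, (f i).1) v := fun I v => by
    rw [hA, ← sum_supportProj hF hk hdense I f hd, _root_.sum_apply]
  have hlip : ∀ I, LipschitzWith 1 (A I) := fun I => by
    have h1 : A I = supportProj k (⋃ i ∈ I, (f i).1) := funext (hA' I)
    rw [h1]
    have h2 := (isStarProjection_supportProj k (⋃ i ∈ I, (f i).1)).norm_le
    exact (ContinuousLinearMap.lipschitz _).weaken (by exact_mod_cast h2)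
  have hclosed : IsClosed {v | Tendsto (A · v) atTop (𝓝 (E v))} :=
    (LipschitzWith.uniformEquicontinuous A 1 hlip).equicontinuous.isClosed_setOfPred_tendsto
      E.continuous
  have hspan : (Submodule.span ℂ {v : K | ∃ s x, k s x = v} : Set K)
      ⊆ {v | Tendsto (A · v) atTop (𝓝 (E v))} := by
    intro v hv
    induction hv using Submodule.span_induction with
    | mem v hv =>
      obtain ⟨t, x, rfl⟩ := hv
      have hm : MeasurableSet (⋃ n, (f n).1) := MeasurableSet.iUnion fun n => (f n).2
      have e : E (k t x) = k (interSet t ⟨_, hm⟩) x := supportProj_apply hk ⟨_, hm⟩ t x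
      have hd' : Pairwise (Function.onFun Disjoint fun i => (interSet t (f i)).1) :=
        fun i j hij => (hd hij).mono Set.inter_subset_right Set.inter_subset_right
      change Tendsto (fun I => A I (k t x)) atTop (𝓝 (E (k t x)))
      rw [e, tendsto_iff_norm_sub_tendsto_zero]
      have h1 : ∀ I, ‖A I (k t x) - k (interSet t ⟨_, hm⟩) x‖ ^ 2
          = (μ x).real (interSet t ⟨_, hm⟩).1 - ∑ i ∈ I, (μ x).real (interSet t (f i)).1 := by
        intro I
        rw [norm_sub_rev, hA]
        simp_rw [supportProj_apply hk]
        exact norm_sub_sum_sq hF hk I (fun i => interSet t (f i)) hd' _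
          (fun i => Set.inter_subset_inter_right _ (Set.subset_iUnion (fun n => (f n).1) i)) x
      have h2 : (interSet t ⟨_, hm⟩).1 = ⋃ i, (interSet t (f i)).1 := Set.inter_iUnion _ _
      have h3 : HasSum (fun i => (μ x).real (interSet t (f i)).1)
          ((μ x).real (interSet t ⟨_, hm⟩).1) := by
        rw [h2]
        have h4 := measure_iUnion (μ := μ x) hd' fun i => (interSet t (f i)).2
        have h5 : ∀ i, μ x (interSet t (f i)).1 ≠ ⊤ := fun i => measure_ne_top _ _
        have h6 := ENNReal.hasSum_toReal (h4 ▸ measure_ne_top (μ x) _)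
        rwa [← ENNReal.tsum_toReal_eq h5, ← h4] at h6
      have h7 := (tendsto_const_nhds (x := (μ x).real (interSet t ⟨_, hm⟩).1)).sub h3
      rw [sub_self] at h7
      have h8 := (h7.congr fun I => (h1 I).symm).sqrt
      rw [Real.sqrt_zero] at h8
      exact h8.congr fun I => Real.sqrt_sq (norm_nonneg _)
    | zero => exact tendsto_const_nhds.congr fun I => by simp [hA]
    | add v w _ _ hv hw =>
      change Tendsto (fun I => A I (v + w)) atTop (𝓝 (E (v + w)))
      rw [map_add]
      exact (hv.add hw).congr fun I => by simp [hA, Finset.sum_add_distrib]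
    | smul c v _ hv =>
      change Tendsto (fun I => A I (c • v)) atTop (𝓝 (E (c • v)))
      rw [map_smul]
      exact (hv.const_smul c).congr fun I => by simp [hA, Finset.smul_sum]
  exact closure_minimal hspan hclosed (hdense v)

end Naimark

section Existence

variable {H : Type u} [NormedAddCommGroup H] [InnerProductSpace ℂ H] [CompleteSpace H]

/-- Every dissipative operator has a minimal self-adjoint dilation. The vectors `k univ x` embed `H`
isometrically into the kernel space, and `μ_x` becomes the spectral measure of `k univ x`. -/
theorem nonempty_selfAdjointDilation {T : H →L[ℂ] H} (hT : IsDissipative T) :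
    Nonempty (SelfAdjointDilation T) := by
  obtain ⟨μ, hfin, huniv, hres, hrel⟩ := exists_spectral_measures hT
  obtain ⟨F, hF⟩ := exists_operator_measure huniv hrel
  obtain ⟨K, _, _, _, k, hk, hdense⟩ := exists_kernel_space hF
  let univ : {s : Set ℝ // MeasurableSet s} := ⟨Set.univ, MeasurableSet.univ⟩
  have hinter : ∀ s, interSet univ s = s := fun s => Subtype.ext (Set.univ_inter _)
  have hself : ∀ s, interSet s s = s := fun s => Subtype.ext (Set.inter_self _)
  have hnorm : ∀ x, ‖k univ x‖ = ‖x‖ := by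
    intro x
    have h1 := hk univ univ x x
    rw [hself, hF, huniv, inner_self_eq_norm_sq_to_K] at h1
    have h2 : ‖k univ x‖ ^ 2 = ‖x‖ ^ 2 :=
      Complex.ofReal_injective (Eq.trans (by push_cast; rfl) h1)
    exact (sq_eq_sq₀ (norm_nonneg _) (norm_nonneg _)).1 h2
  let V : H →ₗᵢ[ℂ] K := ⟨(k univ).toLinearMap, hnorm⟩
  let E : SpectralMeasure K :=
    { proj := supportProj k
      isStarProjection := fun s _ => isStarProjection_supportProj k s
      proj_univ := by
        refine ContinuousLinearMap.ext_on hdense ?_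
        rintro _ ⟨t, x, rfl⟩
        have e := supportProj_apply hk univ t x
        have e1 : interSet t univ = t := Subtype.ext (Set.inter_univ _)
        rw [e1] at e
        exact e
      hasSum_iUnion := fun f hf hd x =>
        hasSum_supportProj hF hk hdense (fun n => ⟨f n, hf n⟩) hd x }
  have hEV : ∀ (s : {s : Set ℝ // MeasurableSet s}) x, E.proj s.1 (V x) = k s x := fun s x => by
    have e := supportProj_apply hk s univ x
    rw [hinter] at e
    exact e
  have hmeas : ∀ x, E.measure (V x) = μ x := by
    intro x
    ext s hs
    rw [E.measure_apply _ hs, hEV ⟨s, hs⟩ x]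
    have h1 : ⟪V x, k ⟨s, hs⟩ x⟫_ℂ = (μ x).real s := by
      change ⟪k univ x, k ⟨s, hs⟩ x⟫_ℂ = _
      rw [hk, hinter, hF]
    rw [h1, Complex.ofReal_re, Measure.real, ENNReal.ofReal_toReal (measure_ne_top _ _)]
  exact ⟨{ K := K
           V := V
           E := E
           resolvent_eq := fun z hz x => by rw [hmeas]; exact hres z hz x
           minimal := by
            refine hdense.mono (Submodule.span_mono ?_)
            rintro _ ⟨s, x, rfl⟩
            exact ⟨s.1, s.2, x, (hEV s x).symm⟩ }⟩

end Existence

/-! ### The operators `Ξ(S + A + iB)` -/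

section Formulas

variable {H : Type u} [NormedAddCommGroup H] [InnerProductSpace ℂ H] [CompleteSpace H]

/-- The Hilbert–Schmidt norm of `|X|^{1/2}` dominates its operator norm. -/
theorem ofReal_norm_le_traceNorm (X : H →L[ℂ] H) : ENNReal.ofReal ‖X‖ ≤ traceNorm X := by
  have h0 := CFC.abs_nonneg X
  obtain ⟨h1, h2⟩ := sqrt_facts h0
  have h3 := ofReal_norm_sq_le_hsSq (CFC.sqrt (CFC.abs X))
  rw [hsSq_sqrt h0] at h3
  refine le_trans (le_of_eq ?_) h3
  have h4 := CStarRing.norm_star_mul_self (x := CFC.sqrt (CFC.abs X))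
  rw [h1, h2, CFC.norm_abs] at h4
  rw [h4, sq]

theorem apply_eq_zero_of_re_inner_eq_zero {B : H →L[ℂ] H} (hB : B.IsPositive) {x : H}
    (h : (⟪x, B x⟫_ℂ).re = 0) : B x = 0 := by
  have h0 := (ContinuousLinearMap.nonneg_iff_isPositive B).2 hB
  rw [inner_sqrt_mul_sqrt h0] at h
  have h1 : CFC.sqrt B x = 0 := inner_self_eq_zero.1 (Complex.ext h (_root_.inner_self_im (𝕜 := ℂ) _))
  rw [← (sqrt_facts h0).2, mul_apply_eq_comp, h1, map_zero]

theorem apply_eq_zero_of_add_I_smul {R B : H →L[ℂ] H} (hR : IsSelfAdjoint R) (hB : B.IsPositive)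
    {x : H} (h : (R + Complex.I • B) x = 0) : R x = 0 ∧ B x = 0 := by
  have h1 := im_inner_add_I_smul hR (B := B) x
  rw [h, inner_zero_right, Complex.zero_im] at h1
  have h2 := apply_eq_zero_of_re_inner_eq_zero hB h1.symm
  rw [_root_.add_apply, _root_.smul_apply, h2, smul_zero, add_zero] at h
  exact ⟨h, h2⟩

theorem star_add_I_smul_apply_eq_zero {R B : H →L[ℂ] H} (hR : IsSelfAdjoint R)
    (hB : B.IsPositive) {x : H} (h : (R + Complex.I • B) x = 0) :
    star (R + Complex.I • B) x = 0 := by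
  obtain ⟨h1, h2⟩ := apply_eq_zero_of_add_I_smul hR hB h
  rw [star_add, star_smul, hR.star_eq, hB.isSelfAdjoint.star_eq, _root_.add_apply,
    _root_.smul_apply, h1, h2, smul_zero, add_zero]

theorem IsDissipative.add_isSelfAdjoint {T P : H →L[ℂ] H} (hT : IsDissipative T)
    (hP : IsSelfAdjoint P) : IsDissipative (T + P) := fun x => by
  rw [_root_.add_apply, inner_add_right, Complex.add_im, Trindex.inner_self_im hP, add_zero]
  exact hT x

theorem Xi_eq_negSpec {T P : H →L[ℂ] H} (hT : IsDissipative T) (hP : IsStarProjection P)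
    (h1 : T * P = 0) (h2 : P * T = 0) (hu : IsUnit (T + P)) : Xi T = negSpec (T + P) := by
  have hne := nonempty_selfAdjointDilation hT
  rw [Xi, dif_pos hne]
  exact hne.some.compression_eq hT hP h1 h2
    ((hT.add_isSelfAdjoint hP.isSelfAdjoint).resolventBound hu)

theorem Xi_eq_negSpec_of_isUnit {T : H →L[ℂ] H} (hT : IsDissipative T) (hu : IsUnit T) :
    Xi T = negSpec T := by
  have h := Xi_eq_negSpec hT (IsStarProjection.zero _) (mul_zero T) (zero_mul T)
    (by rwa [add_zero])
  rwa [add_zero] at h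

/-- `Ξ(R + iB)` is unchanged if the kernel of `R + iB` is moved to the eigenvalue `1`, which makes
the operator invertible. -/
theorem exists_Xi_eq_negSpec {R B W : H →L[ℂ] H} (hR : IsSelfAdjoint R) (hB : B.IsPositive)
    (hW : IsUnit W) (hK : IsCompactOperator (R + Complex.I • B - W : H →L[ℂ] H)) :
    ∃ P : H →L[ℂ] H, IsStarProjection P ∧ (∃ c, TraceBound P c) ∧
      IsUnit (R + Complex.I • B + P) ∧ Xi (R + Complex.I • B) = negSpec (R + Complex.I • B + P) := by
  obtain ⟨N, _, -, h1, h2, h3⟩ := isUnit_add_starProjection_ker hW hK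
    (add_sub_cancel W (R + Complex.I • B)).symm
    fun x hx => star_add_I_smul_apply_eq_zero hR hB hx
  exact ⟨N.starProjection, isStarProjection_starProjection, ⟨_, traceBound_starProjection N⟩, h3,
    Xi_eq_negSpec (isDissipative_add_I_smul hR hB) isStarProjection_starProjection h1 h2 h3⟩

theorem exists_Xi_eq_negSpec_of_isSelfAdjoint {R W : H →L[ℂ] H} (hR : IsSelfAdjoint R)
    (hW : IsUnit W) (hK : IsCompactOperator (R - W : H →L[ℂ] H)) :
    ∃ P : H →L[ℂ] H, IsStarProjection P ∧ (∃ c, TraceBound P c) ∧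
      IsUnit (R + P) ∧ Xi R = negSpec (R + P) := by
  have h := exists_Xi_eq_negSpec hR (B := 0) ContinuousLinearMap.isPositive_zero hW
    (by rwa [smul_zero, add_zero])
  rwa [smul_zero, add_zero] at h

theorem trindex_negSpec {T R S : H →L[ℂ] H} (hT : IsDissipative T) (hTu : IsUnit T)
    (hR : IsSelfAdjoint R) (hRu : IsUnit R) (hS : IsSelfAdjoint S) (hSu : IsUnit S) {c : ℝ}
    (hc : TraceBound (R - T) c) (hRS : IsCompactOperator (S - R : H →L[ℂ] H)) :
    HasTrindex (negSpec T) (negSpec S) ∧ trindex (negSpec T) (negSpec S)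
      = trace (negSpec T - negSpec R) + (pairIndex (negSpec R) (negSpec S) : ℂ) := by
  have hTb := hT.resolventBound hTu
  have hRb := (isDissipative_of_isSelfAdjoint hR).resolventBound hRu
  have hSb := (isDissipative_of_isSelfAdjoint hS).resolventBound hSu
  refine trindex_eq (isSelfAdjoint_negSpec T) (isStarProjection_negSpec hR hRu)
    (isStarProjection_negSpec hS hSu) ?_ ?_
  · exact (traceBound_negSpec_sub hTb hRb hc).isTraceClass
      ((isSelfAdjoint_negSpec T).sub (isSelfAdjoint_negSpec R))
  · exact isCompactOperator_negSpec_sub hRb hSb hRS (by rwa [(hS.sub hR).star_eq])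

theorem hasTrindex_Xi {S A B W : H →L[ℂ] H} (hS : IsSelfAdjoint S) (hA : IsSelfAdjoint A)
    (hAc : IsCompactOperator A) (hB : B.IsPositive) (hBt : IsTraceClass B) (hW : IsUnit W)
    (hK : IsCompactOperator (S - W : H →L[ℂ] H)) :
    HasTrindex (Xi (S + A + Complex.I • B)) (Xi S) := by
  have hBb := traceBound_of_isTraceClass hB.isSelfAdjoint hBt
  have hK' : IsCompactOperator (S + A - W : H →L[ℂ] H) := by
    rw [add_sub_right_comm]; exact hK.add hAc
  have hK'' : IsCompactOperator (S + A + Complex.I • B - W : H →L[ℂ] H) := by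
    rw [add_sub_right_comm]; exact hK'.add (hBb.smul Complex.I).isCompactOperator
  obtain ⟨P, hP, ⟨c, hc⟩, hu, e⟩ := exists_Xi_eq_negSpec (hS.add hA) hB hW hK''
  obtain ⟨P₁, hP₁, ⟨c₁, hc₁⟩, hu₁, -⟩ := exists_Xi_eq_negSpec_of_isSelfAdjoint (hS.add hA) hW hK'
  obtain ⟨P₂, hP₂, ⟨c₂, hc₂⟩, hu₂, e₂⟩ := exists_Xi_eq_negSpec_of_isSelfAdjoint hS hW hK
  rw [e, e₂]
  have d1 : S + A + P₁ - (S + A + Complex.I • B + P) = P₁ - P - Complex.I • B := by abel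
  have d2 : S + P₂ - (S + A + P₁) = P₂ - P₁ - A := by abel
  refine (trindex_negSpec (R := S + A + P₁) (c := c₁ + c + ‖Complex.I‖ * (3 * (traceNorm B).toReal))
    ((isDissipative_add_I_smul (hS.add hA) hB).add_isSelfAdjoint hP.isSelfAdjoint) hu
    ((hS.add hA).add hP₁.isSelfAdjoint) hu₁ (hS.add hP₂.isSelfAdjoint) hu₂ ?_ ?_).1
  · rw [d1]
    exact (hc₁.sub hc).sub (hBb.smul _)
  · rw [d2]
    exact (hc₂.sub hc₁).isCompactOperator.sub hAc

end Formulas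

/-! ### Continuity -/

section Continuity

variable {H : Type u} [NormedAddCommGroup H] [InnerProductSpace ℂ H] [CompleteSpace H]

theorem ResolventBound.mono {T : H →L[ℂ] H} {M M' : ℝ} (h : ResolventBound T M) (hM : M ≤ M') :
    ResolventBound T M' :=
  ⟨h.isUnit, fun y hy => (h.norm_le y hy).trans
    (mul_le_mul_of_nonneg_right hM (inv_nonneg.2 (by linarith)))⟩

theorem ResolventBound.norm_le' {T : H →L[ℂ] H} {M : ℝ} (h : ResolventBound T M) {y : ℝ}
    (hy : 0 ≤ y) : ‖resAt T y‖ ≤ M :=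
  (h.norm_le y hy).trans (mul_le_of_le_one_right h.nonneg (inv_le_one_of_one_le₀ (by linarith)))

/-- Inversion is continuous, so the resolvent bounds near an invertible operator are uniform. -/
theorem exists_eventually_resolventBound {T : ℕ → H →L[ℂ] H} {T₀ : H →L[ℂ] H}
    (hT : ∀ j, IsDissipative (T j)) (hT₀ : IsDissipative T₀) (hu : IsUnit T₀)
    (hlim : Tendsto T atTop (𝓝 T₀)) :
    ∃ M, ResolventBound T₀ M ∧ ∀ᶠ j in atTop, IsUnit (T j) ∧ ResolventBound (T j) M := by
  refine ⟨2 * (‖Ring.inverse T₀‖ + 1) + 1, (hT₀.resolventBound hu).mono (by linarith), ?_⟩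
  have h1 : Tendsto (fun j => ‖Ring.inverse (T j)‖) atTop (𝓝 ‖Ring.inverse T₀‖) := by
    obtain ⟨w, rfl⟩ := hu
    exact ((NormedRing.inverse_continuousAt w).tendsto.comp hlim).norm
  filter_upwards [hlim.eventually (Units.isOpen.mem_nhds hu),
    h1.eventually_le_const (lt_add_one _)] with j h2 h3
  exact ⟨h2, ((hT j).resolventBound h2).mono (by linarith)⟩

theorem traceBound_resAt_mul_sub {T R T' R' : H →L[ℂ] H} {M c ε δ δ' : ℝ}
    (hT : ResolventBound T M) (hR : ResolventBound R M) (hT' : ResolventBound T' M)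
    (hR' : ResolventBound R' M) (hc : TraceBound (R - T) c)
    (hε : TraceBound ((R' - T') - (R - T)) ε) (hδ : ‖T - T'‖ ≤ δ) (hδ' : ‖R - R'‖ ≤ δ') {y : ℝ}
    (hy : 0 ≤ y) :
    TraceBound (resAt T' y * (R' - T') * resAt R' y - resAt T y * (R - T) * resAt R y)
      ((M * ε * M + M * (δ * M * c) * M + M * (c * (M * δ')) * M) * (1 + y ^ 2)⁻¹) := by
  have hM := hT.nonneg
  have e : resAt T' y * (R' - T') * resAt R' y - resAt T y * (R - T) * resAt R y
      = resAt T' y * ((R' - T') - (R - T)) * resAt R' y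
        + resAt T' y * ((T - T') * resAt T y * (R - T)) * resAt R' y
        + resAt T y * ((R - T) * (resAt R' y * (R - R'))) * resAt R y := by
    have e1 := hT'.sub_eq hT hy
    have e2 := hR'.sub_eq hR hy
    have e3 : resAt T' y * ((T - T') * resAt T y * (R - T)) * resAt R' y
        = (resAt T' y - resAt T y) * (R - T) * resAt R' y := by
      rw [e1]; simp only [mul_assoc]
    have e4 : resAt T y * ((R - T) * (resAt R' y * (R - R'))) * resAt R y
        = resAt T y * (R - T) * (resAt R' y - resAt R y) := by
      rw [e2]; simp only [mul_assoc]
    rw [e3, e4]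
    noncomm_ring
  have b1 : ‖(T - T') * resAt T y‖ * c ≤ δ * M * c :=
    mul_le_mul_of_nonneg_right ((norm_mul_le _ _).trans
      (mul_le_mul hδ (hT.norm_le' hy) (norm_nonneg _) ((norm_nonneg _).trans hδ))) hc.nonneg
  have b2 : c * ‖resAt R' y * (R - R')‖ ≤ c * (M * δ') :=
    mul_le_mul_of_nonneg_left ((norm_mul_le _ _).trans
      (mul_le_mul (hR'.norm_le' hy) hδ' (norm_nonneg _) hM)) hc.nonneg
  have t1 := (hε.mul_mul (resAt T' y) (resAt R' y)).mono (hT'.norm_mul_mul_le hR' hy hε.nonneg)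
  have c2 := (hc.mul_left ((T - T') * resAt T y)).mono b1
  have t2 := (c2.mul_mul (resAt T' y) (resAt R' y)).mono (hT'.norm_mul_mul_le hR' hy c2.nonneg)
  have c3 := (hc.mul_right (resAt R' y * (R - R'))).mono b2
  have t3 := (c3.mul_mul (resAt T y) (resAt R y)).mono (hT.norm_mul_mul_le hR hy c3.nonneg)
  rw [e, add_mul, add_mul]
  exact (t1.add t2).add t3

/-- The difference of two differences `negSpec T - negSpec R` is small in trace norm as soon as
`R - T` changes little in trace norm and `T` and `R` change little in operator norm. -/
theorem traceBound_negSpec_sub_sub {T R T' R' : H →L[ℂ] H} {M c ε δ δ' : ℝ}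
    (hT : ResolventBound T M) (hR : ResolventBound R M) (hT' : ResolventBound T' M)
    (hR' : ResolventBound R' M) (hc : TraceBound (R - T) c)
    (hε : TraceBound ((R' - T') - (R - T)) ε) (hδ : ‖T - T'‖ ≤ δ) (hδ' : ‖R - R'‖ ≤ δ') :
    TraceBound ((negSpec T' - negSpec R') - (negSpec T - negSpec R))
      ((M * ε * M + M * (δ * M * c) * M + M * (c * (M * δ')) * M) / 2) := by
  rw [negSpec_sub hT' hR', negSpec_sub hT hR, neg_sub_neg, ← smul_sub,
    ← integral_sub (integrableOn_resAt_mul hT hR) (integrableOn_resAt_mul hT' hR')]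
  set K := M * ε * M + M * (δ * M * c) * M + M * (c * (M * δ')) * M with hK
  have hint : TraceBound _ _ := TraceBound.integral
    (g := fun y : ℝ => (K + K) * (1 + y ^ 2)⁻¹)
    ((integrableOn_resAt_mul hT hR).sub (integrableOn_resAt_mul hT' hR'))
    (integrable_inv_one_add_sq.integrableOn.const_mul _)
    (ae_restrict_of_forall_mem measurableSet_Ioi fun y hy => by
      have h1 := traceBound_resAt_mul_sub hT hR hT' hR' hc hε hδ hδ' (le_of_lt hy)
      have h2 := (h1.add h1.star).neg
      rw [← add_mul] at h2
      convert h2 using 1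
      rw [star_sub, Pi.sub_apply]
      abel)
  refine (hint.smul _).mono (le_of_eq ?_)
  rw [integral_const_mul_inv_one_add_sq, norm_inv_two_pi]
  field_simp
  ring

theorem tendsto_trace_negSpec_sub {T R : ℕ → H →L[ℂ] H} {T₀ R₀ : H →L[ℂ] H} {M c : ℝ} {ε : ℕ → ℝ}
    (hT₀ : ResolventBound T₀ M) (hR₀ : ResolventBound R₀ M)
    (hT : ∀ᶠ j in atTop, ResolventBound (T j) M) (hR : ∀ᶠ j in atTop, ResolventBound (R j) M)
    (hTlim : Tendsto T atTop (𝓝 T₀)) (hRlim : Tendsto R atTop (𝓝 R₀))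
    (hc : TraceBound (R₀ - T₀) c) (hε : ∀ j, TraceBound ((R j - T j) - (R₀ - T₀)) (ε j))
    (hεlim : Tendsto ε atTop (𝓝 0)) :
    Tendsto (fun j => trace (negSpec (T j) - negSpec (R j))) atTop
      (𝓝 (trace (negSpec T₀ - negSpec R₀))) := by
  have d1 : Tendsto (fun j => ‖T₀ - T j‖) atTop (𝓝 0) := by
    simpa using (hTlim.const_sub T₀).norm
  have d2 : Tendsto (fun j => ‖R₀ - R j‖) atTop (𝓝 0) := by
    simpa using (hRlim.const_sub R₀).norm
  have hlim : Tendsto (fun j => (M * ε j * M + M * (‖T₀ - T j‖ * M * c) * M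
      + M * (c * (M * ‖R₀ - R j‖)) * M) / 2) atTop (𝓝 0) := by
    have := ((((hεlim.const_mul M).mul_const M).add
      ((((d1.mul_const M).mul_const c).const_mul M).mul_const M)).add
      ((((d2.const_mul M).const_mul c).const_mul M).mul_const M)).div_const 2
    simpa using this
  rw [tendsto_iff_norm_sub_tendsto_zero]
  refine squeeze_zero' (Eventually.of_forall fun _ => norm_nonneg _) ?_ hlim
  filter_upwards [hT, hR] with j h1 h2
  have b := traceBound_negSpec_sub_sub hT₀ hR₀ h1 h2 hc (hε j) le_rfl le_rfl
  have b0 := traceBound_negSpec_sub hT₀ hR₀ hc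
  have b1 := b.add b0
  rw [sub_add_cancel] at b1
  rw [← b1.trace_sub b0]
  exact b.norm_trace_le

/-- The index of `(negSpec (R j), negSpec R₀)` vanishes as soon as the two projections are at distance
less than one. -/
theorem eventually_pairIndex_negSpec_eq {R : ℕ → H →L[ℂ] H} {R₀ S : H →L[ℂ] H} {M : ℝ}
    (hR₀ : IsSelfAdjoint R₀) (hR₀u : IsUnit R₀) (hR₀M : ResolventBound R₀ M)
    (hR : ∀ j, IsSelfAdjoint (R j))
    (hRM : ∀ᶠ j in atTop, IsUnit (R j) ∧ ResolventBound (R j) M)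
    (hRlim : Tendsto R atTop (𝓝 R₀)) (hS : IsSelfAdjoint S) (hSu : IsUnit S)
    (hRc : ∀ j, IsCompactOperator (R₀ - R j : H →L[ℂ] H))
    (hSc : IsCompactOperator (S - R₀ : H →L[ℂ] H)) :
    ∀ᶠ j in atTop, pairIndex (negSpec (R j)) (negSpec S) = pairIndex (negSpec R₀) (negSpec S) := by
  have hlim : Tendsto (fun j => M * ‖R₀ - R j‖ * M / 2) atTop (𝓝 0) := by
    have d : Tendsto (fun j => ‖R₀ - R j‖) atTop (𝓝 0) := by
      simpa using (hRlim.const_sub R₀).norm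
    simpa using ((d.const_mul M).mul_const M).div_const 2
  filter_upwards [hRM, hlim.eventually_lt_const one_pos] with j h1 h2
  have hSb := (isDissipative_of_isSelfAdjoint hS).resolventBound hSu
  have p := isStarProjection_negSpec (hR j) h1.1
  have p₀ := isStarProjection_negSpec hR₀ hR₀u
  have k1 := isCompactOperator_negSpec_sub h1.2 hR₀M (hRc j)
    (by rw [(hR₀.sub (hR j)).star_eq]; exact hRc j)
  have k2 := isCompactOperator_negSpec_sub hR₀M hSb hSc (by rwa [(hS.sub hR₀).star_eq])
  rw [pairIndex_add p (isStarProjection_negSpec hS hSu) p₀ k1 k2,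
    pairIndex_eq_zero_of_norm_lt p p₀ k1 ((norm_negSpec_sub_le h1.2 hR₀M).trans_lt h2), zero_add]

end Continuity

end Trindex

end


open Trindex in
theorem mainTheorem7 {H : Type*} [NormedAddCommGroup H] [InnerProductSpace ℂ H] [CompleteSpace H]
    [TopologicalSpace.SeparableSpace H]
    (S A B : H →L[ℂ] H)
    (hS : IsSelfAdjoint S)
    (hA : IsSelfAdjoint A) (hA_compact : IsCompactOperator A)
    (hB : B.IsPositive) (hB_trace : Trindex.IsTraceClass B)
    (hinv : ∃ τ₀ : ℝ, IsUnit (S + A + (τ₀ : ℂ) • B))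
    (Aseq Bseq : ℕ → H →L[ℂ] H)
    (hAseq : ∀ j, IsSelfAdjoint (Aseq j)) (hAseq_compact : ∀ j, IsCompactOperator (Aseq j))
    (hBseq : ∀ j, (Bseq j).IsPositive) (hBseq_trace : ∀ j, Trindex.IsTraceClass (Bseq j))
    (hA_lim : Tendsto (fun j => ‖Aseq j - A‖) atTop (𝓝 0))
    (hB_lim : Tendsto (fun j => Trindex.traceNorm (Bseq j - B)) atTop (𝓝 0)) :
    Trindex.HasTrindex (Trindex.Xi (S + A + Complex.I • B)) (Trindex.Xi S) ∧
    (∀ j, Trindex.HasTrindex (Trindex.Xi (S + Aseq j + Complex.I • Bseq j)) (Trindex.Xi S)) ∧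
    Tendsto (fun j => Trindex.trindex (Trindex.Xi (S + Aseq j + Complex.I • Bseq j)) (Trindex.Xi S))
      atTop (𝓝 (Trindex.trindex (Trindex.Xi (S + A + Complex.I • B)) (Trindex.Xi S))) := by
  obtain ⟨τ, hW⟩ := hinv
  have hBb := traceBound_of_isTraceClass hB.isSelfAdjoint hB_trace
  have hBjb := fun j => traceBound_of_isTraceClass (hBseq j).isSelfAdjoint (hBseq_trace j)
  have hSW : IsCompactOperator (S - (S + A + (τ : ℂ) • B) : H →L[ℂ] H) := by
    rw [show S - (S + A + (τ : ℂ) • B) = -(A + (τ : ℂ) • B) by abel]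
    exact (hA_compact.add (hBb.smul _).isCompactOperator).neg
  refine ⟨hasTrindex_Xi hS hA hA_compact hB hB_trace hW hSW, fun j =>
    hasTrindex_Xi hS (hAseq j) (hAseq_compact j) (hBseq j) (hBseq_trace j) hW hSW, ?_⟩
  have hτ : IsSelfAdjoint (τ : ℂ) := Complex.conj_ofReal τ
  have hsaR : IsSelfAdjoint (S + A + (τ : ℂ) • B) := (hS.add hA).add (hτ.smul hB.isSelfAdjoint)
  have hsaRj : ∀ j, IsSelfAdjoint (S + Aseq j + (τ : ℂ) • Bseq j) := fun j =>
    (hS.add (hAseq j)).add (hτ.smul (hBseq j).isSelfAdjoint)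
  have hdT := isDissipative_add_I_smul (hS.add hA) hB
  have hdTj := fun j => isDissipative_add_I_smul (hS.add (hAseq j)) (hBseq j)
  have hA_lim' : Tendsto Aseq atTop (𝓝 A) := tendsto_iff_norm_sub_tendsto_zero.2 hA_lim
  have hfin : ∀ j, traceNorm (Bseq j - B) ≠ ⊤ := fun j =>
    (((hBjb j).sub hBb).isTraceClass ((hBseq j).isSelfAdjoint.sub hB.isSelfAdjoint)).ne
  have hε : Tendsto (fun j => (traceNorm (Bseq j - B)).toReal) atTop (𝓝 0) :=
    (ENNReal.tendsto_toReal ENNReal.zero_ne_top).comp hB_lim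
  have hB_lim' : Tendsto Bseq atTop (𝓝 B) := by
    refine tendsto_iff_norm_sub_tendsto_zero.2 (squeeze_zero (fun _ => norm_nonneg _)
      (fun j => ?_) hε)
    exact (ENNReal.ofReal_le_iff_le_toReal (hfin j)).1 (ofReal_norm_le_traceNorm _)
  have hTlim := (tendsto_const_nhds (x := S)).add hA_lim' |>.add (hB_lim'.const_smul Complex.I)
  have hRlim := (tendsto_const_nhds (x := S)).add hA_lim' |>.add (hB_lim'.const_smul (τ : ℂ))
  -- A vector in the kernel of `S + A + iB` is in the kernels of `B` and of `S + A`, and hence in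
  -- that of `S + A + τB`.
  have hTu : IsUnit (S + A + Complex.I • B) := by
    have e : S + A + Complex.I • B = (S + A + (τ : ℂ) • B) + (Complex.I - τ) • B := by
      rw [sub_smul]; abel
    rw [e]
    refine isUnit_of_injective_of_compact hW (hBb.smul _).isCompactOperator fun x hx => ?_
    rw [← e] at hx
    obtain ⟨h1, h2⟩ := apply_eq_zero_of_add_I_smul (hS.add hA) hB hx
    have h3 : (S + A + (τ : ℂ) • B) x = 0 := by
      rw [_root_.add_apply, h1, _root_.smul_apply, h2, smul_zero, add_zero]
    have h4 : Ring.inverse (S + A + (τ : ℂ) • B) ((S + A + (τ : ℂ) • B) x) = x :=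
      congr($(Ring.inverse_mul_cancel _ hW) x)
    rw [← h4, h3, map_zero]
  obtain ⟨M₁, hM₁, hev₁⟩ := exists_eventually_resolventBound hdTj hdT hTu hTlim
  obtain ⟨M₂, hM₂, hev₂⟩ := exists_eventually_resolventBound
    (fun j => isDissipative_of_isSelfAdjoint (hsaRj j)) (isDissipative_of_isSelfAdjoint hsaR)
    hW hRlim
  -- `S` itself need not be invertible, but `S + P` is.
  obtain ⟨P, hP, ⟨c, hc⟩, hSu, eS⟩ := exists_Xi_eq_negSpec_of_isSelfAdjoint hS hW hSW
  have hSP := hS.add hP.isSelfAdjoint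
  have hTR : TraceBound (S + A + (τ : ℂ) • B - (S + A + Complex.I • B))
      (‖(τ : ℂ) - Complex.I‖ * (3 * (traceNorm B).toReal)) := by
    rw [show S + A + (τ : ℂ) • B - (S + A + Complex.I • B) = ((τ : ℂ) - Complex.I) • B by
      rw [sub_smul]; abel]
    exact hBb.smul _
  have hTRj : ∀ j, TraceBound (S + Aseq j + (τ : ℂ) • Bseq j - (S + Aseq j + Complex.I • Bseq j))
      (‖(τ : ℂ) - Complex.I‖ * (3 * (traceNorm (Bseq j)).toReal)) := fun j => by
    rw [show S + Aseq j + (τ : ℂ) • Bseq j - (S + Aseq j + Complex.I • Bseq j)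
      = ((τ : ℂ) - Complex.I) • Bseq j by rw [sub_smul]; abel]
    exact (hBjb j).smul _
  have hRS : IsCompactOperator (S + P - (S + A + (τ : ℂ) • B) : H →L[ℂ] H) := by
    rw [add_sub_right_comm]
    exact hSW.add hc.isCompactOperator
  have hRR : ∀ j, IsCompactOperator
      (S + A + (τ : ℂ) • B - (S + Aseq j + (τ : ℂ) • Bseq j) : H →L[ℂ] H) := fun j => by
    rw [show S + A + (τ : ℂ) • B - (S + Aseq j + (τ : ℂ) • Bseq j)
      = (A + (τ : ℂ) • B) - (Aseq j + (τ : ℂ) • Bseq j) by abel]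
    exact (hA_compact.add (hBb.smul _).isCompactOperator).sub
      ((hAseq_compact j).add ((hBjb j).smul _).isCompactOperator)
  have htr := tendsto_trace_negSpec_sub (M := max M₁ M₂)
    (ε := fun j => ‖(τ : ℂ) - Complex.I‖ * (3 * (traceNorm (Bseq j - B)).toReal))
    (hM₁.mono (le_max_left _ _)) (hM₂.mono (le_max_right _ _))
    (hev₁.mono fun j h => h.2.mono (le_max_left _ _))
    (hev₂.mono fun j h => h.2.mono (le_max_right _ _)) hTlim hRlim hTR
    (fun j => by
      rw [show S + Aseq j + (τ : ℂ) • Bseq j - (S + Aseq j + Complex.I • Bseq j)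
          - (S + A + (τ : ℂ) • B - (S + A + Complex.I • B))
        = ((τ : ℂ) - Complex.I) • (Bseq j - B) by rw [sub_smul, smul_sub, smul_sub]; abel]
      exact (traceBound_of_isTraceClass ((hBseq j).isSelfAdjoint.sub hB.isSelfAdjoint)
        (hfin j).lt_top).smul _)
    (by simpa using (hε.const_mul 3).const_mul ‖(τ : ℂ) - Complex.I‖)
  have hidx := eventually_pairIndex_negSpec_eq hsaR hW hM₂ hsaRj hev₂ hRlim hSP hSu hRR hRS
  rw [eS, Xi_eq_negSpec_of_isUnit hdT hTu, (trindex_negSpec hdT hTu hsaR hW hSP hSu hTR hRS).2]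
  refine (htr.add_const _).congr' ?_
  filter_upwards [hev₁, hev₂, hidx] with j h1 h2 h3
  have hRSj : IsCompactOperator (S + P - (S + Aseq j + (τ : ℂ) • Bseq j) : H →L[ℂ] H) := by
    rw [← sub_add_sub_cancel]
    exact hRS.add (hRR j)
  rw [Xi_eq_negSpec_of_isUnit (hdTj j) h1.1,
    (trindex_negSpec (hdTj j) h1.1 (hsaRj j) h2.1 hSP hSu (hTRj j) hRSj).2, h3]
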